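/- Let $\mathbb{F}=\mathbb{Z}/2\mathbb{Z}$ and let $\operatorname{rk}\widetilde{\operatorname{Kh}}(L)$ denote the total rank (the dimension over $\mathbb{F}$, summed over all gradings) of the reduced Khovanov homology of a link $L\subset S^3$ with coefficients in $\mathbb{F}$. Let $K=T_{2,5}$ be the cinqfoil (the knot $5_1$), and let $T=(B^3,\tau)$ be the quotient tangle of its strong inversion, so that the complement of $K$ is the two-fold branched cover of $T$, framed so that the denominator closure $\tau(\frac10)$ is the unknot and the numerator closure $\tau(0)$ is a branch set for the zero surgery on $K$. Explicitly, write $A+B$ for the horizontal sum of tangle diagrams, $\rho(A)$ for the rotation of $A$ by a counterclockwise quarter turn, $n$ for the horizontal row of $|n|$ half twists (in the half twist $+1$ the over-strand runs from north-west to south-east), and let rotation realise $r\mapsto -1/r$ on rational tangles. Then $$T=\rho\left(-\tfrac12+\tfrac25\right)+(-10),\qquad -\tfrac12=\rho(2),\qquad \tfrac25=\rho\left((-2)+\rho(2)\right).$$ For $n>0$ let $\tau(\pm\frac1n)$ be the numerator closure of $T+(\pm\frac1n)$, where $\pm\frac1n=\rho(\mp n)$; it is the branch set of a two-fold branched cover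 $\mathbf{\Sigma}(S^3,\tau(\pm\frac1n))\cong S^3_{\pm1/n}(K)$. Then for every integer $n>0$, $$\operatorname{rk}\widetilde{\operatorname{Kh}}\left(\tau(\tfrac1n)\right)\le 16n-1\qquad\text{and}\qquad \operatorname{rk}\widetilde{\operatorname{Kh}}\left(\tau(-\tfrac1n)\right)\le 16n+1 .$$ -/

import Mathlib

/-! ### Planar diagrams

A diagram is recorded by a finite set `Pt` of marked points on the projection, a finite set `Cr`
of crossings, and a relation `wire` listing the crossingless segments between marked points.
`cross c = ![i, j, k, l]` lists the four marked points adjacent to the crossing `c`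
counterclockwise, where `i, k` are the ends of the under-strand and `j, l` are the ends of the
over-strand (the usual planar diagram notation `X[i, j, k, l]`). -/

structure PlanarDiagram where
  Pt : Type
  Cr : Type
  finPt : Finite Pt
  finCr : Finite Cr
  cross : Cr → Fin 4 → Pt
  wire : Pt → Pt → Prop

namespace PlanarDiagram

instance (D : PlanarDiagram) : Finite D.Pt := D.finPt

instance (D : PlanarDiagram) : Finite D.Cr := D.finCr

/-- The segments of the complete smoothing of `D` at the vertex `σ` of the cube: the wires,
and at every crossing `X[i, j, k, l]` the segments `ij`, `kl` of its `0`-smoothing, or the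
segments `il`, `jk` of its `1`-smoothing. -/
def Joined (D : PlanarDiagram) (σ : D.Cr → Bool) (p q : D.Pt) : Prop :=
  D.wire p q ∨ ∃ c : D.Cr,
    (σ c = false ∧ ((p = D.cross c 0 ∧ q = D.cross c 1) ∨ (p = D.cross c 2 ∧ q = D.cross c 3))) ∨
    (σ c = true ∧ ((p = D.cross c 0 ∧ q = D.cross c 3) ∨ (p = D.cross c 1 ∧ q = D.cross c 2)))

/-- Two marked points lie on the same circle of the complete smoothing at `σ`. -/
def SameCircle (D : PlanarDiagram) (σ : D.Cr → Bool) (p q : D.Pt) : Prop :=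
  Relation.EqvGen (D.Joined σ) p q

/-! ### Reduced Khovanov homology with coefficients in the field of two elements

The algebra of the theory is `𝔽[X]/(X²)` with basis `1, X`, multiplication
`1·1 = 1`, `1·X = X·1 = X`, `X·X = 0` and comultiplication
`Δ 1 = 1 ⊗ X + X ⊗ 1`, `Δ X = X ⊗ X`. -/

/-- Enhanced states: a vertex `smoothing` of the cube together with a label `1` or `X` on each
circle of the corresponding complete smoothing. The label is recorded at the marked points:
`isX p = true` if the circle through `p` is labelled `X`, and `isX p = false` if it is
labelled `1`. -/
@[ext]
structure EnhancedState (D : PlanarDiagram) where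
  smoothing : D.Cr → Bool
  isX : D.Pt → Bool
  compat : ∀ p q, D.Joined smoothing p q → isX p = isX q

instance (D : PlanarDiagram) : Finite D.EnhancedState :=
  Finite.of_injective (fun S => (S.smoothing, S.isX)) (by
    intro S T h
    exact EnhancedState.ext (congrArg Prod.fst h) (congrArg Prod.snd h))

/-- The generators of the reduced complex: the circle through the base point is labelled `X`. -/
def ReducedState (D : PlanarDiagram) (base : D.Pt) : Type :=
  {S : D.EnhancedState // S.isX base = true}

instance (D : PlanarDiagram) (base : D.Pt) : Finite (D.ReducedState base) :=
  inferInstanceAs (Finite {S : D.EnhancedState // S.isX base = true})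

noncomputable instance (D : PlanarDiagram) (base : D.Pt) : Fintype (D.ReducedState base) :=
  Fintype.ofFinite _

open Classical in
/-- `T` occurs in the differential of `S`: there is a crossing `c` which is `0`-smoothed in `S`
and `1`-smoothed in `T`, all other crossings being smoothed in the same way; the circles which
do not pass through `c` carry the same labels in `S` and in `T`; and either two circles of `S`
merge at `c` and the label of the resulting circle is the product, or a circle of `S` splits at `c`
and the two resulting labels occur in the coproduct of its label. Both conditions are written
by counting labels `X`. -/
def EnhancedState.Incident {D : PlanarDiagram} (S T : D.EnhancedState) : Prop :=
  ∃ c : D.Cr, S.smoothing c = false ∧ T.smoothing = Function.update S.smoothing c true ∧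
    (∀ p, ¬ D.SameCircle S.smoothing p (D.cross c 0) → ¬ D.SameCircle S.smoothing p (D.cross c 2) →
      T.isX p = S.isX p) ∧
    ((¬ D.SameCircle S.smoothing (D.cross c 0) (D.cross c 2) ∧
        D.SameCircle T.smoothing (D.cross c 0) (D.cross c 2) ∧
        (T.isX (D.cross c 0)).toNat = (S.isX (D.cross c 0)).toNat + (S.isX (D.cross c 2)).toNat) ∨
      (D.SameCircle S.smoothing (D.cross c 0) (D.cross c 2) ∧
        ¬ D.SameCircle T.smoothing (D.cross c 0) (D.cross c 2) ∧
        (T.isX (D.cross c 0)).toNat + (T.isX (D.cross c 2)).toNat =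
          (S.isX (D.cross c 0)).toNat + 1))

open Classical in
/-- The differential of the reduced Khovanov complex, on the vector space with basis
the reduced enhanced states. -/
noncomputable def differential (D : PlanarDiagram) (base : D.Pt) :
    (D.ReducedState base → ZMod 2) →ₗ[ZMod 2] (D.ReducedState base → ZMod 2) :=
  Matrix.toLin' (Matrix.of fun T S : D.ReducedState base =>
    if S.1.Incident T.1 then (1 : ZMod 2) else 0)

/-- The total rank of reduced Khovanov homology: the dimension over the field of two elements of
cycles modulo boundaries (the direct sum over all gradings). -/
noncomputable def rkKh (D : PlanarDiagram) (base : D.Pt) : ℕ :=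
  Module.finrank (ZMod 2) (LinearMap.ker (D.differential base) ⧸
    (LinearMap.range (D.differential base)).submoduleOf (LinearMap.ker (D.differential base)))

end PlanarDiagram

/-! ### Tangles -/

/-- A tangle diagram in a disk with four boundary points. -/
structure TangleDiagram extends PlanarDiagram where
  nw : Pt
  ne : Pt
  sw : Pt
  se : Pt

namespace TangleDiagram

/-- The tangle `0`, consisting of two horizontal arcs. In `zero` and `crossing` the corners
north-west, north-east, south-west, south-east are `0, 1, 2, 3`. -/
def zero : TangleDiagram where
  Pt := Fin 4
  Cr := Empty
  finPt := inferInstance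
  finCr := inferInstance
  cross := fun c => c.elim
  wire := fun p q => (p = 0 ∧ q = 1) ∨ (p = 2 ∧ q = 3)
  nw := 0
  ne := 1
  sw := 2
  se := 3

/-- The tangles `+1` (for `true`) and `-1` (for `false`) consisting of a single crossing. The
over-strand of `+1` runs from north-west to south-east, the over-strand of `-1` from south-west
to north-east. -/
def crossing (positive : Bool) : TangleDiagram where
  Pt := Fin 4
  Cr := Unit
  finPt := inferInstance
  finCr := inferInstance
  cross := fun _ => if positive then ![2, 3, 1, 0] else ![3, 1, 0, 2]
  wire := fun _ _ => False
  nw := 0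
  ne := 1
  sw := 2
  se := 3

/-- The sum `A + B`: place `A` to the left of `B` and join the two eastern ends of `A` to
the two western ends of `B`. -/
def add (A B : TangleDiagram) : TangleDiagram where
  Pt := A.Pt ⊕ B.Pt
  Cr := A.Cr ⊕ B.Cr
  finPt := inferInstance
  finCr := inferInstance
  cross := Sum.elim (fun c i => Sum.inl (A.cross c i)) (fun c i => Sum.inr (B.cross c i))
  wire := fun p q =>
    match p, q with
    | Sum.inl p, Sum.inl q => A.wire p q
    | Sum.inr p, Sum.inr q => B.wire p q
    | Sum.inl p, Sum.inr q => (p = A.ne ∧ q = B.nw) ∨ (p = A.se ∧ q = B.sw)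
    | Sum.inr _, Sum.inl _ => False
  nw := Sum.inl A.nw
  ne := Sum.inr B.ne
  sw := Sum.inl A.sw
  se := Sum.inr B.se

/-- Rotation by a quarter turn counterclockwise, which takes the rational tangle `r`
to the rational tangle `-1/r`. -/
def rot (A : TangleDiagram) : TangleDiagram where
  toPlanarDiagram := A.toPlanarDiagram
  nw := A.ne
  ne := A.se
  sw := A.nw
  se := A.sw

/-- The integral tangle `n` (for `true`) or `-n` (for `false`): a row of `n` half twists. -/
def twist (positive : Bool) : ℕ → TangleDiagram
  | 0 => zero
  | n + 1 => (twist positive n).add (crossing positive)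

/-- The numerator closure: the two northern ends are joined, and so are the two southern ends. -/
def numerator (A : TangleDiagram) : PlanarDiagram :=
  { A.toPlanarDiagram with
    wire := fun p q => A.wire p q ∨ (p = A.nw ∧ q = A.ne) ∨ (p = A.sw ∧ q = A.se) }

/-- The rational tangle `-1/2`. -/
def minusHalf : TangleDiagram := (twist true 2).rot

/-- The rational tangle `2/5 = -1/(-2 - 1/2)`. -/
def twoFifths : TangleDiagram := ((twist false 2).add (twist true 2).rot).rot

/-- The quotient tangle of the strong inversion on the cinqfoil: the Montesinos
tangle `-1/2 + 2/5`, whose two-fold branched cover is Seifert fibered over the disk with exceptional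
fibres of orders `2` and `5`, turned by a quarter turn. The ten half twists normalise the
framing: the denominator closure is the unknot (trivial surgery), and the
numerator closure is the branch set of the zero surgery. -/
def cinqfoil : TangleDiagram := (minusHalf.add twoFifths).rot.add (twist false 10)

/-- The rational tangle `1/n` (for `true`) or `-1/n` (for `false`): a column of `n` half twists. -/
def reciprocal (positive : Bool) (n : ℕ) : TangleDiagram := (twist (!positive) n).rot

/-- The branch set `τ(1/n)` (for `true`) or `τ(-1/n)` (for `false`) of the surgery with
coefficient `1/n` or `-1/n` on the cinqfoil. -/
def branchSet (positive : Bool) (n : ℕ) : PlanarDiagram :=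
  (cinqfoil.add (reciprocal positive n)).numerator

/-- The base point used for reduced homology: the north-western end of the quotient tangle. -/
def branchSetBase (positive : Bool) (n : ℕ) : (branchSet positive n).Pt :=
  (cinqfoil.add (reciprocal positive n)).nw

end TangleDiagram

/-! The branch set is the closure of the cinqfoil tangle with a column of half twists. Turning the
cinqfoil tangle instead of the column makes the column a row (`khRank_closure_rot`). Smoothing the
last crossing of a row in its two ways either shortens the row or replaces that crossing by the
tangle `∞`; in the second case the rest of the row consists of kinks, which the first Reidemeister
move removes. By the exact triangle each half twist therefore costs at most the rank of one fixed
closure (`khRank_closure_twist_le`). Here that closure is the branch set of the zero surgery, which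
is the Montesinos tangle closed with `-10`.

The same estimate bounds this constant. The Montesinos tangle closed with `-3` has rank at most 9
and its closure with `∞` has rank at most 1, so `-9` gives at most 15 and `-10` at most 16. For
`τ(-1/n)` the induction starts with the empty column, where the ten framing twists unwind and the
rank is at most 1: the total is `1 + 16n`. For `τ(1/n)` it starts with one half twist, which cancels
one of the ten by the second Reidemeister move (`khRank_closure_bigon_le`) and leaves `-9`: the
total is `15 + 16(n - 1)`.

All these steps are inequalities for `homRank`, the dimension minus twice the rank, and amount to
lower bounds for ranks of matrices. They do not need the differential to square to zero. That fact
(`incidence_mul_self`) is used only to identify cycles modulo boundaries with `homRank`. Since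
diagrams are combinatorial, planarity is replaced by the parity condition `IsEven`, which is
preserved by the tangle operations.

The two initial values come from a verified computation: one program bounds the number of generators
from above, and another finds independent columns of the differential by Gaussian elimination and so
bounds its rank from below (`Numbering.khRank_le`). -/

namespace Matrix

/-! ### Linear algebra: ranks of block matrices and cancellation in a complex. -/

variable {F : Type*} [Field F]

/-- The first block of a kernel vector lies in the kernel of `A`, and the kernel vectors whose first
block vanishes embed in the kernel of `D`. Nullities are thus subadditive, and rank-nullity turns
this around. -/
theorem rank_fromBlocks_lower_ge {m n p q : Type*} [Fintype m] [Fintype n] [Fintype p]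
    [Fintype q] (A : Matrix m n F) (C : Matrix p n F) (D : Matrix p q F) :
    A.rank + D.rank ≤ (fromBlocks A 0 C D).rank := by
  have hA := A.mulVecLin.finrank_range_add_finrank_ker
  have hD := D.mulVecLin.finrank_range_add_finrank_ker
  have hM := (fromBlocks A 0 C D).mulVecLin.finrank_range_add_finrank_ker
  let f : LinearMap.ker (fromBlocks A 0 C D).mulVecLin →ₗ[F] LinearMap.ker A.mulVecLin :=
    { toFun := fun v => ⟨v.1 ∘ Sum.inl, by
        have h := v.2
        rw [LinearMap.mem_ker, mulVecLin_apply, fromBlocks_mulVec] at h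
        rw [LinearMap.mem_ker, mulVecLin_apply]
        ext i
        simpa using congrFun h (Sum.inl i)⟩
      map_add' := fun _ _ => rfl
      map_smul' := fun _ _ => rfl }
  let g : LinearMap.ker f →ₗ[F] LinearMap.ker D.mulVecLin :=
    { toFun := fun v => ⟨v.1.1 ∘ Sum.inr, by
        have h := v.1.2
        have h0 : v.1.1 ∘ Sum.inl = 0 := congrArg Subtype.val v.2
        rw [LinearMap.mem_ker, mulVecLin_apply, fromBlocks_mulVec, h0] at h
        rw [LinearMap.mem_ker, mulVecLin_apply]
        ext i
        simpa using congrFun h (Sum.inr i)⟩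
      map_add' := fun _ _ => rfl
      map_smul' := fun _ _ => rfl }
  have hg : Function.Injective g := by
    intro v w h
    have hv : v.1.1 ∘ Sum.inl = 0 := congrArg Subtype.val v.2
    have hw : w.1.1 ∘ Sum.inl = 0 := congrArg Subtype.val w.2
    have h2 := congrArg Subtype.val h
    ext i
    rcases i with i | i
    · exact (congrFun hv i).trans (congrFun hw i).symm
    · exact congrFun h2 i
  have h1 := f.finrank_range_add_finrank_ker
  have h2 := LinearMap.finrank_le_finrank_of_injective hg
  have h3 := Submodule.finrank_le (LinearMap.range f)
  simp only [Module.finrank_fintype_fun_eq_card, Fintype.card_sum] at hA hD hM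
  unfold rank
  omega

/-- Since `C * B = 0`, the Schur complement of the identity block is `D` itself: a kernel vector is
determined by its second block, which lies in the kernel of `D`. -/
theorem rank_fromBlocks_one_ge {m q : Type*} [Fintype m] [Fintype q] [DecidableEq m]
    (B : Matrix m q F) (C : Matrix q m F) (D : Matrix q q F) (h : C * B = 0) :
    Fintype.card m + D.rank ≤ (fromBlocks 1 B C D).rank := by
  have hD := D.mulVecLin.finrank_range_add_finrank_ker
  have hM := (fromBlocks 1 B C D).mulVecLin.finrank_range_add_finrank_ker
  have key : ∀ v ∈ LinearMap.ker (fromBlocks 1 B C D).mulVecLin,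
      v ∘ Sum.inl = -(B *ᵥ (v ∘ Sum.inr)) ∧ D *ᵥ (v ∘ Sum.inr) = 0 := by
    intro v hv
    rw [LinearMap.mem_ker, mulVecLin_apply, fromBlocks_mulVec] at hv
    have h1 : v ∘ Sum.inl + B *ᵥ (v ∘ Sum.inr) = 0 := by
      ext i
      simpa using congrFun hv (Sum.inl i)
    have h2 : C *ᵥ (v ∘ Sum.inl) + D *ᵥ (v ∘ Sum.inr) = 0 := by
      ext i
      simpa using congrFun hv (Sum.inr i)
    have h3 := eq_neg_of_add_eq_zero_left h1
    refine ⟨h3, ?_⟩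
    rw [h3, mulVec_neg, mulVec_mulVec, h, zero_mulVec, neg_zero, zero_add] at h2
    exact h2
  let g : LinearMap.ker (fromBlocks 1 B C D).mulVecLin →ₗ[F] LinearMap.ker D.mulVecLin :=
    { toFun := fun v => ⟨v.1 ∘ Sum.inr, (key v.1 v.2).2⟩
      map_add' := fun _ _ => rfl
      map_smul' := fun _ _ => rfl }
  have hg : Function.Injective g := by
    intro v w e
    have h2 : v.1 ∘ Sum.inr = w.1 ∘ Sum.inr := congrArg Subtype.val e
    have h1 : v.1 ∘ Sum.inl = w.1 ∘ Sum.inl := by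
      rw [(key v.1 v.2).1, (key w.1 w.2).1, h2]
    ext i
    rcases i with i | i
    · exact congrFun h1 i
    · exact congrFun h2 i
  have h2 := LinearMap.finrank_le_finrank_of_injective hg
  simp only [Module.finrank_fintype_fun_eq_card, Fintype.card_sum] at hD hM
  unfold rank
  omega

/-- Twice the corank defect of a square matrix: for a differential this is the dimension of its
homology. -/
noncomputable def homRank {I : Type*} [Fintype I] (M : Matrix I I F) : ℤ :=
  (Fintype.card I : ℤ) - 2 * (M.rank : ℤ)

theorem homRank_submatrix {I J : Type*} [Fintype I] [Fintype J] (M : Matrix I I F) (e : J ≃ I) :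
    (M.submatrix e e).homRank = M.homRank := by
  unfold homRank
  rw [rank_submatrix, Fintype.card_congr e]

/-- The homology of a complex with a two step filtration. -/
theorem homRank_le_add {I J K : Type*} [Fintype I] [Fintype J] [Fintype K] (M : Matrix I I F)
    (e : J ⊕ K ≃ I) (h : ∀ j k, M (e (Sum.inl j)) (e (Sum.inr k)) = 0) :
    M.homRank ≤ (M.submatrix (e ∘ Sum.inl) (e ∘ Sum.inl)).homRank +
      (M.submatrix (e ∘ Sum.inr) (e ∘ Sum.inr)).homRank := by
  rw [← homRank_submatrix M e]
  have : M.submatrix e e = fromBlocks (M.submatrix (e ∘ Sum.inl) (e ∘ Sum.inl)) 0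
      (M.submatrix (e ∘ Sum.inr) (e ∘ Sum.inl)) (M.submatrix (e ∘ Sum.inr) (e ∘ Sum.inr)) := by
    ext i j
    rcases i with i | i <;> rcases j with j | j <;> simp [h]
  have h2 := rank_fromBlocks_lower_ge (M.submatrix (e ∘ Sum.inl) (e ∘ Sum.inl))
      (M.submatrix (e ∘ Sum.inr) (e ∘ Sum.inl)) (M.submatrix (e ∘ Sum.inr) (e ∘ Sum.inr))
  rw [← this] at h2
  unfold homRank
  rw [Fintype.card_sum]
  push_cast
  omega

/-- Gaussian elimination of an acyclic piece without correction terms. -/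
theorem homRank_le_of_matching {I A Q : Type*} [Fintype I] [Fintype A] [Fintype Q]
    [DecidableEq A] (M : Matrix I I F) (e : A ⊕ A ⊕ Q ≃ I)
    (h1 : ∀ a b, M (e (Sum.inr (Sum.inl b))) (e (Sum.inl a)) = if b = a then 1 else 0)
    (h0 : ∀ a q r, M (e (Sum.inr (Sum.inr r))) (e (Sum.inl a)) *
      M (e (Sum.inr (Sum.inl a))) (e (Sum.inr (Sum.inr q))) = 0) :
    M.homRank ≤
      (M.submatrix (e ∘ Sum.inr ∘ Sum.inr) (e ∘ Sum.inr ∘ Sum.inr)).homRank := by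
  -- Taking the cancelled targets and `Q` as rows, the cancelled sources and `Q` as columns, puts
  -- the identity in the corner; a submatrix has at most the rank of `M`.
  have hle := M.rank_submatrix_le (Sum.elim (e ∘ Sum.inr ∘ Sum.inl) (e ∘ Sum.inr ∘ Sum.inr))
    (Sum.elim (e ∘ Sum.inl) (e ∘ Sum.inr ∘ Sum.inr))
  have hb : M.submatrix (Sum.elim (e ∘ Sum.inr ∘ Sum.inl) (e ∘ Sum.inr ∘ Sum.inr))
      (Sum.elim (e ∘ Sum.inl) (e ∘ Sum.inr ∘ Sum.inr)) =
      fromBlocks 1 (M.submatrix (e ∘ Sum.inr ∘ Sum.inl) (e ∘ Sum.inr ∘ Sum.inr))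
        (M.submatrix (e ∘ Sum.inr ∘ Sum.inr) (e ∘ Sum.inl))
        (M.submatrix (e ∘ Sum.inr ∘ Sum.inr) (e ∘ Sum.inr ∘ Sum.inr)) := by
    ext i j
    rcases i with i | i <;> rcases j with j | j <;> simp [h1, one_apply]
  have hr := rank_fromBlocks_one_ge
    (M.submatrix (e ∘ Sum.inr ∘ Sum.inl) (e ∘ Sum.inr ∘ Sum.inr))
    (M.submatrix (e ∘ Sum.inr ∘ Sum.inr) (e ∘ Sum.inl))
    (M.submatrix (e ∘ Sum.inr ∘ Sum.inr) (e ∘ Sum.inr ∘ Sum.inr)) (by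
      ext r q
      rw [mul_apply]
      exact Finset.sum_eq_zero fun a _ => h0 a q r)
  rw [← hb] at hr
  unfold homRank
  rw [← Fintype.card_congr e, Fintype.card_sum, Fintype.card_sum]
  push_cast
  have hle' := hr.trans hle
  omega

/-- For a square-zero matrix, cycles modulo boundaries have dimension `homRank`. -/
theorem finrank_ker_quotient_range {I : Type*} [Fintype I] [DecidableEq I] (M : Matrix I I F)
    (h : M * M = 0) :
    (Module.finrank F (LinearMap.ker (toLin' M) ⧸
      (LinearMap.range (toLin' M)).submoduleOf (LinearMap.ker (toLin' M))) : ℤ) =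
      M.homRank := by
  have hle : LinearMap.range (toLin' M) ≤ LinearMap.ker (toLin' M) := by
    rintro _ ⟨v, rfl⟩
    rw [LinearMap.mem_ker, ← LinearMap.comp_apply, ← toLin'_mul, h]
    simp
  have h1 := Submodule.finrank_quotient_add_finrank
    ((LinearMap.range (toLin' M)).submoduleOf (LinearMap.ker (toLin' M)))
  have h2 : Module.finrank F ((LinearMap.range (toLin' M)).submoduleOf
      (LinearMap.ker (toLin' M))) = Module.finrank F (LinearMap.range (toLin' M)) :=
    (Submodule.submoduleOfEquivOfLe hle).finrank_eq
  have h3 := (toLin' M).finrank_range_add_finrank_ker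
  simp only [Module.finrank_fintype_fun_eq_card] at h3
  have h4 : Module.finrank F (LinearMap.range (toLin' M)) = M.rank := by
    rw [rank, toLin'_apply']
  unfold homRank
  omega

end Matrix

/-- The form of the cancellation used for Khovanov complexes: the bijection between cancelled
sources `A` and targets `B` is read off from the nonzero entries, which over the field of two
elements are all 1. Hypothesis `h0` says that no zigzag through a matched pair connects two
survivors, so cancelling leaves the entries between survivors unchanged. -/
theorem Matrix.homRank_le_of_matching_rel {I : Type*} [Fintype I] (M : Matrix I I (ZMod 2))
    (A B : I → Prop) (hd : ∀ i, A i → ¬ B i)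
    (hA : ∀ a, A a → ∃ b, B b ∧ M b a ≠ 0)
    (hA' : ∀ a b b', A a → B b → B b' → M b a ≠ 0 → M b' a ≠ 0 → b = b')
    (hB : ∀ b, B b → ∃ a, A a ∧ M b a ≠ 0)
    (hB' : ∀ a a' b, A a → A a' → B b → M b a ≠ 0 → M b a' ≠ 0 → a = a')
    (h0 : ∀ a b q r, A a → B b → M b a ≠ 0 → ¬ A q → ¬ B q → ¬ A r → ¬ B r →
      M r a = 0 ∨ M b q = 0)
    [Fintype {i // ¬ A i ∧ ¬ B i}] :
    M.homRank ≤ (M.submatrix (Subtype.val : {i // ¬ A i ∧ ¬ B i} → I) Subtype.val).homRank := by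
  classical
  choose m hmB hm using hA
  let e : {i // A i} ⊕ {i // A i} ⊕ {i // ¬ A i ∧ ¬ B i} → I :=
    Sum.elim Subtype.val (Sum.elim (fun a => m a.1 a.2) Subtype.val)
  have he : Function.Bijective e := by
    constructor
    · rintro (a | a | a) (b | b | b) h <;> simp only [e, Sum.elim_inl, Sum.elim_inr] at h
      · rw [Subtype.ext h]
      · exact absurd (hmB b.1 b.2) (h ▸ hd _ a.2)
      · exact absurd a.2 (h ▸ b.2.1)
      · exact absurd (hmB a.1 a.2) (h ▸ hd _ b.2)
      · have := hB' a.1 b.1 _ a.2 b.2 (hmB a.1 a.2) (hm a.1 a.2) (h ▸ hm b.1 b.2)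
        rw [Subtype.ext this]
      · exact absurd (hmB a.1 a.2) (h ▸ b.2.2)
      · exact absurd b.2 (h ▸ a.2.1)
      · exact absurd (hmB b.1 b.2) (h ▸ a.2.2)
      · rw [Subtype.ext h]
    · intro i
      by_cases hAi : A i
      · exact ⟨Sum.inl ⟨i, hAi⟩, rfl⟩
      · by_cases hBi : B i
        · obtain ⟨a, ha, hab⟩ := hB i hBi
          exact ⟨Sum.inr (Sum.inl ⟨a, ha⟩),
            hA' a _ _ ha (hmB a ha) hBi (hm a ha) hab⟩
        · exact ⟨Sum.inr (Sum.inr ⟨i, hAi, hBi⟩), rfl⟩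
  have key := M.homRank_le_of_matching (Equiv.ofBijective e he) (by
    intro a b
    change M (m b.1 b.2) a.1 = _
    split_ifs with h
    · subst h
      exact Fin.eq_one_of_ne_zero _ (hm b.1 b.2)
    · by_contra h2
      exact h (Subtype.ext (hB' _ _ _ b.2 a.2 (hmB b.1 b.2) (hm b.1 b.2) h2))) (by
    intro a q r
    change M r.1 a.1 * M (m a.1 a.2) q.1 = 0
    rcases h0 a.1 _ q.1 r.1 a.2 (hmB a.1 a.2) (hm a.1 a.2) q.2.1 q.2.2 r.2.1 r.2.2 with h | h
    · rw [h, zero_mul]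
    · rw [h, mul_zero])
  convert key using 2
  rfl

/-! ### Circles of a smoothing and the differential near a loop. -/

namespace PlanarDiagram

open Relation Function
open scoped Classical

section SameCircle

variable {D : PlanarDiagram} {σ σ' : D.Cr → Bool} {p q r : D.Pt}

theorem SameCircle.refl (σ : D.Cr → Bool) (p : D.Pt) : D.SameCircle σ p p := EqvGen.refl p

theorem SameCircle.symm (h : D.SameCircle σ p q) : D.SameCircle σ q p := EqvGen.symm _ _ h

theorem SameCircle.trans (h : D.SameCircle σ p q) (h' : D.SameCircle σ q r) :
    D.SameCircle σ p r := EqvGen.trans _ _ _ h h'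

theorem Joined.sameCircle (h : D.Joined σ p q) : D.SameCircle σ p q := EqvGen.rel _ _ h

theorem EnhancedState.isX_eq (S : D.EnhancedState) (h : D.SameCircle S.smoothing p q) :
    S.isX p = S.isX q := by
  induction h with
  | rel x y h => exact S.compat _ _ h
  | refl x => rfl
  | symm x y _ ih => exact ih.symm
  | trans x y z _ _ ih1 ih2 => exact ih1.trans ih2

/-- Either smoothing joins each end of the over-strand to an end of the under-strand. Hence the
circles through a crossing are those through its corners 0 and 2, and only these need to be tested.
-/
theorem sameCircle_cross (σ : D.Cr → Bool) (c : D.Cr) (i : Fin 4) :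
    D.SameCircle σ (D.cross c i) (D.cross c 0) ∨ D.SameCircle σ (D.cross c i) (D.cross c 2) := by
  have j01 : σ c = false → D.SameCircle σ (D.cross c 0) (D.cross c 1) := fun h =>
    Joined.sameCircle (Or.inr ⟨c, Or.inl ⟨h, Or.inl ⟨rfl, rfl⟩⟩⟩)
  have j23 : σ c = false → D.SameCircle σ (D.cross c 2) (D.cross c 3) := fun h =>
    Joined.sameCircle (Or.inr ⟨c, Or.inl ⟨h, Or.inr ⟨rfl, rfl⟩⟩⟩)
  have j03 : σ c = true → D.SameCircle σ (D.cross c 0) (D.cross c 3) := fun h =>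
    Joined.sameCircle (Or.inr ⟨c, Or.inr ⟨h, Or.inl ⟨rfl, rfl⟩⟩⟩)
  have j12 : σ c = true → D.SameCircle σ (D.cross c 1) (D.cross c 2) := fun h =>
    Joined.sameCircle (Or.inr ⟨c, Or.inr ⟨h, Or.inr ⟨rfl, rfl⟩⟩⟩)
  fin_cases i
  · exact Or.inl (SameCircle.refl _ _)
  · rcases h : σ c with _ | _
    · exact Or.inl (j01 h).symm
    · exact Or.inr (j12 h)
  · exact Or.inr (SameCircle.refl _ _)
  · rcases h : σ c with _ | _
    · exact Or.inr (j23 h).symm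
    · exact Or.inl (j03 h).symm

/-- Changing the smoothing at one crossing only affects the circles through that crossing. -/
theorem SameCircle.flip {c : D.Cr} (hσ : ∀ c', c' ≠ c → σ c' = σ' c')
    (h : D.SameCircle σ p q) :
    D.SameCircle σ' p q ∨
      ((D.SameCircle σ' p (D.cross c 0) ∨ D.SameCircle σ' p (D.cross c 2)) ∧
        (D.SameCircle σ' q (D.cross c 0) ∨ D.SameCircle σ' q (D.cross c 2))) := by
  induction h with
  | rel x y h =>
    rcases h with h | ⟨c', h⟩
    · exact Or.inl (Joined.sameCircle (Or.inl h))
    · by_cases hc : c' = c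
      · subst hc
        right
        rcases h with ⟨_, ⟨rfl, rfl⟩ | ⟨rfl, rfl⟩⟩ | ⟨_, ⟨rfl, rfl⟩ | ⟨rfl, rfl⟩⟩ <;>
          exact ⟨sameCircle_cross _ _ _, sameCircle_cross _ _ _⟩
      · rw [hσ c' hc] at h
        exact Or.inl (Joined.sameCircle (Or.inr ⟨c', h⟩))
  | refl x => exact Or.inl (SameCircle.refl _ _)
  | symm x y _ ih =>
    rcases ih with ih | ih
    · exact Or.inl ih.symm
    · exact Or.inr ih.symm
  | trans x y z _ _ ih1 ih2 =>
    rcases ih1 with h1 | h1 <;> rcases ih2 with h2 | h2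
    · exact Or.inl (h1.trans h2)
    · exact Or.inr ⟨h2.1.imp h1.trans h1.trans, h2.2⟩
    · exact Or.inr ⟨h1.1, h1.2.imp h2.symm.trans h2.symm.trans⟩
    · exact Or.inr ⟨h1.1, h2.2⟩

/-- A set of points closed under adjacency is closed under lying on the same circle. -/
theorem SameCircle.mem_iff {K : Set D.Pt} (hK : ∀ p q, D.Joined σ p q → (p ∈ K ↔ q ∈ K))
    (h : D.SameCircle σ p q) : p ∈ K ↔ q ∈ K := by
  induction h with
  | rel x y h => exact hK _ _ h
  | refl x => exact Iff.rfl
  | symm x y _ ih => exact ih.symm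
  | trans x y z _ _ ih1 ih2 => exact ih1.trans ih2

end SameCircle

/-- The two points `u`, `v` are the ends of the under-strand at `c`. -/
def IsUnder (D : PlanarDiagram) (c : D.Cr) (u v : D.Pt) : Prop :=
  (u = D.cross c 0 ∧ v = D.cross c 2) ∨ (u = D.cross c 2 ∧ v = D.cross c 0)

theorem SameCircle.flip' {D : PlanarDiagram} {σ σ' : D.Cr → Bool} {p q u v : D.Pt} {c : D.Cr}
    (huv : D.IsUnder c u v) (hσ : ∀ c', c' ≠ c → σ c' = σ' c') (h : D.SameCircle σ p q) :
    D.SameCircle σ' p q ∨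
      ((D.SameCircle σ' p u ∨ D.SameCircle σ' p v) ∧
        (D.SameCircle σ' q u ∨ D.SameCircle σ' q v)) := by
  rcases huv with ⟨rfl, rfl⟩ | ⟨rfl, rfl⟩
  · exact h.flip hσ
  · exact (h.flip hσ).imp id fun h => ⟨h.1.symm, h.2.symm⟩

theorem EnhancedState.Incident.exists_update {D : PlanarDiagram} {S T : D.EnhancedState}
    (h : S.Incident T) :
    ∃ c, S.smoothing c = false ∧ T.smoothing = update S.smoothing c true := by
  obtain ⟨c, h1, h2, -⟩ := h
  exact ⟨c, h1, h2⟩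

/-- The two smoothings determine the crossing at which they differ, which removes the existential
quantifier. The remaining condition is symmetric in the two ends because labels are constant on
circles. -/
theorem EnhancedState.incident_iff {D : PlanarDiagram} {S T : D.EnhancedState} {c : D.Cr}
    {u v : D.Pt} (huv : D.IsUnder c u v) (hc : S.smoothing c = false)
    (hT : T.smoothing = update S.smoothing c true) :
    S.Incident T ↔
      (∀ p, ¬ D.SameCircle S.smoothing p u → ¬ D.SameCircle S.smoothing p v →
        T.isX p = S.isX p) ∧
      ((¬ D.SameCircle S.smoothing u v ∧ D.SameCircle T.smoothing u v ∧
          (T.isX u).toNat = (S.isX u).toNat + (S.isX v).toNat) ∨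
        (D.SameCircle S.smoothing u v ∧ ¬ D.SameCircle T.smoothing u v ∧
          (T.isX u).toNat + (T.isX v).toNat = (S.isX u).toNat + 1)) := by
  have huniq : ∀ c', S.smoothing c' = false → T.smoothing = update S.smoothing c' true →
      c' = c := by
    intro c' h1 h2
    by_contra hne
    have := congrFun (hT.symm.trans h2) c'
    rw [update_of_ne hne, update_self, h1] at this
    exact absurd this (by simp)
  constructor
  · rintro ⟨c', h1, h2, h3, h4⟩
    obtain rfl := huniq c' h1 h2
    rcases huv with ⟨rfl, rfl⟩ | ⟨rfl, rfl⟩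
    · exact ⟨h3, h4⟩
    · refine ⟨fun p hp hq => h3 p hq hp, ?_⟩
      rcases h4 with ⟨a, b, e⟩ | ⟨a, b, e⟩
      · refine Or.inl ⟨fun h => a h.symm, b.symm, ?_⟩
        rw [← T.isX_eq b, e, add_comm]
      · refine Or.inr ⟨a.symm, fun h => b h.symm, ?_⟩
        rw [add_comm, e, S.isX_eq a]
  · rintro ⟨h3, h4⟩
    refine ⟨c, hc, hT, ?_⟩
    rcases huv with ⟨rfl, rfl⟩ | ⟨rfl, rfl⟩
    · exact ⟨h3, h4⟩
    · refine ⟨fun p hp hq => h3 p hq hp, ?_⟩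
      rcases h4 with ⟨a, b, e⟩ | ⟨a, b, e⟩
      · refine Or.inl ⟨fun h => a h.symm, b.symm, ?_⟩
        rw [← T.isX_eq b, e, add_comm]
      · refine Or.inr ⟨a.symm, fun h => b h.symm, ?_⟩
        rw [add_comm, e, S.isX_eq a]

/-- `K` is a circle of the smoothing `σ` which meets the under-strand `u`, `v` of a crossing
in `u` only. -/
structure IsLoop (D : PlanarDiagram) (σ : D.Cr → Bool) (K : Set D.Pt) (u v : D.Pt) : Prop where
  joined : ∀ p q, D.Joined σ p q → (p ∈ K ↔ q ∈ K)
  connected : ∀ p ∈ K, D.SameCircle σ p u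
  mem : u ∈ K
  notMem : v ∉ K

section Loop

variable {D : PlanarDiagram} {K : Set D.Pt} {u v : D.Pt} {c : D.Cr}

/-- In `Δ 1 = 1 ⊗ X + X ⊗ 1` and `Δ X = X ⊗ X` the terms with `X` on the loop carry the original
label on the other factor. This component of the differential is thus the identity on labels outside
`K`, an entry that can be cancelled. -/
theorem EnhancedState.incident_iff_of_split {S T : D.EnhancedState} (huv : D.IsUnder c u v)
    (hc : S.smoothing c = false) (hT : T.smoothing = update S.smoothing c true)
    (hK : D.IsLoop T.smoothing K u v) (huvS : D.SameCircle S.smoothing u v)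
    (hu : T.isX u = true) : S.Incident T ↔ ∀ p, p ∉ K → T.isX p = S.isX p := by
  have agree : ∀ c', c' ≠ c → S.smoothing c' = T.smoothing c' := fun c' h => by
    rw [hT, update_of_ne h]
  have hnot : ¬ D.SameCircle T.smoothing u v := fun h => hK.notMem ((h.mem_iff hK.joined).1 hK.mem)
  rw [incident_iff huv hc hT]
  constructor
  · rintro ⟨h1, h2⟩ p hp
    rcases h2 with ⟨a, -⟩ | ⟨-, -, e⟩
    · exact absurd huvS a
    by_cases hpv : D.SameCircle S.smoothing p v
    · have hpvT : D.SameCircle T.smoothing p v := by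
        rcases hpv.flip' huv agree with h | ⟨h | h, -⟩
        · exact h
        · exact absurd ((h.mem_iff hK.joined).2 hK.mem) hp
        · exact h
      rw [T.isX_eq hpvT, S.isX_eq hpv, ← S.isX_eq huvS]
      rw [hu] at e
      revert e
      cases T.isX v <;> cases S.isX u <;> simp
    · exact h1 p (fun h => hpv (h.trans huvS)) hpv
  · intro h
    refine ⟨fun p hpu hpv => h p fun hp => ?_, Or.inr ⟨huvS, hnot, ?_⟩⟩
    · rcases (hK.connected p hp).flip' huv (fun c' h => (agree c' h).symm) with h | ⟨h | h, -⟩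
      · exact hpu h
      · exact hpu h
      · exact hpv h
    · rw [hu, h v hK.notMem, S.isX_eq huvS, add_comm]
      rfl

/-- The label `1` is the unit of the multiplication, so a merge with a loop labelled `1` is the
identity on labels outside `K`. This is the second kind of entry that can be cancelled. -/
theorem EnhancedState.incident_iff_of_merge {S T : D.EnhancedState} (huv : D.IsUnder c u v)
    (hc : S.smoothing c = false) (hT : T.smoothing = update S.smoothing c true)
    (hK : D.IsLoop S.smoothing K u v) (huvT : D.SameCircle T.smoothing u v)
    (hu : S.isX u = false) : S.Incident T ↔ ∀ p, p ∉ K → T.isX p = S.isX p := by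
  have agree : ∀ c', c' ≠ c → S.smoothing c' = T.smoothing c' := fun c' h => by
    rw [hT, update_of_ne h]
  have hnot : ¬ D.SameCircle S.smoothing u v := fun h => hK.notMem ((h.mem_iff hK.joined).1 hK.mem)
  rw [incident_iff huv hc hT]
  constructor
  · rintro ⟨h1, h2⟩ p hp
    rcases h2 with ⟨-, -, e⟩ | ⟨a, -⟩
    swap
    · exact absurd a hnot
    by_cases hpv : D.SameCircle S.smoothing p v
    · have hpvT : D.SameCircle T.smoothing p v := by
        rcases hpv.flip' huv agree with h | ⟨h | h, -⟩
        · exact h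
        · exact h.trans huvT
        · exact h
      rw [T.isX_eq hpvT, S.isX_eq hpv, ← T.isX_eq huvT]
      rw [hu] at e
      revert e
      cases T.isX u <;> cases S.isX v <;> simp
    · exact h1 p (fun h => hp ((h.mem_iff hK.joined).2 hK.mem)) hpv
  · intro h
    refine ⟨fun p hpu hpv => h p fun hp => hpu (hK.connected p hp), Or.inl ⟨hnot, huvT, ?_⟩⟩
    rw [hu, T.isX_eq huvT, h v hK.notMem]
    simp

/-- The label of a circle away from the crossing at which the smoothing changes is kept. -/
theorem EnhancedState.Incident.isX_eq_of_loop {S T : D.EnhancedState} (h : S.Incident T)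
    (hK : ∀ p q, D.Joined S.smoothing p q → (p ∈ K ↔ q ∈ K)) (hu : u ∈ K)
    (hcr : ∀ c, S.smoothing c ≠ T.smoothing c → D.cross c 0 ∉ K ∧ D.cross c 2 ∉ K) :
    T.isX u = S.isX u := by
  obtain ⟨c, hc, hT, h3, -⟩ := h
  have := hcr c (by rw [hT, update_self, hc]; simp)
  exact h3 u (fun h => this.1 ((h.mem_iff hK).1 hu)) (fun h => this.2 ((h.mem_iff hK).1 hu))

/-- Splitting off the loop `K` with the label `x`. -/
noncomputable def EnhancedState.splitLoop (S : D.EnhancedState) (huv : D.IsUnder c u v)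
    (b x : Bool) (hK : D.IsLoop (update S.smoothing c b) K u v)
    (huvS : D.SameCircle S.smoothing u v) : D.EnhancedState where
  smoothing := update S.smoothing c b
  isX p := if p ∈ K then x else S.isX p
  compat p q h := by
    have hm := hK.joined p q h
    by_cases hp : p ∈ K
    · rw [if_pos hp, if_pos (hm.1 hp)]
    · rw [if_neg hp, if_neg (fun hq => hp (hm.2 hq))]
      apply S.isX_eq
      rcases h.sameCircle.flip' (σ' := S.smoothing) huv
        (fun c' h => by rw [update_of_ne h]) with h | ⟨h | h, h' | h'⟩
      · exact h
      · exact h.trans h'.symm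
      · exact h.trans (huvS.trans h'.symm)
      · exact h.trans (huvS.symm.trans h'.symm)
      · exact h.trans h'.symm

/-- Merging the loop `K` into its neighbour. -/
noncomputable def EnhancedState.mergeLoop (S : D.EnhancedState) (huv : D.IsUnder c u v)
    (b : Bool) (hK : D.IsLoop S.smoothing K u v) : D.EnhancedState where
  smoothing := update S.smoothing c b
  isX p := if p ∈ K then S.isX v else S.isX p
  compat p q h := by
    have aux : ∀ p, D.SameCircle S.smoothing p u ∨ D.SameCircle S.smoothing p v →
        (if p ∈ K then S.isX v else S.isX p) = S.isX v := by
      intro p hp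
      split_ifs with h
      · rfl
      · rcases hp with hp | hp
        · exact absurd ((hp.mem_iff hK.joined).2 hK.mem) h
        · exact S.isX_eq hp
    rcases h.sameCircle.flip' (σ' := S.smoothing) huv
      (fun c' h => by rw [update_of_ne h]) with h | ⟨h, h'⟩
    · have hm := h.mem_iff hK.joined
      by_cases hp : p ∈ K
      · rw [if_pos hp, if_pos (hm.1 hp)]
      · rw [if_neg hp, if_neg (fun hq => hp (hm.2 hq)), S.isX_eq h]
    · rw [aux p h, aux q h']

end Loop

end PlanarDiagram

/-! ### Transport of the complex to a simpler diagram, and the exact triangle. -/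

namespace PlanarDiagram

open Relation Function
open scoped Classical

/-- The matrix of the differential. -/
noncomputable def incidence (D : PlanarDiagram) (base : D.Pt) :
    Matrix (D.ReducedState base) (D.ReducedState base) (ZMod 2) :=
  Matrix.of fun T S => if S.1.Incident T.1 then 1 else 0

theorem incidence_ne_zero {D : PlanarDiagram} {base : D.Pt} {S T : D.ReducedState base} :
    D.incidence base T S ≠ 0 ↔ S.1.Incident T.1 := by
  simp [incidence]

theorem incidence_eq_zero {D : PlanarDiagram} {base : D.Pt} {S T : D.ReducedState base} :
    D.incidence base T S = 0 ↔ ¬ S.1.Incident T.1 := by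
  simp [incidence]

/-- The rank of reduced Khovanov homology, computed as a corank defect. -/
noncomputable def khRank (D : PlanarDiagram) (base : D.Pt) : ℤ := (D.incidence base).homRank

/-- The quantity `khRank` makes sense for any incidence matrix; a vanishing square is what relates
it to homology. -/
theorem rkKh_eq_khRank (D : PlanarDiagram) (base : D.Pt)
    (h : D.incidence base * D.incidence base = 0) : (D.rkKh base : ℤ) = D.khRank base :=
  Matrix.finrank_ker_quotient_range _ h

/-- The diagram `D'` is obtained from `D` by smoothing the crossings outside the range of `e`
according to `τ`, forgetting the points in `K`, and sliding points along segments. -/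
structure Reduction (D D' : PlanarDiagram) where
  e : D'.Cr → D.Cr
  τ : D.Cr → Bool
  K : Set D.Pt
  f : D.Pt → D'.Pt
  g : D'.Pt → D.Pt
  inj : Injective e
  joined_mem : ∀ σ, (∀ c, c ∉ Set.range e → σ c = τ c) → ∀ p q, D.Joined σ p q →
    (p ∈ K ↔ q ∈ K)
  map : ∀ σ, (∀ c, c ∉ Set.range e → σ c = τ c) → ∀ p q, p ∉ K → D.Joined σ p q →
    D'.SameCircle (σ ∘ e) (f p) (f q)
  comap : ∀ σ, (∀ c, c ∉ Set.range e → σ c = τ c) → ∀ p q, D'.Joined (σ ∘ e) p q →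
    D.SameCircle σ (g p) (g q)
  notMem : ∀ p, g p ∉ K
  gf : ∀ σ, (∀ c, c ∉ Set.range e → σ c = τ c) → ∀ p, p ∉ K → D.SameCircle σ p (g (f p))
  fg : ∀ σ p, D'.SameCircle σ (f (g p)) p
  cross_notMem : ∀ c i, D.cross (e c) i ∉ K
  cross : ∀ c i σ, D'.SameCircle σ (f (D.cross (e c) i)) (D'.cross c i)

namespace Reduction

variable {D D' : PlanarDiagram} (R : D.Reduction D')

/-- The smoothings of `D` which agree with the prescribed one. -/
def Fits (σ : D.Cr → Bool) : Prop := ∀ c, c ∉ Set.range R.e → σ c = R.τ c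

variable {R}

theorem sameCircle_map {σ : D.Cr → Bool} (hσ : R.Fits σ) {p q : D.Pt}
    (h : D.SameCircle σ p q) (hp : p ∉ R.K) : D'.SameCircle (σ ∘ R.e) (R.f p) (R.f q) := by
  induction h with
  | rel x y h => exact R.map σ hσ _ _ hp h
  | refl x => exact SameCircle.refl _ _
  | symm x y h ih =>
    exact (ih (fun hx => hp ((SameCircle.mem_iff (R.joined_mem σ hσ) h).1 hx))).symm
  | trans x y z h _ ih1 ih2 =>
    exact (ih1 hp).trans (ih2 (fun hx => hp ((SameCircle.mem_iff (R.joined_mem σ hσ) h).2 hx)))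

theorem sameCircle_comap {σ : D.Cr → Bool} (hσ : R.Fits σ) {p q : D'.Pt}
    (h : D'.SameCircle (σ ∘ R.e) p q) : D.SameCircle σ (R.g p) (R.g q) := by
  induction h with
  | rel x y h => exact R.comap σ hσ _ _ h
  | refl x => exact SameCircle.refl _ _
  | symm x y _ ih => exact ih.symm
  | trans x y z _ _ ih1 ih2 => exact ih1.trans ih2

/-- The maps `f` and `g` are inverse only up to moving along circles, which still gives a bijection
between the circles of `D` outside `K` and the circles of `D'`. -/
theorem sameCircle_iff {σ : D.Cr → Bool} (hσ : R.Fits σ) {p q : D.Pt} (hp : p ∉ R.K)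
    (hq : q ∉ R.K) : D'.SameCircle (σ ∘ R.e) (R.f p) (R.f q) ↔ D.SameCircle σ p q :=
  ⟨fun h => ((R.gf σ hσ p hp).trans (sameCircle_comap hσ h)).trans (R.gf σ hσ q hq).symm,
    fun h => sameCircle_map hσ h hp⟩

variable (R) in
/-- The restriction of a state of `D` to `D'`. -/
def restrict (S : D.EnhancedState) (hS : R.Fits S.smoothing) : D'.EnhancedState where
  smoothing := S.smoothing ∘ R.e
  isX p := S.isX (R.g p)
  compat _ _ h := S.isX_eq (R.comap _ hS _ _ h)

theorem restrict_isX {S : D.EnhancedState} {hS : R.Fits S.smoothing} {p : D.Pt} (hp : p ∉ R.K) :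
    (R.restrict S hS).isX (R.f p) = S.isX p :=
  (S.isX_eq (R.gf _ hS p hp)).symm

theorem fits_extend (σ : D'.Cr → Bool) : R.Fits (extend R.e σ R.τ) := fun _ hc =>
  extend_apply' _ _ _ fun ⟨a, ha⟩ => hc ⟨a, ha⟩

theorem extend_comp (σ : D'.Cr → Bool) : extend R.e σ R.τ ∘ R.e = σ :=
  funext fun c => R.inj.extend_apply _ _ c

variable (R) in
/-- The state of `D` with label `κ` at the forgotten points which restricts to a given state. -/
noncomputable def extendState (κ : Bool) (S : D'.EnhancedState) : D.EnhancedState where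
  smoothing := extend R.e S.smoothing R.τ
  isX p := if p ∈ R.K then κ else S.isX (R.f p)
  compat p q h := by
    have hm := R.joined_mem _ (fits_extend _) _ _ h
    by_cases hp : p ∈ R.K
    · rw [if_pos hp, if_pos (hm.1 hp)]
    · rw [if_neg hp, if_neg (fun hq => hp (hm.2 hq))]
      have := R.map _ (fits_extend _) _ _ hp h
      rw [extend_comp] at this
      exact S.isX_eq this

/-- Circles, labels and remaining crossings correspond, so incidence can be read off in `D'`. The
points of `K` are invisible there, which is why agreement on them is a separate hypothesis. -/
theorem restrict_incident {S T : D.EnhancedState} (hS : R.Fits S.smoothing)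
    (hT : R.Fits T.smoothing) (hK : ∀ p ∈ R.K, T.isX p = S.isX p) :
    (R.restrict S hS).Incident (R.restrict T hT) ↔ S.Incident T := by
  have hT' : ∀ c', T.smoothing ∘ R.e = update (S.smoothing ∘ R.e) c' true ↔
      T.smoothing = update S.smoothing (R.e c') true := by
    intro c'
    constructor
    · intro h
      ext c
      by_cases hc : c ∈ Set.range R.e
      · obtain ⟨d, rfl⟩ := hc
        have := congrFun h d
        simp only [comp_apply] at this
        rw [this]
        by_cases hd : d = c'
        · subst hd; simp
        · rw [update_of_ne hd, update_of_ne (fun h => hd (R.inj h))]; rfl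
      · rw [update_of_ne (fun h => hc ⟨c', h.symm⟩), hT c hc, hS c hc]
    · intro h
      rw [h]
      ext d
      by_cases hd : d = c'
      · subst hd; simp
      · rw [update_of_ne hd, comp_apply, update_of_ne (fun h => hd (R.inj h))]; rfl
  have main : ∀ c', S.smoothing (R.e c') = false →
      T.smoothing = update S.smoothing (R.e c') true →
      ((R.restrict S hS).Incident (R.restrict T hT) ↔ S.Incident T) := by
    intro c' h1 h2
    have t : ∀ (σ : D.Cr → Bool) (hσ : R.Fits σ) p i, p ∉ R.K →
        (D'.SameCircle (σ ∘ R.e) (R.f p) (D'.cross c' i) ↔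
          D.SameCircle σ p (D.cross (R.e c') i)) := by
      intro σ hσ p i hp
      rw [← sameCircle_iff hσ hp (R.cross_notMem c' i)]
      exact ⟨fun h => h.trans (R.cross c' i _).symm, fun h => h.trans (R.cross c' i _)⟩
    have t2 : ∀ (σ : D.Cr → Bool) (hσ : R.Fits σ) i j,
        (D'.SameCircle (σ ∘ R.e) (D'.cross c' i) (D'.cross c' j) ↔
          D.SameCircle σ (D.cross (R.e c') i) (D.cross (R.e c') j)) := by
      intro σ hσ i j
      rw [← t σ hσ _ j (R.cross_notMem c' i)]
      exact ⟨fun h => (R.cross c' i _).trans h, fun h => (R.cross c' i _).symm.trans h⟩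
    have l : ∀ (U : D.EnhancedState) (hU : R.Fits U.smoothing) i,
        (R.restrict U hU).isX (D'.cross c' i) = U.isX (D.cross (R.e c') i) := by
      intro U hU i
      rw [← restrict_isX (hS := hU) (R.cross_notMem c' i)]
      exact ((R.restrict U hU).isX_eq (R.cross c' i _)).symm
    rw [EnhancedState.incident_iff (c := c') (Or.inl ⟨rfl, rfl⟩) h1 ((hT' c').2 h2),
      EnhancedState.incident_iff (c := R.e c') (Or.inl ⟨rfl, rfl⟩) h1 h2, l, l, l, l]
    have a1 := t2 S.smoothing hS 0 2
    have a2 := t2 T.smoothing hT 0 2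
    change D'.SameCircle (R.restrict S hS).smoothing _ _ ↔ _ at a1
    change D'.SameCircle (R.restrict T hT).smoothing _ _ ↔ _ at a2
    rw [a1, a2]
    refine and_congr_left fun _ => ⟨fun h p hp0 hp2 => ?_, fun h p hp0 hp2 => ?_⟩
    · by_cases hp : p ∈ R.K
      · exact hK p hp
      · have := h (R.f p) (fun h => hp0 ((t _ hS p 0 hp).1 h))
          (fun h => hp2 ((t _ hS p 2 hp).1 h))
        rwa [restrict_isX hp, restrict_isX hp] at this
    · have hg := R.notMem p
      exact h (R.g p)
        (fun h' => hp0 ((R.fg _ p).symm.trans ((t _ hS _ 0 hg).2 h')))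
        (fun h' => hp2 ((R.fg _ p).symm.trans ((t _ hS _ 2 hg).2 h')))
  constructor
  · intro h
    obtain ⟨c', h1, h2⟩ := h.exists_update
    exact (main c' h1 ((hT' c').1 h2)).1 h
  · intro h
    obtain ⟨c, h1, h2⟩ := h.exists_update
    by_cases hc : c ∈ Set.range R.e
    · obtain ⟨c', rfl⟩ := hc
      exact (main c' h1 h2).2 h
    -- A crossing outside the range of `e` has the prescribed smoothing in both states, so the
    -- differential cannot change it.
    · exfalso
      have h3 : T.smoothing c = true := by rw [h2, update_self]
      rw [hT c hc, ← hS c hc, h1] at h3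
      exact absurd h3 (by simp)

/-- The part of the complex of `D` carried by the reduction `R`, with label `κ` at the forgotten
points, has the same homology as the complex of `D'`. -/
theorem homRank_eq (R : D.Reduction D') (κ : Bool) {base : D.Pt} {base' : D'.Pt}
    (hb : base ∉ R.K) (hbase : ∀ σ, D'.SameCircle σ (R.f base) base')
    {I : Type} [Fintype I] (j : I → D.ReducedState base) (hj : Injective j)
    (hrange : ∀ S, S ∈ Set.range j ↔
      R.Fits S.1.smoothing ∧ ∀ p ∈ R.K, S.1.isX p = κ) :
    ((D.incidence base).submatrix j j).homRank = D'.khRank base' := by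
  have hj1 : ∀ i, R.Fits (j i).1.smoothing := fun i => ((hrange _).1 ⟨i, rfl⟩).1
  have hj2 : ∀ i, ∀ p ∈ R.K, (j i).1.isX p = κ := fun i => ((hrange _).1 ⟨i, rfl⟩).2
  let φ : I → D'.ReducedState base' := fun i => ⟨R.restrict (j i).1 (hj1 i), by
    rw [← (R.restrict (j i).1 (hj1 i)).isX_eq (hbase _), restrict_isX hb]
    exact (j i).2⟩
  have hφ : Bijective φ := by
    constructor
    · intro a b h
      apply hj
      have h' := congrArg Subtype.val h
      have hs : (j a).1.smoothing ∘ R.e = (j b).1.smoothing ∘ R.e :=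
        congrArg EnhancedState.smoothing h'
      have hx := congrArg EnhancedState.isX h'
      apply Subtype.ext
      apply EnhancedState.ext
      · ext c
        by_cases hc : c ∈ Set.range R.e
        · obtain ⟨d, rfl⟩ := hc
          exact congrFun hs d
        · rw [hj1 a c hc, hj1 b c hc]
      · ext p
        by_cases hp : p ∈ R.K
        · rw [hj2 a p hp, hj2 b p hp]
        · have := congrFun hx (R.f p)
          change (R.restrict _ (hj1 a)).isX (R.f p) = (R.restrict _ (hj1 b)).isX (R.f p) at this
          rwa [restrict_isX hp, restrict_isX hp] at this
    · intro T
      have hbX : (R.extendState κ T.1).isX base = true := by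
        change (if base ∈ R.K then κ else T.1.isX (R.f base)) = true
        rw [if_neg hb, T.1.isX_eq (hbase _)]
        exact T.2
      obtain ⟨i, hi⟩ := (hrange ⟨R.extendState κ T.1, hbX⟩).2
        ⟨fits_extend _, fun p hp => if_pos hp⟩
      refine ⟨i, Subtype.ext (EnhancedState.ext ?_ ?_)⟩
      · change (j i).1.smoothing ∘ R.e = _
        rw [hi]
        exact extend_comp _
      · ext p
        change (j i).1.isX (R.g p) = _
        rw [hi]
        change (if R.g p ∈ R.K then κ else T.1.isX (R.f (R.g p))) = _
        rw [if_neg (R.notMem p)]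
        exact T.1.isX_eq (R.fg _ p)
  rw [khRank, ← Matrix.homRank_submatrix _ (Equiv.ofBijective φ hφ)]
  congr 1
  ext a b
  change (if (j b).1.Incident (j a).1 then (1 : ZMod 2) else 0) =
    if (φ b).1.Incident (φ a).1 then 1 else 0
  rw [← restrict_incident (hj1 b) (hj1 a) (fun p hp => by rw [hj2 a p hp, hj2 b p hp])]

/-- Reductions which keep all crossings and all points do not change the homology. -/
theorem khRank_eq (R : D.Reduction D') (hs : Surjective R.e) (hK : R.K = ∅) {base : D.Pt}
    {base' : D'.Pt} (hbase : ∀ σ, D'.SameCircle σ (R.f base) base') :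
    D.khRank base = D'.khRank base' := by
  rw [← R.homRank_eq true (by simp [hK]) hbase id injective_id]
  · rfl
  · intro S
    refine iff_of_true ⟨S, rfl⟩ ⟨fun c hc => absurd (hs c) hc, fun p hp => ?_⟩
    rw [hK] at hp
    exact absurd hp (Set.notMem_empty p)

end Reduction

theorem incidence_eq_zero_of_smoothing {D : PlanarDiagram} {base : D.Pt}
    {S T : D.ReducedState base} {c : D.Cr} (hS : S.1.smoothing c = true)
    (hT : T.1.smoothing c = false) : D.incidence base T S = 0 := by
  rw [incidence_eq_zero]
  intro h
  obtain ⟨d, h1, h2⟩ := h.exists_update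
  have := congrFun h2 c
  rw [hT] at this
  by_cases hc : c = d
  · subst hc; simp at this
  · rw [update_of_ne hc, hS] at this
    exact absurd this (by simp)

/-- The exact triangle of the two smoothings of a crossing. -/
theorem khRank_le_add {D D₀ D₁ : PlanarDiagram} {base : D.Pt} {base₀ : D₀.Pt} {base₁ : D₁.Pt}
    (c : D.Cr) (R₀ : D.Reduction D₀) (R₁ : D.Reduction D₁)
    (he₀ : ∀ d, d ∉ Set.range R₀.e ↔ d = c) (he₁ : ∀ d, d ∉ Set.range R₁.e ↔ d = c)
    (hτ₀ : R₀.τ c = false) (hτ₁ : R₁.τ c = true) (hK₀ : R₀.K = ∅) (hK₁ : R₁.K = ∅)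
    (hb₀ : ∀ σ, D₀.SameCircle σ (R₀.f base) base₀)
    (hb₁ : ∀ σ, D₁.SameCircle σ (R₁.f base) base₁) :
    D.khRank base ≤ D₀.khRank base₀ + D₁.khRank base₁ := by
  let e : {S : D.ReducedState base // S.1.smoothing c = false} ⊕
      {S : D.ReducedState base // ¬ S.1.smoothing c = false} ≃ D.ReducedState base :=
    Equiv.sumCompl _
  -- The differential never turns a 1-smoothing into a 0-smoothing, so the states with `c`
  -- 1-smoothed span a subcomplex; the others span the quotient.
  have h := (D.incidence base).homRank_le_add e (fun S T =>
    incidence_eq_zero_of_smoothing (c := c) (Bool.eq_true_of_not_eq_false T.2) S.2)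
  rw [R₀.homRank_eq true (by simp [hK₀]) hb₀ (e ∘ Sum.inl) (e.injective.comp Sum.inl_injective),
    R₁.homRank_eq true (by simp [hK₁]) hb₁ (e ∘ Sum.inr) (e.injective.comp Sum.inr_injective)]
    at h
  · exact h
  · intro S
    constructor
    · rintro ⟨⟨T, hT⟩, rfl⟩
      refine ⟨fun d hd => ?_, by simp [hK₁]⟩
      rw [(he₁ d).1 hd, hτ₁]
      exact Bool.eq_true_of_not_eq_false hT
    · rintro ⟨h1, -⟩
      refine ⟨⟨S, ?_⟩, rfl⟩
      rw [h1 c ((he₁ c).2 rfl), hτ₁]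
      simp
  · intro S
    constructor
    · rintro ⟨⟨T, hT⟩, rfl⟩
      refine ⟨fun d hd => ?_, by simp [hK₀]⟩
      rw [(he₀ d).1 hd, hτ₀]
      exact hT
    · rintro ⟨h1, -⟩
      exact ⟨⟨S, (h1 c ((he₀ c).2 rfl)).trans hτ₀⟩, rfl⟩

end PlanarDiagram

/-! ### The first and second Reidemeister moves as cancellations. -/

namespace PlanarDiagram

open Relation Function
open scoped Classical

theorem EnhancedState.Incident.eq_update {D : PlanarDiagram} {S T : D.EnhancedState}
    (h : S.Incident T) {c : D.Cr} (hc : S.smoothing c ≠ T.smoothing c) :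
    S.smoothing c = false ∧ T.smoothing = update S.smoothing c true := by
  obtain ⟨d, h1, h2⟩ := h.exists_update
  have : c = d := by
    by_contra hne
    rw [h2, update_of_ne hne] at hc
    exact hc rfl
  subst this
  exact ⟨h1, h2⟩

theorem smoothing_eq_update {D : PlanarDiagram} {σ τ ρ : D.Cr → Bool} {c : D.Cr} {b : Bool}
    (hσ : σ c = b) (h : ρ = update σ c (!b)) (h' : ρ = update τ c (!b)) (hτ : τ c = b) :
    σ = τ := by
  ext d
  by_cases hd : d = c
  · rw [hd, hσ, hτ]
  · have := congrFun (h.symm.trans h') d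
    rwa [update_of_ne hd, update_of_ne hd] at this

theorem eq_update_update {D : PlanarDiagram} {σ : D.Cr → Bool} {c : D.Cr} {b : Bool}
    (h : σ c = b) (b' : Bool) : σ = update (update σ c b') c b := by
  rw [update_idem, ← h, update_eq_self]

theorem update_smoothing_self {D : PlanarDiagram} (σ : D.Cr → Bool) (c : D.Cr) (b : Bool) :
    update σ c b c = b :=
  update_self _ _ _

/-- Cancellation combined with transport: the survivors of the matching are exactly the states that
fit `R` with the label `κ` on the forgotten circles, and these carry the complex of `D'`. -/
theorem khRank_le_matching {D D' : PlanarDiagram} {base : D.Pt} {base' : D'.Pt}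
    (R : D.Reduction D') (κ : Bool) (hb : base ∉ R.K)
    (hbase : ∀ σ, D'.SameCircle σ (R.f base) base') (A B : D.ReducedState base → Prop)
    (hd : ∀ S, A S → ¬ B S)
    (hA : ∀ S, A S → ∃ T, B T ∧ S.1.Incident T.1)
    (hA' : ∀ S T T', A S → B T → B T' → S.1.Incident T.1 → S.1.Incident T'.1 → T = T')
    (hB : ∀ T, B T → ∃ S, A S ∧ S.1.Incident T.1)
    (hB' : ∀ S S' T, A S → A S' → B T → S.1.Incident T.1 → S'.1.Incident T.1 → S = S')
    (h0 : ∀ S T U V, A S → B T → S.1.Incident T.1 → ¬ A U → ¬ B U → ¬ A V → ¬ B V →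
      S.1.Incident V.1 → ¬ U.1.Incident T.1)
    (hQ : ∀ S, (¬ A S ∧ ¬ B S) ↔ R.Fits S.1.smoothing ∧ ∀ p ∈ R.K, S.1.isX p = κ) :
    D.khRank base ≤ D'.khRank base' := by
  have : Finite {S // ¬ A S ∧ ¬ B S} := inferInstance
  let _ := Fintype.ofFinite {S // ¬ A S ∧ ¬ B S}
  have h := (D.incidence base).homRank_le_of_matching_rel A B hd
    (by simpa only [incidence_ne_zero] using hA) (by simpa only [incidence_ne_zero] using hA')
    (by simpa only [incidence_ne_zero] using hB) (by simpa only [incidence_ne_zero] using hB')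
    (by
      intro a b q r ha hb hab hq hq' hr hr'
      rw [incidence_ne_zero] at hab
      rw [incidence_eq_zero, incidence_eq_zero]
      by_cases h : a.1.Incident r.1
      · exact Or.inr (h0 a b q r ha hb hab hq hq' hr hr' h)
      · exact Or.inl h)
  rwa [R.homRank_eq κ hb hbase _ Subtype.val_injective] at h
  intro S
  exact Iff.trans ⟨by rintro ⟨x, rfl⟩; exact x.2, fun h => ⟨⟨S, h⟩, rfl⟩⟩ (hQ S)

/-- The first Reidemeister move, for a kink whose loop `K` is split off in the smoothing `b` of
the crossing `c`. -/
theorem khRank_le_of_kink {D D' : PlanarDiagram} {base : D.Pt} {base' : D'.Pt}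
    (R : D.Reduction D') (c : D.Cr) (u v : D.Pt) (b : Bool)
    (he : ∀ d, d ∉ Set.range R.e ↔ d = c) (hτ : R.τ c = b)
    (huv : D.IsUnder c u v) (hu : u ∈ R.K) (hv : v ∉ R.K)
    (hconn : ∀ σ, ∀ p ∈ R.K, D.SameCircle σ p u)
    (hmerge : ∀ σ, σ c = !b → D.SameCircle σ u v)
    (hb : base ∉ R.K) (hbase : ∀ σ, D'.SameCircle σ (R.f base) base') :
    D.khRank base ≤ D'.khRank base' := by
  have fits : ∀ σ : D.Cr → Bool, R.Fits σ ↔ σ c = b := fun σ =>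
    ⟨fun h => (h c ((he c).2 rfl)).trans hτ, fun h d hd => by rw [(he d).1 hd, hτ, h]⟩
  have loop : ∀ σ : D.Cr → Bool, σ c = b → D.IsLoop σ R.K u v := fun σ h =>
    ⟨R.joined_mem σ ((fits σ).2 h), hconn σ, hu, hv⟩
  have other : ∀ {S T : D.EnhancedState}, S.Incident T → S.smoothing c = b →
      T.smoothing c = b → T.isX u = S.isX u := by
    intro S T h hS hT
    refine h.isX_eq_of_loop (loop _ hS).joined hu fun d hd => ?_
    have : d ∈ Set.range R.e := by
      by_contra h
      rw [(he d).1 h, hS, hT] at hd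
      exact hd rfl
    obtain ⟨d, rfl⟩ := this
    exact ⟨R.cross_notMem _ _, R.cross_notMem _ _⟩
  have constK : ∀ (S : D.EnhancedState), ∀ p ∈ R.K, S.isX p = S.isX u := fun S p hp =>
    S.isX_eq (hconn _ p hp)
  cases b
  -- The loop is present in the 0-smoothing. States with `1` on the loop are matched with all
  -- 1-smoothed states by merging the loop; the survivors have `X` on the loop.
  · have inc : ∀ S T : D.EnhancedState, S.smoothing c = false ∧ S.isX u = false →
        T.smoothing = update S.smoothing c true →
        (S.Incident T ↔ ∀ p, p ∉ R.K → T.isX p = S.isX p) := fun S T hS hT =>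
      EnhancedState.incident_iff_of_merge huv hS.1 hT (loop _ hS.1)
        (hmerge _ (by rw [hT, update_self]; rfl)) hS.2
    have upd : ∀ S T : D.EnhancedState, S.smoothing c = false ∧ S.isX u = false →
        T.smoothing c = true → S.Incident T → T.smoothing = update S.smoothing c true :=
      fun S T hS hT h => (h.eq_update (by rw [hS.1, hT]; simp)).2
    refine khRank_le_matching R true hb hbase
      (fun S => S.1.smoothing c = false ∧ S.1.isX u = false) (fun S => S.1.smoothing c = true)
      ?_ ?_ ?_ ?_ ?_ ?_ ?_
    · rintro S ⟨h, -⟩ h'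
      rw [h] at h'
      exact absurd h' (by simp)
    · intro S hS
      let T := S.1.mergeLoop huv true (loop _ hS.1)
      have hTX : ∀ p, p ∉ R.K → T.isX p = S.1.isX p := fun p hp => if_neg hp
      refine ⟨⟨T, (hTX base hb).trans S.2⟩, update_smoothing_self S.1.smoothing c true, (inc S.1 T hS rfl).2 hTX⟩
    · intro S T T' hS hT hT' h h'
      have e1 := upd _ _ hS hT h
      have e2 := upd _ _ hS hT' h'
      have hh := (inc _ _ hS e1).1 h
      have hh' := (inc _ _ hS e2).1 h'
      refine Subtype.ext (EnhancedState.ext (e1.trans e2.symm) (funext fun p => ?_))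
      by_cases hp : p ∈ R.K
      · rw [constK _ p hp, constK _ p hp, T.1.isX_eq (hmerge _ hT), T'.1.isX_eq (hmerge _ hT'),
          hh v hv, hh' v hv]
      · rw [hh p hp, hh' p hp]
    · intro T hT
      have hl := loop (update T.1.smoothing c false) (update_self _ _ _)
      let S := T.1.splitLoop huv false false hl (hmerge _ hT)
      have hSX : ∀ p, p ∉ R.K → S.isX p = T.1.isX p := fun p hp => if_neg hp
      have hS : S.smoothing c = false ∧ S.isX u = false := ⟨update_smoothing_self T.1.smoothing c false, if_pos hu⟩
      have hTS : T.1.smoothing = update S.smoothing c true :=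
        eq_update_update hT false
      exact ⟨⟨S, (hSX base hb).trans T.2⟩, hS, (inc S T.1 hS hTS).2 fun p hp => (hSX p hp).symm⟩
    · intro S S' T hS hS' hT h h'
      have e1 := upd _ _ hS hT h
      have e2 := upd _ _ hS' hT h'
      have hh := (inc _ _ hS e1).1 h
      have hh' := (inc _ _ hS' e2).1 h'
      refine Subtype.ext (EnhancedState.ext (smoothing_eq_update hS.1 e1 e2 hS'.1)
        (funext fun p => ?_))
      by_cases hp : p ∈ R.K
      · rw [constK _ p hp, constK _ p hp, hS.2, hS'.2]
      · rw [← hh p hp, ← hh' p hp]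
    -- A survivor `V` reached from `S` has the same smoothing at `c`, so the loop would keep its
    -- label `1`; but survivors carry `X` there.
    · intro S T U V hS hT _ _ _ hV hV' hSV
      exfalso
      have hVc : V.1.smoothing c = false := Bool.eq_false_of_not_eq_true hV'
      have := other hSV hS.1 hVc
      exact hV ⟨hVc, this.trans hS.2⟩
    · intro S
      rw [fits]
      constructor
      · rintro ⟨h1, h2⟩
        have h3 := Bool.eq_false_of_not_eq_true h2
        refine ⟨h3, fun p hp => ?_⟩
        rw [constK _ p hp]
        exact Bool.eq_true_of_not_eq_false fun h => h1 ⟨h3, h⟩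
      · rintro ⟨h1, h2⟩
        refine ⟨fun h => ?_, fun h => ?_⟩
        · rw [h2 u hu] at h
          exact absurd h.2 (by simp)
        · rw [h1] at h
          exact absurd h (by simp)
  -- The loop is present in the 1-smoothing. All 0-smoothed states are matched with the states
  -- having `X` on the loop, by splitting it off; the survivors have `1` on the loop.
  · have inc : ∀ S T : D.EnhancedState, S.smoothing c = false →
        T.smoothing = update S.smoothing c true → T.isX u = true →
        (S.Incident T ↔ ∀ p, p ∉ R.K → T.isX p = S.isX p) := fun S T hS hT hx =>
      EnhancedState.incident_iff_of_split huv hS hT (loop _ (by rw [hT, update_self]))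
        (hmerge _ hS) hx
    have upd : ∀ S T : D.EnhancedState, S.smoothing c = false → T.smoothing c = true →
        S.Incident T → T.smoothing = update S.smoothing c true :=
      fun S T hS hT h => (h.eq_update (by rw [hS, hT]; simp)).2
    refine khRank_le_matching R false hb hbase
      (fun S => S.1.smoothing c = false) (fun S => S.1.smoothing c = true ∧ S.1.isX u = true)
      ?_ ?_ ?_ ?_ ?_ ?_ ?_
    · rintro S h ⟨h', -⟩
      rw [h] at h'
      exact absurd h' (by simp)
    · intro S hS
      have hl := loop (update S.1.smoothing c true) (update_self _ _ _)
      let T := S.1.splitLoop huv true true hl (hmerge _ hS)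
      have hTX : ∀ p, p ∉ R.K → T.isX p = S.1.isX p := fun p hp => if_neg hp
      exact ⟨⟨T, (hTX base hb).trans S.2⟩, ⟨update_smoothing_self S.1.smoothing c true, if_pos hu⟩,
        (inc S.1 T hS rfl (if_pos hu)).2 hTX⟩
    · intro S T T' hS hT hT' h h'
      have e1 := upd _ _ hS hT.1 h
      have e2 := upd _ _ hS hT'.1 h'
      have hh := (inc _ _ hS e1 hT.2).1 h
      have hh' := (inc _ _ hS e2 hT'.2).1 h'
      refine Subtype.ext (EnhancedState.ext (e1.trans e2.symm) (funext fun p => ?_))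
      by_cases hp : p ∈ R.K
      · rw [constK _ p hp, constK _ p hp, hT.2, hT'.2]
      · rw [hh p hp, hh' p hp]
    · intro T hT
      let S := T.1.mergeLoop huv false (loop _ hT.1)
      have hSX : ∀ p, p ∉ R.K → S.isX p = T.1.isX p := fun p hp => if_neg hp
      have hTS : T.1.smoothing = update S.smoothing c true :=
        eq_update_update hT.1 false
      exact ⟨⟨S, (hSX base hb).trans T.2⟩, update_smoothing_self T.1.smoothing c false,
        (inc S T.1 (update_smoothing_self T.1.smoothing c false) hTS hT.2).2 fun p hp => (hSX p hp).symm⟩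
    · intro S S' T hS hS' hT h h'
      have e1 := upd _ _ hS hT.1 h
      have e2 := upd _ _ hS' hT.1 h'
      have hh := (inc _ _ hS e1 hT.2).1 h
      have hh' := (inc _ _ hS' e2 hT.2).1 h'
      refine Subtype.ext (EnhancedState.ext (smoothing_eq_update hS e1 e2 hS')
        (funext fun p => ?_))
      by_cases hp : p ∈ R.K
      · rw [constK _ p hp, constK _ p hp, S.1.isX_eq (hmerge _ hS), S'.1.isX_eq (hmerge _ hS'),
          ← hh v hv, ← hh' v hv]
      · rw [← hh p hp, ← hh' p hp]
    -- A survivor `U` has `1` on the loop, and an arrow to a 1-smoothed state keeps this label,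
    -- whereas `T` has `X`.
    · intro S T U V _ hT _ hU hU' _ _ _ hUT
      have hUc : U.1.smoothing c = true := Bool.eq_true_of_not_eq_false hU
      have := other hUT hUc hT.1
      exact hU' ⟨hUc, this.symm.trans hT.2⟩
    · intro S
      rw [fits]
      constructor
      · rintro ⟨h1, h2⟩
        have h3 := Bool.eq_true_of_not_eq_false h1
        refine ⟨h3, fun p hp => ?_⟩
        rw [constK _ p hp]
        exact Bool.eq_false_of_not_eq_true fun h => h2 ⟨h3, h⟩
      · rintro ⟨h1, h2⟩
        refine ⟨fun h => ?_, fun h => ?_⟩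
        · rw [h1] at h
          exact absurd h (by simp)
        · rw [h2 u hu] at h
          exact absurd h.2 (by simp)

/-- The second Reidemeister move: the loop `K` between the crossings `c` and `d` is split off in
the smoothing with `c` of type `0` and `d` of type `1`. -/
theorem khRank_le_of_bigon {D D' : PlanarDiagram} {base : D.Pt} {base' : D'.Pt}
    (R : D.Reduction D') (c d : D.Cr) (u v u' v' : D.Pt) (K : Set D.Pt) (hcd : c ≠ d)
    (he : ∀ x, x ∉ Set.range R.e ↔ x = c ∨ x = d) (hτc : R.τ c = true) (hτd : R.τ d = false)
    (hRK : R.K = ∅) (huv : D.IsUnder c u v) (huv' : D.IsUnder d u' v')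
    (hu : u ∈ K) (hv : v ∉ K) (hu' : u' ∈ K) (hv' : v' ∉ K)
    (hjoin : ∀ σ, σ c = false → σ d = true → ∀ p q, D.Joined σ p q → (p ∈ K ↔ q ∈ K))
    (hconn : ∀ σ, (σ c = false ∨ σ d = true) → ∀ p ∈ K, D.SameCircle σ p u)
    (hmerge : ∀ σ, σ c = true → σ d = true → D.SameCircle σ u v)
    (hmerge' : ∀ σ, σ c = false → σ d = false → D.SameCircle σ u' v')
    (hcross : ∀ x, x ≠ c → x ≠ d → D.cross x 0 ∉ K ∧ D.cross x 2 ∉ K)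
    (hb : base ∉ K) (hbase : ∀ σ, D'.SameCircle σ (R.f base) base') :
    D.khRank base ≤ D'.khRank base' := by
  have fits : ∀ σ : D.Cr → Bool, R.Fits σ ↔ σ c = true ∧ σ d = false := fun σ =>
    ⟨fun h => ⟨(h c ((he c).2 (Or.inl rfl))).trans hτc, (h d ((he d).2 (Or.inr rfl))).trans hτd⟩,
      fun h x hx => by rcases (he x).1 hx with rfl | rfl <;> simp [*]⟩
  have conn : ∀ σ, (σ c = false ∨ σ d = true) → ∀ p ∈ K, D.SameCircle σ p u' :=
    fun σ hσ p hp => (hconn σ hσ p hp).trans (hconn σ hσ u' hu').symm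
  have loop : ∀ σ, σ c = false → σ d = true → D.IsLoop σ K u v := fun σ h h' =>
    ⟨hjoin σ h h', hconn σ (Or.inl h), hu, hv⟩
  have loop' : ∀ σ, σ c = false → σ d = true → D.IsLoop σ K u' v' := fun σ h h' =>
    ⟨hjoin σ h h', conn σ (Or.inl h), hu', hv'⟩
  have constK : ∀ S : D.EnhancedState, (S.smoothing c = false ∨ S.smoothing d = true) →
      ∀ p ∈ K, S.isX p = S.isX u := fun S h p hp => S.isX_eq (hconn _ h p hp)
  have constK' : ∀ S : D.EnhancedState, (S.smoothing c = false ∨ S.smoothing d = true) →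
      ∀ p ∈ K, S.isX p = S.isX u' := fun S h p hp => S.isX_eq (conn _ h p hp)
  -- Write `(c, d)` for the two smoothings. The vertex `(0, 0)` cancels against `(0, 1)` with `X` on
  -- the loop, by splitting at `d`; the vertex `(0, 1)` with `1` on the loop cancels against `(1,
  -- 1)`, by merging at `c`. The vertex `(1, 0)` survives untouched.
  let A₁ : D.EnhancedState → Prop := fun S => S.smoothing c = false ∧ S.smoothing d = false
  let A₂ : D.EnhancedState → Prop := fun S =>
    (S.smoothing c = false ∧ S.smoothing d = true) ∧ S.isX u = false
  let B₁ : D.EnhancedState → Prop := fun S =>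
    (S.smoothing c = false ∧ S.smoothing d = true) ∧ S.isX u = true
  let B₂ : D.EnhancedState → Prop := fun S => S.smoothing c = true ∧ S.smoothing d = true
  have inc₁ : ∀ S T : D.EnhancedState, A₁ S → B₁ T → T.smoothing = update S.smoothing d true →
      (S.Incident T ↔ ∀ p, p ∉ K → T.isX p = S.isX p) := fun S T hS hT h =>
    EnhancedState.incident_iff_of_split huv' hS.2 h (loop' _ hT.1.1 hT.1.2)
      (hmerge' _ hS.1 hS.2) (by rw [← constK' T (Or.inl hT.1.1) u hu, hT.2])
  have inc₂ : ∀ S T : D.EnhancedState, A₂ S → B₂ T → T.smoothing = update S.smoothing c true →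
      (S.Incident T ↔ ∀ p, p ∉ K → T.isX p = S.isX p) := fun S T hS hT h =>
    EnhancedState.incident_iff_of_merge huv hS.1.1 h (loop _ hS.1.1 hS.1.2)
      (hmerge _ hT.1 hT.2) hS.2
  have upd₁ : ∀ S T : D.EnhancedState, A₁ S → B₁ T → S.Incident T →
      T.smoothing = update S.smoothing d true := fun S T hS hT h =>
    (h.eq_update (by rw [hS.2, hT.1.2]; simp)).2
  have upd₂ : ∀ S T : D.EnhancedState, A₂ S → B₂ T → S.Incident T →
      T.smoothing = update S.smoothing c true := fun S T hS hT h =>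
    (h.eq_update (by rw [hS.1.1, hT.1]; simp)).2
  -- The two matchings do not interact: `A₁` and `B₂` differ at two crossings, while an arrow from
  -- `A₂` to `B₁` would have to change the label of a loop away from its crossing.
  have no₁ : ∀ S T : D.EnhancedState, A₁ S → B₂ T → ¬ S.Incident T := by
    intro S T hS hT h
    have h1 := (h.eq_update (c := c) (by rw [hS.1, hT.1]; simp)).2
    have h2 := congrFun h1 d
    rw [update_of_ne hcd.symm, hS.2, hT.2] at h2
    exact absurd h2 (by simp)
  have no₂ : ∀ S T : D.EnhancedState, A₂ S → B₁ T → ¬ S.Incident T := by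
    intro S T hS hT h
    have h1 := h.isX_eq_of_loop (loop _ hS.1.1 hS.1.2).joined hu fun x hx =>
      hcross x (by rintro rfl; rw [hS.1.1, hT.1.1] at hx; exact hx rfl)
        (by rintro rfl; rw [hS.1.2, hT.1.2] at hx; exact hx rfl)
    rw [hS.2, hT.2] at h1
    exact absurd h1 (by simp)
  have hQ : ∀ S : D.EnhancedState, (¬ (A₁ S ∨ A₂ S) ∧ ¬ (B₁ S ∨ B₂ S)) ↔
      S.smoothing c = true ∧ S.smoothing d = false := by
    intro S
    simp only [A₁, A₂, B₁, B₂]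
    cases S.smoothing c <;> cases S.smoothing d <;> cases S.isX u <;> simp
  refine khRank_le_matching R true (by simp [hRK]) hbase
    (fun S => A₁ S.1 ∨ A₂ S.1) (fun S => B₁ S.1 ∨ B₂ S.1) ?_ ?_ ?_ ?_ ?_ ?_ ?_
  · rintro S (h | h) (h' | h')
    · exact absurd (h.2.symm.trans h'.1.2) (by simp)
    · exact absurd (h.1.symm.trans h'.1) (by simp)
    · exact absurd (h.2.symm.trans h'.2) (by simp)
    · exact absurd (h.1.1.symm.trans h'.1) (by simp)
  · rintro S (hS | hS)
    · have hl := loop' (update S.1.smoothing d true) (by rw [update_of_ne hcd, hS.1])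
        (update_self _ _ _)
      let T := S.1.splitLoop huv' true true hl (hmerge' _ hS.1 hS.2)
      have hTX : ∀ p, p ∉ K → T.isX p = S.1.isX p := fun p hp => if_neg hp
      have hT : B₁ T := ⟨⟨(update_of_ne hcd _ _).trans hS.1, update_smoothing_self S.1.smoothing d true⟩, if_pos hu⟩
      exact ⟨⟨T, (hTX base hb).trans S.2⟩, Or.inl hT, (inc₁ S.1 T hS hT rfl).2 hTX⟩
    · let T := S.1.mergeLoop huv true (loop _ hS.1.1 hS.1.2)
      have hTX : ∀ p, p ∉ K → T.isX p = S.1.isX p := fun p hp => if_neg hp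
      have hT : B₂ T := ⟨update_smoothing_self S.1.smoothing c true, (update_of_ne hcd.symm _ _).trans hS.1.2⟩
      exact ⟨⟨T, (hTX base hb).trans S.2⟩, Or.inr hT, (inc₂ S.1 T hS hT rfl).2 hTX⟩
  · rintro S T T' (hS | hS) (hT | hT) (hT' | hT') h h'
    · have e1 := upd₁ _ _ hS hT h
      have e2 := upd₁ _ _ hS hT' h'
      refine Subtype.ext (EnhancedState.ext (e1.trans e2.symm) (funext fun p => ?_))
      by_cases hp : p ∈ K
      · rw [constK _ (Or.inl hT.1.1) p hp, constK _ (Or.inl hT'.1.1) p hp, hT.2, hT'.2]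
      · rw [(inc₁ _ _ hS hT e1).1 h p hp, (inc₁ _ _ hS hT' e2).1 h' p hp]
    · exact absurd h' (no₁ _ _ hS hT')
    · exact absurd h (no₁ _ _ hS hT)
    · exact absurd h (no₁ _ _ hS hT)
    · exact absurd h (no₂ _ _ hS hT)
    · exact absurd h (no₂ _ _ hS hT)
    · exact absurd h' (no₂ _ _ hS hT')
    · have e1 := upd₂ _ _ hS hT h
      have e2 := upd₂ _ _ hS hT' h'
      have hh := (inc₂ _ _ hS hT e1).1 h
      have hh' := (inc₂ _ _ hS hT' e2).1 h'
      refine Subtype.ext (EnhancedState.ext (e1.trans e2.symm) (funext fun p => ?_))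
      by_cases hp : p ∈ K
      · rw [constK _ (Or.inr hT.2) p hp, constK _ (Or.inr hT'.2) p hp,
          T.1.isX_eq (hmerge _ hT.1 hT.2), T'.1.isX_eq (hmerge _ hT'.1 hT'.2), hh v hv, hh' v hv]
      · rw [hh p hp, hh' p hp]
  · rintro T (hT | hT)
    · let S := T.1.mergeLoop huv' false (loop' _ hT.1.1 hT.1.2)
      have hSX : ∀ p, p ∉ K → S.isX p = T.1.isX p := fun p hp => if_neg hp
      have hS : A₁ S := ⟨(update_of_ne hcd _ _).trans hT.1.1, update_smoothing_self T.1.smoothing d false⟩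
      have hTS : T.1.smoothing = update S.smoothing d true :=
        eq_update_update hT.1.2 false
      exact ⟨⟨S, (hSX base hb).trans T.2⟩, Or.inl hS,
        (inc₁ S T.1 hS hT hTS).2 fun p hp => (hSX p hp).symm⟩
    · have hl := loop (update T.1.smoothing c false) (update_self _ _ _)
        (by rw [update_of_ne hcd.symm, hT.2])
      let S := T.1.splitLoop huv false false hl (hmerge _ hT.1 hT.2)
      have hSX : ∀ p, p ∉ K → S.isX p = T.1.isX p := fun p hp => if_neg hp
      have hS : A₂ S := ⟨⟨update_smoothing_self T.1.smoothing c false, (update_of_ne hcd.symm _ _).trans hT.2⟩, if_pos hu⟩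
      have hTS : T.1.smoothing = update S.smoothing c true :=
        eq_update_update hT.1 false
      exact ⟨⟨S, (hSX base hb).trans T.2⟩, Or.inr hS,
        (inc₂ S T.1 hS hT hTS).2 fun p hp => (hSX p hp).symm⟩
  · rintro S S' T (hS | hS) (hS' | hS') (hT | hT) h h'
    · have e1 := upd₁ _ _ hS hT h
      have e2 := upd₁ _ _ hS' hT h'
      have hh := (inc₁ _ _ hS hT e1).1 h
      have hh' := (inc₁ _ _ hS' hT e2).1 h'
      refine Subtype.ext (EnhancedState.ext (smoothing_eq_update hS.2 e1 e2 hS'.2)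
        (funext fun p => ?_))
      by_cases hp : p ∈ K
      · rw [constK' _ (Or.inl hS.1) p hp, constK' _ (Or.inl hS'.1) p hp,
          S.1.isX_eq (hmerge' _ hS.1 hS.2), S'.1.isX_eq (hmerge' _ hS'.1 hS'.2),
          ← hh v' hv', ← hh' v' hv']
      · rw [← hh p hp, ← hh' p hp]
    · exact absurd h (no₁ _ _ hS hT)
    · exact absurd h' (no₂ _ _ hS' hT)
    · exact absurd h (no₁ _ _ hS hT)
    · exact absurd h (no₂ _ _ hS hT)
    · exact absurd h' (no₁ _ _ hS' hT)
    · exact absurd h (no₂ _ _ hS hT)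
    · have e1 := upd₂ _ _ hS hT h
      have e2 := upd₂ _ _ hS' hT h'
      have hh := (inc₂ _ _ hS hT e1).1 h
      have hh' := (inc₂ _ _ hS' hT e2).1 h'
      refine Subtype.ext (EnhancedState.ext (smoothing_eq_update hS.1.1 e1 e2 hS'.1.1)
        (funext fun p => ?_))
      by_cases hp : p ∈ K
      · rw [constK _ (Or.inl hS.1.1) p hp, constK _ (Or.inl hS'.1.1) p hp, hS.2, hS'.2]
      · rw [← hh p hp, ← hh' p hp]
  -- Survivors have `c` 1-smoothed and `d` 0-smoothed. None can map to `B₁`, where `c` is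
  -- 0-smoothed, and none is reached from `A₂`, where `d` is 1-smoothed.
  · rintro S T U V (hS | hS) (hT | hT) hST hU hU' hV hV' hSV hUT
    · have hUc := ((hQ U.1).1 ⟨hU, hU'⟩).1
      have := (hUT.eq_update (c := c) (by rw [hUc, hT.1.1]; simp)).1
      exact absurd (hUc.symm.trans this) (by simp)
    · exact no₁ _ _ hS hT hST
    · exact no₂ _ _ hS hT hST
    · have hVd := ((hQ V.1).1 ⟨hV, hV'⟩).2
      have := (hSV.eq_update (c := d) (by rw [hVd, hS.1.2]; simp)).1
      exact absurd (hS.1.2.symm.trans this) (by simp)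
  · intro S
    rw [hQ, fits]
    simp [hRK]

end PlanarDiagram

/-! ### The differential squares to zero. -/

namespace PlanarDiagram

open Relation Function
open scoped Classical

/-- Every curve on the diagram meets the four corners of a crossing evenly: a function constant
along all segments away from the crossing `c` has sum zero over its corners. -/
def IsEven (D : PlanarDiagram) : Prop :=
  ∀ (σ : D.Cr → Bool) (c : D.Cr) (f : D.Pt → ZMod 2),
    (∀ p q, D.wire p q → f p = f q) →
    (∀ d, d ≠ c → (σ d = false →
        f (D.cross d 0) = f (D.cross d 1) ∧ f (D.cross d 2) = f (D.cross d 3)) ∧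
      (σ d = true → f (D.cross d 0) = f (D.cross d 3) ∧ f (D.cross d 1) = f (D.cross d 2))) →
    f (D.cross c 0) + f (D.cross c 1) + f (D.cross c 2) + f (D.cross c 3) = 0

section

variable {D : PlanarDiagram} {base : D.Pt} {σ : D.Cr → Bool} {c : D.Cr}

/-- Evenness excludes that the ends of the under-strand lie on different circles both before and
after the change. Delete the crossing and take the indicator function of the component of corner 0.
In the excluded case it vanishes at the other three corners: at 2 directly, at 3 because 2 and 3 are
joined in the 0-smoothing, at 1 because 1 and 2 are joined in the 1-smoothing. Its sum would be odd.
-/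
theorem IsEven.sameCircle_or (hD : D.IsEven) (hc : σ c = false) :
    D.SameCircle σ (D.cross c 0) (D.cross c 2) ∨
      D.SameCircle (update σ c true) (D.cross c 0) (D.cross c 2) := by
  by_contra! hcon
  obtain ⟨h1, h2⟩ := hcon
  let r : D.Pt → D.Pt → Prop := fun p q => D.wire p q ∨ ∃ d, d ≠ c ∧
    ((σ d = false ∧ ((p = D.cross d 0 ∧ q = D.cross d 1) ∨ (p = D.cross d 2 ∧ q = D.cross d 3))) ∨
    (σ d = true ∧ ((p = D.cross d 0 ∧ q = D.cross d 3) ∨ (p = D.cross d 1 ∧ q = D.cross d 2))))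
  have hr : ∀ p q, EqvGen r p q → D.SameCircle σ p q := by
    refine EqvGen.mono ?_
    rintro p q (h | ⟨d, -, h⟩)
    exacts [Or.inl h, Or.inr ⟨d, h⟩]
  have hr' : ∀ p q, EqvGen r p q → D.SameCircle (update σ c true) p q := by
    refine EqvGen.mono ?_
    rintro p q (h | ⟨d, hd, h⟩)
    exacts [Or.inl h, Or.inr ⟨d, by rwa [update_of_ne hd]⟩]
  let f : D.Pt → ZMod 2 := fun p => if EqvGen r (D.cross c 0) p then 1 else 0
  have hf : ∀ p q, r p q → f p = f q := by
    intro p q h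
    have : EqvGen r (D.cross c 0) p ↔ EqvGen r (D.cross c 0) q :=
      ⟨fun h' => h'.trans _ _ _ (EqvGen.rel _ _ h),
        fun h' => h'.trans _ _ _ ((EqvGen.rel _ _ h).symm _ _)⟩
    simp only [f, this]
  have key := hD σ c f (fun p q h => hf _ _ (Or.inl h)) fun d hd =>
    ⟨fun h => ⟨hf _ _ (Or.inr ⟨d, hd, Or.inl ⟨h, Or.inl ⟨rfl, rfl⟩⟩⟩),
        hf _ _ (Or.inr ⟨d, hd, Or.inl ⟨h, Or.inr ⟨rfl, rfl⟩⟩⟩)⟩,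
      fun h => ⟨hf _ _ (Or.inr ⟨d, hd, Or.inr ⟨h, Or.inl ⟨rfl, rfl⟩⟩⟩),
        hf _ _ (Or.inr ⟨d, hd, Or.inr ⟨h, Or.inr ⟨rfl, rfl⟩⟩⟩)⟩⟩
  have j23 : D.SameCircle σ (D.cross c 2) (D.cross c 3) :=
    Joined.sameCircle (Or.inr ⟨c, Or.inl ⟨hc, Or.inr ⟨rfl, rfl⟩⟩⟩)
  have j12 : D.SameCircle (update σ c true) (D.cross c 1) (D.cross c 2) :=
    Joined.sameCircle (Or.inr ⟨c, Or.inr ⟨update_self _ _ _, Or.inr ⟨rfl, rfl⟩⟩⟩)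
  have f0 : f (D.cross c 0) = 1 := if_pos (EqvGen.refl _)
  have f1 : f (D.cross c 1) = 0 := if_neg fun h => h2 ((hr' _ _ h).trans j12)
  have f2 : f (D.cross c 2) = 0 := if_neg fun h => h1 (hr _ _ h)
  have f3 : f (D.cross c 3) = 0 := if_neg fun h => h1 ((hr _ _ h).trans j23.symm)
  rw [f0, f1, f2, f3] at key
  exact absurd key (by decide)

variable (base) in
/-- The points of `Q` lie on different circles, none of which is the base circle. -/
def Independent (σ : D.Cr → Bool) (Q : List D.Pt) : Prop :=
  (base :: Q).Pairwise fun p q => ¬ D.SameCircle σ p q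

variable (base) in
/-- The point `p` lies on the base circle or on a circle through a point of `Q`. -/
def Marked (σ : D.Cr → Bool) (Q : List D.Pt) (p : D.Pt) : Prop :=
  ∃ q ∈ base :: Q, D.SameCircle σ q p

variable (base) in
/-- The monomial in the points of `Q`, as a chain supported at the vertex `σ`. -/
noncomputable def monomial (σ : D.Cr → Bool) (Q : List D.Pt) : D.ReducedState base → ZMod 2 :=
  fun S => if S.1.smoothing = σ ∧ Independent base σ Q ∧
    ∀ p, S.1.isX p = true ↔ Marked base σ Q p then 1 else 0

theorem Marked.congr {Q : List D.Pt} {p q : D.Pt} (h : D.SameCircle σ p q) :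
    Marked base σ Q p ↔ Marked base σ Q q :=
  ⟨fun ⟨x, hx, h'⟩ => ⟨x, hx, h'.trans h⟩, fun ⟨x, hx, h'⟩ => ⟨x, hx, h'.trans h.symm⟩⟩

theorem marked_cons {Q : List D.Pt} {p q : D.Pt} :
    Marked base σ (p :: Q) q ↔ D.SameCircle σ p q ∨ Marked base σ Q q := by
  simp only [Marked, List.mem_cons]
  constructor
  · rintro ⟨x, rfl | rfl | hx, h⟩
    · exact Or.inr ⟨_, Or.inl rfl, h⟩
    · exact Or.inl h
    · exact Or.inr ⟨_, Or.inr hx, h⟩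
  · rintro (h | ⟨x, rfl | hx, h⟩)
    · exact ⟨_, Or.inr (Or.inl rfl), h⟩
    · exact ⟨_, Or.inl rfl, h⟩
    · exact ⟨_, Or.inr (Or.inr hx), h⟩

theorem independent_cons {Q : List D.Pt} {p : D.Pt} :
    Independent base σ (p :: Q) ↔ ¬ Marked base σ Q p ∧ Independent base σ Q := by
  simp only [Independent, Marked, List.pairwise_cons, List.mem_cons]
  constructor
  · rintro ⟨h1, h2, h3⟩
    refine ⟨?_, fun x hx => h1 x (Or.inr hx), h3⟩
    rintro ⟨x, rfl | hx, h⟩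
    · exact h1 p (Or.inl rfl) h
    · exact h2 x hx h.symm
  · rintro ⟨h1, h2, h3⟩
    refine ⟨?_, fun x hx h => h1 ⟨x, Or.inr hx, h.symm⟩, h3⟩
    rintro x (rfl | hx) h
    · exact h1 ⟨_, Or.inl rfl, h⟩
    · exact h2 x hx h

/-- Monomials model the chain group at a vertex as a polynomial ring in variables `x_p`, modulo `x_p
= x_q` on a common circle, `x_p ^ 2 = 0` and `x_base = 0`. In this model a merge is the quotient map
and a split at `c` is multiplication by the sum of the variables of corners 0 and 2. The present
lemma is the first relation; `monomial_eq_zero` contains the other two. -/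
theorem monomial_congr {Q : List D.Pt} {p q : D.Pt} (h : D.SameCircle σ p q) :
    monomial base σ (p :: Q) = monomial base σ (q :: Q) := by
  have h1 : ∀ x, D.SameCircle σ p x ↔ D.SameCircle σ q x := fun x =>
    ⟨fun h' => h.symm.trans h', fun h' => h.trans h'⟩
  unfold monomial
  simp only [independent_cons, marked_cons, h1, Marked.congr (base := base) (Q := Q) h]

theorem monomial_swap {Q : List D.Pt} {p q : D.Pt} :
    monomial base σ (p :: q :: Q) = monomial base σ (q :: p :: Q) := by
  have h1 : D.SameCircle σ q p ↔ D.SameCircle σ p q := ⟨SameCircle.symm, SameCircle.symm⟩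
  unfold monomial
  simp only [independent_cons, marked_cons, h1]
  ext S
  congr 1
  simp only [not_or, or_left_comm, eq_iff_iff]
  tauto

theorem monomial_add_self {v : D.ReducedState base → ZMod 2} : v + v = 0 := by
  ext S
  exact CharTwo.add_self_eq_zero _

/-- Every generator is a monomial. -/
theorem exists_monomial (S : D.ReducedState base) :
    ∃ Q, monomial base S.1.smoothing Q = Pi.single S 1 := by
  obtain ⟨Q, hQ1, hQ2⟩ : ∃ Q, Independent base S.1.smoothing Q ∧
      ∀ p, S.1.isX p = true ↔ Marked base S.1.smoothing Q p := by
    -- a maximal independent list of points labelled `X`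
    have hfin : ∀ Q, Independent base S.1.smoothing Q → Q.length ≤ Nat.card D.Pt := by
      intro Q hQ
      have hn : (base :: Q).Nodup := List.Pairwise.imp
        (fun {a b} (h : ¬ D.SameCircle S.1.smoothing a b) (e : a = b) =>
          h (e ▸ SameCircle.refl _ a)) hQ
      let _ := Fintype.ofFinite D.Pt
      have := hn.length_le_card
      rw [Nat.card_eq_fintype_card]
      simp only [List.length_cons] at this
      omega
    let s : Set ℕ := {n | ∃ Q, Q.length = n ∧ Independent base S.1.smoothing Q ∧
      ∀ p, Marked base S.1.smoothing Q p → S.1.isX p = true}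
    have hs : s.Nonempty := by
      refine ⟨0, [], rfl, by simp [Independent], ?_⟩
      rintro p ⟨q, hq, h⟩
      rw [List.mem_singleton] at hq
      subst hq
      rw [← S.1.isX_eq h]
      exact S.2
    have hb : BddAbove s := ⟨Nat.card D.Pt, by
      rintro n ⟨Q, rfl, hQ, -⟩
      exact hfin Q hQ⟩
    obtain ⟨Q, hl, hQ, hm⟩ := Nat.sSup_mem hs hb
    refine ⟨Q, hQ, fun p => ⟨fun hp => ?_, hm p⟩⟩
    by_contra hcon
    have : (p :: Q).length ∈ s := by
      refine ⟨p :: Q, rfl, independent_cons.2 ⟨hcon, hQ⟩, fun q hq => ?_⟩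
      rcases marked_cons.1 hq with h | h
      · rw [← S.1.isX_eq h, hp]
      · exact hm q h
    have := le_csSup hb this
    rw [← hl, List.length_cons] at this
    omega
  refine ⟨Q, ?_⟩
  ext T
  by_cases hT : T = S
  · subst hT
    rw [Pi.single_eq_same]
    exact if_pos ⟨rfl, hQ1, hQ2⟩
  · rw [Pi.single_eq_of_ne hT]
    refine if_neg fun h => hT (Subtype.ext (EnhancedState.ext h.1 (funext fun p => ?_)))
    rw [Bool.eq_iff_iff, h.2.2 p, hQ2 p]

variable (base) in
/-- The component of the differential at the crossing `c`, on monomials. -/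
noncomputable def edge (σ : D.Cr → Bool) (c : D.Cr) (Q : List D.Pt) :
    D.ReducedState base → ZMod 2 :=
  if D.SameCircle σ (D.cross c 0) (D.cross c 2) then
    monomial base (update σ c true) (D.cross c 0 :: Q) +
      monomial base (update σ c true) (D.cross c 2 :: Q)
  else monomial base (update σ c true) Q

end

end PlanarDiagram

namespace PlanarDiagram

open Relation Function
open scoped Classical

section

variable {D : PlanarDiagram} {base : D.Pt} {σ σ' : D.Cr → Bool} {c : D.Cr} {Q : List D.Pt}

/-- If the under-strand at `c` lies on one circle of `σ'`, then circles of `σ` are not cut in `σ'`. -/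
theorem SameCircle.of_flip {p q : D.Pt} (h : D.SameCircle σ p q)
    (hσ : ∀ d, d ≠ c → σ d = σ' d) (hab : D.SameCircle σ' (D.cross c 0) (D.cross c 2)) :
    D.SameCircle σ' p q := by
  rcases h.flip hσ with h | ⟨h | h, h' | h'⟩
  · exact h
  · exact h.trans h'.symm
  · exact h.trans (hab.trans h'.symm)
  · exact h.trans (hab.symm.trans h'.symm)
  · exact h.trans h'.symm

theorem Independent.eq_of_sameCircle (h : Independent base σ Q) {x y : D.Pt}
    (hx : x ∈ base :: Q) (hy : y ∈ base :: Q) (hxy : D.SameCircle σ x y) : x = y := by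
  by_contra hne
  have : Std.Symm fun p q => ¬ D.SameCircle σ p q := ⟨fun _ _ h h' => h h'.symm⟩
  exact List.Pairwise.forall h hx hy hne hxy

theorem Independent.mono (h : Independent base σ Q)
    (hle : ∀ p q, D.SameCircle σ' p q → D.SameCircle σ p q) : Independent base σ' Q :=
  List.Pairwise.imp (fun {a b} (h : ¬ D.SameCircle σ a b) h' => h (hle a b h')) h

theorem monomial_eq_zero (h : ¬ Independent base σ Q) : monomial base σ Q = 0 := by
  ext S
  exact if_neg fun h' => h h'.2.1

variable (base) in
/-- The generator underlying a monomial. -/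
noncomputable def markedState (σ : D.Cr → Bool) (Q : List D.Pt) : D.ReducedState base :=
  ⟨{ smoothing := σ
     isX := fun p => decide (Marked base σ Q p)
     compat := fun p q h => by simp only [Marked.congr h.sameCircle] },
    decide_eq_true ⟨base, by simp, SameCircle.refl _ _⟩⟩

theorem monomial_eq_single (h : Independent base σ Q) :
    monomial base σ Q = Pi.single (markedState base σ Q) 1 := by
  ext T
  by_cases hT : T = markedState base σ Q
  · subst hT
    rw [Pi.single_eq_same]
    exact if_pos ⟨rfl, h, fun p => decide_eq_true_iff⟩
  · rw [Pi.single_eq_of_ne hT]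
    refine if_neg fun h' => hT (Subtype.ext (EnhancedState.ext h'.1 (funext fun p => ?_)))
    rw [Bool.eq_iff_iff, h'.2.2 p]
    exact decide_eq_true_iff.symm

/-- The formula for an edge respects the relations. After a merge coinciding circles still coincide.
After a split, if an end `u` is independent of the list then no listed point lies on the circle of
`u`, and the list was already independent before; so each summand vanishes on a dependent list. -/
theorem edge_eq_zero (hD : D.IsEven) (hc : σ c = false) (h : ¬ Independent base σ Q) :
    edge base σ c Q = 0 := by
  have hσ : ∀ d, d ≠ c → update σ c true d = σ d := fun d hd => update_of_ne hd _ _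
  have hσ' : ∀ d, d ≠ c → σ d = update σ c true d := fun d hd => (hσ d hd).symm
  unfold edge
  split_ifs with hab
  · by_cases hab' : D.SameCircle (update σ c true) (D.cross c 0) (D.cross c 2)
    · rw [monomial_congr hab', monomial_add_self]
    have key : ∀ u v : D.Pt, D.IsUnder c u v → ¬ Independent base (update σ c true) (u :: Q) := by
      intro u v huv hI
      obtain ⟨h1, h2⟩ := independent_cons.1 hI
      refine h (List.Pairwise.imp_of_mem ?_ h2)
      intro x y hx hy hxy hs
      rcases hs.flip' huv hσ' with h' | ⟨hx' | hx', hy' | hy'⟩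
      · exact hxy h'
      · exact h1 ⟨x, hx, hx'⟩
      · exact h1 ⟨x, hx, hx'⟩
      · exact h1 ⟨y, hy, hy'⟩
      · exact hxy (hx'.trans hy'.symm)
    rw [monomial_eq_zero (key _ _ (Or.inl ⟨rfl, rfl⟩)),
      monomial_eq_zero (key _ _ (Or.inr ⟨rfl, rfl⟩)), add_zero]
  · have hab' := (hD.sameCircle_or hc).resolve_left hab
    exact monomial_eq_zero fun h' => h (h'.mono fun _ _ hs => hs.of_flip hσ' hab')

set_option linter.unusedSimpArgs false in
-- Comparison of the ring model with the definition of incidence by counting labels. If one circle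
-- stays one circle, the two monomials are equal and cancel, in agreement with the absence of
-- incidences.
theorem edge_apply (hD : D.IsEven) (hc : σ c = false) (hQ : Independent base σ Q)
    (T : D.ReducedState base) (hT : T.1.smoothing = update σ c true) :
    edge base σ c Q T = D.incidence base T (markedState base σ Q) := by
  have hσ : ∀ d, d ≠ c → T.1.smoothing d = σ d := fun d hd => by rw [hT, update_of_ne hd]
  have hσ' : ∀ d, d ≠ c → σ d = T.1.smoothing d := fun d hd => (hσ d hd).symm
  have hor := hD.sameCircle_or hc
  have hlab : ∀ p, (markedState base σ Q).1.isX p = decide (Marked base σ Q p) := fun _ => rfl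
  have hsm : (markedState base σ Q).1.smoothing = σ := rfl
  unfold edge incidence
  simp only [Matrix.of_apply]
  rw [EnhancedState.incident_iff (Or.inl ⟨rfl, rfl⟩) hc hT]
  rw [← hT] at hor ⊢
  simp only [hlab, hsm]
  set a := D.cross c 0
  set b := D.cross c 2
  set τ := T.1.smoothing
  by_cases hab : D.SameCircle σ a b
  · rw [if_pos hab]
    by_cases hab' : D.SameCircle τ a b
    · rw [monomial_congr hab', monomial_add_self]
      simp [hab, hab']
    have hle : ∀ p q, D.SameCircle τ p q → D.SameCircle σ p q := fun p q h =>
      h.of_flip hσ hab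
    have hQ' := hQ.mono hle
    -- An independent list has at most one member on the circle that splits, so only one half can be
    -- marked.
    have hnot : Marked base τ Q a → ¬ Marked base τ Q b := by
      rintro ⟨x, hx, hxa⟩ ⟨y, hy, hyb⟩
      have := hQ.eq_of_sameCircle hx hy
        ((hle _ _ hxa).trans (hab.trans (hle _ _ hyb).symm))
      subst this
      exact hab' (hxa.symm.trans hyb)
    have hM : Marked base σ Q a ↔ Marked base τ Q a ∨ Marked base τ Q b := by
      constructor
      · rintro ⟨x, hx, h⟩
        rcases h.flip hσ' with h | ⟨h | h, -⟩
        · exact Or.inl ⟨x, hx, h⟩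
        · exact Or.inl ⟨x, hx, h⟩
        · exact Or.inr ⟨x, hx, h⟩
      · rintro (⟨x, hx, h⟩ | ⟨x, hx, h⟩)
        · exact ⟨x, hx, hle _ _ h⟩
        · exact ⟨x, hx, (hle _ _ h).trans hab.symm⟩
    have haway : ∀ p, ¬ D.SameCircle σ p a → (Marked base σ Q p ↔ Marked base τ Q p) := by
      intro p hp
      constructor
      · rintro ⟨x, hx, h⟩
        rcases h.flip hσ' with h | ⟨-, h | h⟩
        · exact ⟨x, hx, h⟩
        · exact absurd (hle _ _ h) hp
        · exact absurd ((hle _ _ h).trans hab.symm) hp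
      · rintro ⟨x, hx, h⟩
        exact ⟨x, hx, hle _ _ h⟩
    have hnear : ∀ p, D.SameCircle σ p a → D.SameCircle τ p a ∨ D.SameCircle τ p b := by
      intro p hp
      rcases hp.flip hσ' with h | ⟨h, -⟩
      · exact Or.inl h
      · exact h
    have hmono : ∀ u v : D.Pt, ((u = a ∧ v = b) ∨ (u = b ∧ v = a)) →
        monomial base τ (u :: Q) T = if ¬ Marked base τ Q u ∧
          (∀ p, ¬ D.SameCircle σ p a → (T.1.isX p = true ↔ Marked base σ Q p)) ∧
          T.1.isX u = true ∧ (T.1.isX v = true ↔ Marked base τ Q v) then 1 else 0 := by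
      intro u v huv
      unfold monomial
      congr 1
      rw [eq_iff_iff]
      have huv' : ¬ D.SameCircle τ u v := by
        rcases huv with ⟨rfl, rfl⟩ | ⟨rfl, rfl⟩
        · exact hab'
        · exact fun h => hab' h.symm
      have hua : D.SameCircle σ u a := by
        rcases huv with ⟨rfl, rfl⟩ | ⟨rfl, rfl⟩
        · exact SameCircle.refl _ _
        · exact hab.symm
      have hnear' : ∀ p, D.SameCircle σ p a → D.SameCircle τ u p ∨ D.SameCircle τ p v := by
        intro p hp
        rcases huv with ⟨rfl, rfl⟩ | ⟨rfl, rfl⟩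
        · exact (hnear p hp).imp SameCircle.symm id
        · exact (hnear p hp).symm.imp SameCircle.symm id
      simp only [independent_cons, marked_cons]
      constructor
      · rintro ⟨-, ⟨h1, -⟩, h2⟩
        refine ⟨h1, fun p hp => ?_, (h2 u).2 (Or.inl (SameCircle.refl _ _)), ?_⟩
        · rw [h2, haway p hp, or_iff_right]
          exact fun h => hp ((hle _ _ h).symm.trans hua)
        · rw [h2, or_iff_right huv']
      · rintro ⟨h1, h2, h3, h4⟩
        refine ⟨rfl, ⟨h1, hQ'⟩, fun p => ?_⟩
        by_cases hp : D.SameCircle σ p a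
        · rcases hnear' p hp with h | h
          · rw [← T.1.isX_eq h, h3]
            simp [h]
          · rw [T.1.isX_eq h, h4, ← Marked.congr h, or_iff_right]
            exact fun h' => huv' (h'.trans h)
        · rw [h2 p hp, haway p hp, or_iff_right]
          exact fun h => hp ((hle _ _ h).symm.trans hua)
    rw [Pi.add_apply, hmono a b (Or.inl ⟨rfl, rfl⟩), hmono b a (Or.inr ⟨rfl, rfl⟩)]
    have h3 : (∀ p, ¬ D.SameCircle σ p a → ¬ D.SameCircle σ p b →
        T.1.isX p = decide (Marked base σ Q p)) ↔
        (∀ p, ¬ D.SameCircle σ p a → (T.1.isX p = true ↔ Marked base σ Q p)) := by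
      refine forall_congr' fun p => forall_congr' fun hp => ?_
      rw [Bool.eq_iff_iff, decide_eq_true_iff]
      exact ⟨fun h => h fun h' => hp (h'.trans hab.symm), fun h _ => h⟩
    rw [h3]
    by_cases hA : ∀ p, ¬ D.SameCircle σ p a → (T.1.isX p = true ↔ Marked base σ Q p)
    swap
    · simp [hA]
    by_cases h4 : Marked base τ Q a
    · have h5 := hnot h4
      cases h6 : T.1.isX a <;> cases h7 : T.1.isX b <;>
        simp [hA, h4, h5, hM, hab, hab', h6, h7]
    · by_cases h5 : Marked base τ Q b
      · cases h6 : T.1.isX a <;> cases h7 : T.1.isX b <;>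
          simp [hA, h4, h5, hM, hab, hab', h6, h7]
      · cases h6 : T.1.isX a <;> cases h7 : T.1.isX b <;>
          simp [hA, h4, h5, hM, hab, hab', h6, h7]
  · rw [if_neg hab]
    have hab' : D.SameCircle τ a b := hor.resolve_left hab
    have hle : ∀ p q, D.SameCircle σ p q → D.SameCircle τ p q := fun p q h =>
      h.of_flip hσ' hab'
    -- After a merge the monomial vanishes exactly when both circles were marked: this is `X·X = 0`.
    have hind : Independent base τ Q ↔ ¬ (Marked base σ Q a ∧ Marked base σ Q b) := by
      constructor
      · rintro h ⟨⟨x, hx, hxa⟩, ⟨y, hy, hyb⟩⟩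
        have := h.eq_of_sameCircle hx hy ((hle _ _ hxa).trans (hab'.trans (hle _ _ hyb).symm))
        subst this
        exact hab (hxa.symm.trans hyb)
      · intro h
        refine List.Pairwise.imp_of_mem ?_ hQ
        intro x y hx hy hxy hs
        rcases hs.flip hσ with h' | ⟨hx' | hx', hy' | hy'⟩
        · exact hxy h'
        · exact hxy (hx'.trans hy'.symm)
        · exact h ⟨⟨x, hx, hx'⟩, ⟨y, hy, hy'⟩⟩
        · exact h ⟨⟨y, hy, hy'⟩, ⟨x, hx, hx'⟩⟩
        · exact hxy (hx'.trans hy'.symm)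
    have hnear : Marked base τ Q a ↔ Marked base σ Q a ∨ Marked base σ Q b := by
      constructor
      · rintro ⟨x, hx, h⟩
        rcases h.flip hσ with h | ⟨h | h, -⟩
        · exact Or.inl ⟨x, hx, h⟩
        · exact Or.inl ⟨x, hx, h⟩
        · exact Or.inr ⟨x, hx, h⟩
      · rintro (⟨x, hx, h⟩ | ⟨x, hx, h⟩)
        · exact ⟨x, hx, hle _ _ h⟩
        · exact ⟨x, hx, (hle _ _ h).trans hab'.symm⟩
    have haway : ∀ p, ¬ D.SameCircle σ p a → ¬ D.SameCircle σ p b →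
        (Marked base τ Q p ↔ Marked base σ Q p) := by
      intro p hpa hpb
      constructor
      · rintro ⟨x, hx, h⟩
        rcases h.flip hσ with h | ⟨-, h | h⟩
        · exact ⟨x, hx, h⟩
        · exact absurd h hpa
        · exact absurd h hpb
      · rintro ⟨x, hx, h⟩
        exact ⟨x, hx, hle _ _ h⟩
    have hall : (∀ p, T.1.isX p = true ↔ Marked base τ Q p) ↔
        (∀ p, ¬ D.SameCircle σ p a → ¬ D.SameCircle σ p b →
          T.1.isX p = decide (Marked base σ Q p)) ∧
        (T.1.isX a = true ↔ Marked base σ Q a ∨ Marked base σ Q b) := by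
      constructor
      · intro h
        refine ⟨fun p h1 h2 => ?_, by rw [h, hnear]⟩
        rw [Bool.eq_iff_iff, decide_eq_true_iff, h, haway p h1 h2]
      · rintro ⟨h1, h2⟩ p
        by_cases hp : D.SameCircle τ p a
        · rw [T.1.isX_eq hp, h2, Marked.congr hp, hnear]
        · rw [h1 p (fun h => hp (hle _ _ h)) (fun h => hp ((hle _ _ h).trans hab'.symm)),
            decide_eq_true_iff, haway p (fun h => hp (hle _ _ h))
              (fun h => hp ((hle _ _ h).trans hab'.symm))]
    unfold monomial
    simp only [hind, hall]
    congr 1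
    rw [eq_iff_iff]
    by_cases h4 : Marked base σ Q a <;> by_cases h5 : Marked base σ Q b <;>
      cases h6 : T.1.isX a <;> simp [h4, h5, hab, hab'] <;> intro _ <;> rfl

end

end PlanarDiagram

namespace PlanarDiagram

open Relation Function
open scoped Classical

section

variable {D : PlanarDiagram} {base : D.Pt} {σ : D.Cr → Bool} {c d : D.Cr} {Q : List D.Pt}

/-- The formula includes dependent lists, where both sides vanish. Hence it can be applied again to
the output of an edge without checking independence. -/
theorem incidence_mulVec_monomial [Fintype D.Cr] (hD : D.IsEven) (σ : D.Cr → Bool)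
    (Q : List D.Pt) :
    (D.incidence base).mulVec (monomial base σ Q) =
      ∑ c, if σ c = false then edge base σ c Q else 0 := by
  by_cases hQ : Independent base σ Q
  · rw [monomial_eq_single hQ, Matrix.mulVec_single_one]
    ext T
    rw [Finset.sum_apply, Matrix.col_apply]
    have hedge : ∀ c, T.1.smoothing ≠ update σ c true → edge base σ c Q T = 0 := by
      intro c hT
      have hm : ∀ Q', monomial base (update σ c true) Q' T = 0 := fun Q' =>
        if_neg fun h => hT h.1
      unfold edge
      split_ifs
      · rw [Pi.add_apply, hm, hm, add_zero]
      · rw [hm]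
    by_cases hT : ∃ c, σ c = false ∧ T.1.smoothing = update σ c true
    · obtain ⟨c, hc, hT⟩ := hT
      rw [Finset.sum_eq_single c, if_pos hc, edge_apply hD hc hQ T hT]
      · intro d _ hdc
        split_ifs with hd
        · refine hedge d fun h => ?_
          have := congrFun (hT.symm.trans h) d
          rw [update_self, update_of_ne hdc, hd] at this
          exact absurd this (by simp)
        · rfl
      · simp
    · rw [incidence_eq_zero.2, Finset.sum_eq_zero]
      · intro c _
        split_ifs with hc
        · exact hedge c fun h => hT ⟨c, hc, h⟩
        · rfl
      · intro h
        exact hT h.exists_update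
  · rw [monomial_eq_zero hQ, Matrix.mulVec_zero, Finset.sum_eq_zero]
    intro c _
    split_ifs with hc
    · exact edge_eq_zero hD hc hQ
    · rfl

variable (base) in
/-- The component of the square of the differential at the crossings `c`, `d`. -/
noncomputable def doubleEdge (σ : D.Cr → Bool) (c d : D.Cr) (Q : List D.Pt) :
    D.ReducedState base → ZMod 2 :=
  if D.SameCircle σ (D.cross c 0) (D.cross c 2) then
    edge base (update σ c true) d (D.cross c 0 :: Q) +
      edge base (update σ c true) d (D.cross c 2 :: Q)
  else edge base (update σ c true) d Q

theorem incidence_mulVec_edge [Fintype D.Cr] (hD : D.IsEven) (σ : D.Cr → Bool) (c : D.Cr)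
    (Q : List D.Pt) :
    (D.incidence base).mulVec (edge base σ c Q) =
      ∑ d, if update σ c true d = false then doubleEdge base σ c d Q else 0 := by
  unfold edge doubleEdge
  split_ifs with h
  · rw [Matrix.mulVec_add, incidence_mulVec_monomial hD, incidence_mulVec_monomial hD,
      ← Finset.sum_add_distrib]
    refine Finset.sum_congr rfl fun d _ => ?_
    split_ifs <;> simp
  · exact incidence_mulVec_monomial hD _ _

/-- The square of smoothings obtained by changing two crossings. -/
structure IsSquare (D : PlanarDiagram) (c d : D.Cr) (s s₁ s₂ t : D.Cr → Bool) : Prop where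
  left : ∀ e, e ≠ c → s e = s₁ e
  right : ∀ e, e ≠ d → s e = s₂ e
  left' : ∀ e, e ≠ d → s₁ e = t e
  right' : ∀ e, e ≠ c → s₂ e = t e

namespace IsSquare

variable {s s₁ s₂ t : D.Cr → Bool}

theorem swap (h : D.IsSquare c d s s₁ s₂ t) : D.IsSquare d c s s₂ s₁ t :=
  ⟨h.right, h.left, h.right', h.left'⟩

/-- The change at `d` separates the ends at `c`, so in `s₂` these lie on the circles of the two
different ends at `d`. Joining the former in `t` joins the latter. -/
theorem sameCircle_of_split_split (h : D.IsSquare c d s s₁ s₂ t)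
    (P00 : D.SameCircle s (D.cross c 0) (D.cross c 2))
    (P01 : ¬ D.SameCircle s₂ (D.cross c 0) (D.cross c 2))
    (P11 : D.SameCircle t (D.cross c 0) (D.cross c 2)) :
    D.SameCircle t (D.cross d 0) (D.cross d 2) := by
  have up : ∀ p q, D.SameCircle s₂ p q → D.SameCircle t p q := fun p q hs =>
    hs.of_flip h.right' P11
  rcases P00.flip h.right with h1 | ⟨h1 | h1, h2 | h2⟩
  · exact absurd h1 P01
  · exact absurd (h1.trans h2.symm) P01
  · exact ((up _ _ h1).symm.trans P11).trans (up _ _ h2)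
  · exact ((up _ _ h2).symm.trans P11.symm).trans (up _ _ h1)
  · exact absurd (h1.trans h2.symm) P01

/-- The change at `c` joins the ends at `d`, so in `s` these lie on the circles of the two different
ends at `c`. The change at `d` joins these circles too. -/
theorem sameCircle_of_merge_split (h : D.IsSquare c d s s₁ s₂ t)
    (Q00 : ¬ D.SameCircle s (D.cross d 0) (D.cross d 2))
    (Q10 : D.SameCircle s₁ (D.cross d 0) (D.cross d 2))
    (Q01 : D.SameCircle s₂ (D.cross d 0) (D.cross d 2)) :
    D.SameCircle s₂ (D.cross c 0) (D.cross c 2) := by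
  have up : ∀ p q, D.SameCircle s p q → D.SameCircle s₂ p q := fun p q hs =>
    hs.of_flip h.right Q01
  rcases Q10.flip (fun e he => (h.left e he).symm) with h1 | ⟨h1 | h1, h2 | h2⟩
  · exact absurd h1 Q00
  · exact absurd (h1.trans h2.symm) Q00
  · exact ((up _ _ h1).symm.trans Q01).trans (up _ _ h2)
  · exact ((up _ _ h2).symm.trans Q01.symm).trans (up _ _ h1)
  · exact absurd (h1.trans h2.symm) Q00

/-- In `s₁` all four ends lie on one circle. If `t` cuts it, the ends at `c` and the ends at `d`
both represent the same two pieces, so the two sums agree; otherwise both vanish modulo 2. -/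
theorem monomial_add_eq (h : D.IsSquare c d s s₁ s₂ t)
    (P10 : D.SameCircle s₁ (D.cross c 0) (D.cross c 2))
    (Q01 : D.SameCircle s₂ (D.cross d 0) (D.cross d 2))
    (Q00 : ¬ D.SameCircle s (D.cross d 0) (D.cross d 2))
    (Q10 : D.SameCircle s₁ (D.cross d 0) (D.cross d 2)) :
    monomial base t (D.cross d 0 :: Q) + monomial base t (D.cross d 2 :: Q) =
      monomial base t (D.cross c 0 :: Q) + monomial base t (D.cross c 2 :: Q) := by
  by_cases Q11 : D.SameCircle t (D.cross d 0) (D.cross d 2)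
  · have P11 : D.SameCircle t (D.cross c 0) (D.cross c 2) := P10.of_flip h.left' Q11
    rw [monomial_congr Q11, monomial_congr P11, monomial_add_self, monomial_add_self]
  have up0 : ∀ p q, D.SameCircle s p q → D.SameCircle s₁ p q := fun p q hs =>
    hs.of_flip h.left P10
  -- both ends at `c` are joined in `s₁` to the ends at `d`
  have near : ∀ p, D.SameCircle s₁ p (D.cross d 0) →
      D.SameCircle t p (D.cross d 0) ∨ D.SameCircle t p (D.cross d 2) := by
    intro p hp
    rcases hp.flip h.left' with h1 | ⟨h1, -⟩
    · exact Or.inl h1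
    · exact h1
  have hc0 : D.SameCircle s₁ (D.cross c 0) (D.cross d 0) := by
    rcases Q10.flip (fun e he => (h.left e he).symm) with h1 | ⟨h1 | h1, -⟩
    · exact absurd h1 Q00
    · exact (up0 _ _ h1).symm
    · exact P10.trans (up0 _ _ h1).symm
  have hne : ¬ D.SameCircle t (D.cross c 0) (D.cross c 2) := fun P11 =>
    Q11 (Q01.of_flip h.right' P11)
  rcases near _ hc0 with h1 | h1 <;> rcases near _ (P10.symm.trans hc0) with h2 | h2
  · exact absurd (h1.trans h2.symm) hne
  · rw [monomial_congr h1, monomial_congr h2]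
  · rw [monomial_congr h1, monomial_congr h2, add_comm]
  · exact absurd (h1.trans h2.symm) hne

end IsSquare

/-- Quotient maps and multiplications commute, which settles the generic squares. The other
combinations of coincidences at the three lower vertices are impossible or follow from the
`IsSquare` lemmas; evenness supplies the coincidences `W1` to `W4`. -/
theorem doubleEdge_comm (hD : D.IsEven) (hcd : c ≠ d) (hc : σ c = false) (hd : σ d = false)
    (Q : List D.Pt) : doubleEdge base σ c d Q = doubleEdge base σ d c Q := by
  have hc' : update σ d true c = false := by rw [update_of_ne hcd, hc]
  have hd' : update σ c true d = false := by rw [update_of_ne hcd.symm, hd]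
  have hcomm : update (update σ d true) c true = update (update σ c true) d true :=
    update_comm hcd.symm _ _ _
  have sq : D.IsSquare c d σ (update σ c true) (update σ d true)
      (update (update σ c true) d true) :=
    ⟨fun e he => (update_of_ne he _ _).symm, fun e he => (update_of_ne he _ _).symm,
      fun e he => (update_of_ne he _ _).symm,
      fun e he => by rw [← hcomm]; exact (update_of_ne he _ _).symm⟩
  have W1 := hD.sameCircle_or hc
  have W2 := hD.sameCircle_or hd
  have W3 := hD.sameCircle_or hc'
  have W4 := hD.sameCircle_or hd'
  unfold doubleEdge edge
  rw [hcomm] at W3 ⊢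
  set s₁ := update σ c true
  set s₂ := update σ d true
  set t := update s₁ d true
  by_cases P00 : D.SameCircle σ (D.cross c 0) (D.cross c 2) <;>
    by_cases Q10 : D.SameCircle s₁ (D.cross d 0) (D.cross d 2) <;>
    by_cases Q00 : D.SameCircle σ (D.cross d 0) (D.cross d 2) <;>
    by_cases P01 : D.SameCircle s₂ (D.cross c 0) (D.cross c 2) <;>
    simp only [P00, Q10, Q00, P01, if_true, if_false, false_or] at W1 W2 W3 W4 ⊢
  · rw [monomial_swap (p := D.cross c 0) (q := D.cross d 0),
      monomial_swap (p := D.cross c 0) (q := D.cross d 2),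
      monomial_swap (p := D.cross c 2) (q := D.cross d 0),
      monomial_swap (p := D.cross c 2) (q := D.cross d 2)]
    abel
  · have Q11 := sq.sameCircle_of_split_split P00 P01 W3
    simp only [monomial_congr Q11, monomial_add_self, add_zero]
  · exact absurd (Q10.of_flip (fun e he => (sq.left e he).symm) P00) Q00
  · exact absurd (Q10.of_flip (fun e he => (sq.left e he).symm) P00) Q00
  · have P11 := sq.swap.sameCircle_of_split_split Q00 Q10 W4
    simp only [monomial_congr P11, monomial_add_self, add_zero]
  · rw [monomial_congr W3, monomial_congr W4, monomial_add_self, monomial_add_self]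
  · exact absurd (P00.of_flip sq.right W2) P01
  · exact absurd (P01.of_flip (fun e he => (sq.right e he).symm) Q00) P00
  · exact sq.monomial_add_eq W1 W2 Q00 Q10
  · exact absurd (sq.sameCircle_of_merge_split Q00 Q10 W2) P01
  · exact absurd (P01.of_flip (fun e he => (sq.right e he).symm) Q00) P00
  · exact absurd (Q00.of_flip sq.left W1) Q10
  · exact absurd (sq.swap.sameCircle_of_merge_split P00 P01 W1) Q10

/-- The square of the differential is a sum over ordered pairs of crossings, and the two orders
contribute equal terms, which cancel modulo 2. -/
theorem incidence_mul_self (hD : D.IsEven) : D.incidence base * D.incidence base = 0 := by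
  have := Fintype.ofFinite D.Cr
  ext T S
  have key : (D.incidence base).mulVec ((D.incidence base).mulVec (Pi.single S 1)) = 0 := by
    obtain ⟨Q, hQ⟩ := exists_monomial S
    rw [← hQ, incidence_mulVec_monomial hD, Matrix.mulVec_sum]
    set σ := S.1.smoothing
    have h1 : ∀ c, (D.incidence base).mulVec (if σ c = false then edge base σ c Q else 0) =
        ∑ d, if σ c = false ∧ σ d = false ∧ c ≠ d then doubleEdge base σ c d Q else 0 := by
      intro c
      split_ifs with hc
      · rw [incidence_mulVec_edge hD]
        refine Finset.sum_congr rfl fun d _ => ?_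
        congr 1
        rw [eq_iff_iff]
        by_cases hcd : c = d
        · subst hcd; simp
        · rw [update_of_ne (Ne.symm hcd)]; simp [hc, hcd]
      · simp [hc]
    simp only [h1]
    rw [← Finset.sum_product']
    refine Finset.sum_involution (fun x _ => (x.2, x.1)) ?_ ?_ (fun _ _ => Finset.mem_univ _)
      (fun _ _ => rfl)
    · rintro ⟨c, d⟩ -
      dsimp only
      by_cases h : σ c = false ∧ σ d = false ∧ c ≠ d
      · rw [if_pos h, if_pos ⟨h.2.1, h.1, h.2.2.symm⟩, doubleEdge_comm hD h.2.2 h.1 h.2.1,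
          monomial_add_self]
      · rw [if_neg h, if_neg fun h' => h ⟨h'.2.1, h'.1, h'.2.2.symm⟩, add_zero]
    · rintro ⟨c, d⟩ - h h'
      dsimp only at h h'
      have : d = c := congrArg Prod.fst h'
      subst this
      simp at h
  rw [Matrix.mulVec_mulVec, Matrix.mulVec_single_one] at key
  exact congrFun key T

/-- The rank of reduced Khovanov homology of an even diagram. -/
theorem IsEven.rkKh_eq (hD : D.IsEven) (base : D.Pt) : (D.rkKh base : ℤ) = D.khRank base :=
  rkKh_eq_khRank D base (incidence_mul_self hD)

end

end PlanarDiagram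

/-! ### Parity of tangles, and closures of a sum of two tangles. -/

namespace TangleDiagram

open Relation Function PlanarDiagram
open scoped Classical

/-- Every curve which is constant along the wires of the tangle meets the corners of the crossings
and the ends of the tangle evenly. -/
def IsEven (A : TangleDiagram) : Prop :=
  ∀ f : A.Pt → ZMod 2, (∀ p q, A.wire p q → f p = f q) →
    f A.nw + f A.ne + f A.sw + f A.se = ∑ᶠ c, ∑ i, f (A.cross c i)

theorem isEven_zero : zero.IsEven := by
  intro f hf
  have h1 : f (0 : Fin 4) = f (1 : Fin 4) := hf _ _ (Or.inl ⟨rfl, rfl⟩)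
  have h2 : f (2 : Fin 4) = f (3 : Fin 4) := hf _ _ (Or.inr ⟨rfl, rfl⟩)
  change f (0 : Fin 4) + f (1 : Fin 4) + f (2 : Fin 4) + f (3 : Fin 4) = _
  have : IsEmpty zero.Cr := inferInstanceAs (IsEmpty Empty)
  rw [h1, h2, CharTwo.add_self_eq_zero, zero_add, CharTwo.add_self_eq_zero, finsum_of_isEmpty]

theorem isEven_crossing (s : Bool) : (crossing s).IsEven := by
  intro f _
  change f (0 : Fin 4) + f (1 : Fin 4) + f (2 : Fin 4) + f (3 : Fin 4) = _
  have : Unique (crossing s).Cr := inferInstanceAs (Unique Unit)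
  rw [finsum_unique, Fin.sum_univ_four]
  cases s
  · change _ = f (3 : Fin 4) + f (1 : Fin 4) + f (0 : Fin 4) + f (2 : Fin 4)
    ring
  · change _ = f (2 : Fin 4) + f (3 : Fin 4) + f (1 : Fin 4) + f (0 : Fin 4)
    ring

theorem IsEven.rot {A : TangleDiagram} (hA : A.IsEven) : A.rot.IsEven := by
  intro f hf
  change f A.ne + f A.se + f A.nw + f A.sw = ∑ᶠ c, ∑ i, f (A.cross c i)
  rw [← hA f hf]
  ring

/-- The ends glued in the sum are counted once on each side with equal values, so they cancel modulo
2. -/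
theorem IsEven.add {A B : TangleDiagram} (hA : A.IsEven) (hB : B.IsEven) :
    (A.add B).IsEven := by
  intro f hf
  have h1 := hA (fun p => f (Sum.inl p)) (fun p q h => hf (Sum.inl p) (Sum.inl q) h)
  have h2 := hB (fun p => f (Sum.inr p)) (fun p q h => hf (Sum.inr p) (Sum.inr q) h)
  have h3 : f (Sum.inl A.ne) = f (Sum.inr B.nw) := hf (.inl A.ne) (.inr B.nw) (Or.inl ⟨rfl, rfl⟩)
  have h4 : f (Sum.inl A.se) = f (Sum.inr B.sw) := hf (.inl A.se) (.inr B.sw) (Or.inr ⟨rfl, rfl⟩)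
  have := Fintype.ofFinite A.Cr
  have := Fintype.ofFinite B.Cr
  have h5 : ∑ᶠ c, ∑ i, f ((A.add B).cross c i) =
      ∑ᶠ c, ∑ i, f (Sum.inl (A.cross c i)) + ∑ᶠ c, ∑ i, f (Sum.inr (B.cross c i)) := by
    rw [finsum_eq_sum_of_fintype (α := A.Cr), finsum_eq_sum_of_fintype (α := B.Cr)]
    refine (finsum_eq_sum_of_fintype (α := A.Cr ⊕ B.Cr) _).trans ?_
    rw [Fintype.sum_sum_type]
    rfl
  rw [h5, ← h1, ← h2, h3, h4]
  change f (Sum.inl A.nw) + f (Sum.inr B.ne) + f (Sum.inl A.sw) + f (Sum.inr B.se) = _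
  have e1 := CharTwo.add_self_eq_zero (f (Sum.inr B.nw))
  have e2 := CharTwo.add_self_eq_zero (f (Sum.inr B.sw))
  linear_combination -e1 - e2

theorem isEven_twist (s : Bool) (n : ℕ) : (twist s n).IsEven := by
  induction n with
  | zero => exact isEven_zero
  | succ n ih => exact ih.add (isEven_crossing s)

/-- The closure pairs the four ends, whose sum then vanishes. At every crossing other than `c` the
smoothing pairs the corners, so only the corners of `c` remain. -/
theorem IsEven.numerator {A : TangleDiagram} (hA : A.IsEven) : A.numerator.IsEven := by
  intro σ c f hf hd
  have h1 : f A.nw = f A.ne := hf A.nw A.ne (Or.inr (Or.inl ⟨rfl, rfl⟩))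
  have h2 : f A.sw = f A.se := hf A.sw A.se (Or.inr (Or.inr ⟨rfl, rfl⟩))
  have h := hA f (fun p q h => hf p q (Or.inl h))
  rw [h1, h2, CharTwo.add_self_eq_zero, zero_add, CharTwo.add_self_eq_zero,
    finsum_eq_single (α := A.Cr) _ c, Fin.sum_univ_four] at h
  · exact h.symm
  · intro d hdc
    rw [Fin.sum_univ_four]
    obtain ⟨h3, h4⟩ := hd d hdc
    change f (A.cross d 0) + f (A.cross d 1) + f (A.cross d 2) + f (A.cross d 3) = 0
    cases h5 : σ d
    · obtain ⟨h6, h7⟩ := h3 h5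
      change f (A.cross d 0) = f (A.cross d 1) at h6
      change f (A.cross d 2) = f (A.cross d 3) at h7
      rw [h6, h7, CharTwo.add_self_eq_zero, zero_add, CharTwo.add_self_eq_zero]
    · obtain ⟨h6, h7⟩ := h4 h5
      change f (A.cross d 0) = f (A.cross d 3) at h6
      change f (A.cross d 1) = f (A.cross d 2) at h7
      rw [h6, h7]
      have e1 := CharTwo.add_self_eq_zero (f (A.cross d 3))
      have e2 := CharTwo.add_self_eq_zero (f (A.cross d 2))
      linear_combination e1 + e2

theorem isEven_branchSet (s : Bool) (n : ℕ) : (branchSet s n).IsEven :=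
  ((((((isEven_twist _ _).rot.add (((isEven_twist _ _).add (isEven_twist _ _).rot).rot)).rot).add
    (isEven_twist _ _)).add (isEven_twist _ _).rot)).numerator

/-- The numerator closure of `Z + Y`. -/
abbrev closure (Z Y : TangleDiagram) : PlanarDiagram := (Z.add Y).numerator

section Closure

variable {Z Y Y' : TangleDiagram} {σ : (closure Z Y).Cr → Bool}

theorem closure_joined_inl {p q : Z.Pt} :
    (closure Z Y).Joined σ (Sum.inl p) (Sum.inl q) ↔ Z.Joined (fun c => σ (Sum.inl c)) p q := by
  constructor
  · rintro ((h | ⟨-, h⟩ | ⟨-, h⟩) | ⟨c | c, h⟩)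
    · exact Or.inl h
    · exact absurd h (by simp [add])
    · exact absurd h (by simp [add])
    · refine Or.inr ⟨c, ?_⟩
      simpa [closure, numerator, add] using h
    · simp [closure, numerator, add] at h
  · rintro (h | ⟨c, h⟩)
    · exact Or.inl (Or.inl h)
    · refine Or.inr ⟨Sum.inl c, ?_⟩
      simpa [closure, numerator, add] using h

theorem closure_joined_inr {p q : Y.Pt} :
    (closure Z Y).Joined σ (Sum.inr p) (Sum.inr q) ↔ Y.Joined (fun c => σ (Sum.inr c)) p q := by
  constructor
  · rintro ((h | ⟨h, -⟩ | ⟨h, -⟩) | ⟨c | c, h⟩)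
    · exact Or.inl h
    · exact absurd h (by simp [add])
    · exact absurd h (by simp [add])
    · simp [closure, numerator, add] at h
    · refine Or.inr ⟨c, ?_⟩
      simpa [closure, numerator, add] using h
  · rintro (h | ⟨c, h⟩)
    · exact Or.inl (Or.inl h)
    · refine Or.inr ⟨Sum.inr c, ?_⟩
      simpa [closure, numerator, add] using h

theorem closure_joined_inl_inr {p : Z.Pt} {q : Y.Pt} :
    (closure Z Y).Joined σ (Sum.inl p) (Sum.inr q) ↔
      ((p = Z.ne ∧ q = Y.nw) ∨ (p = Z.se ∧ q = Y.sw)) ∨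
      ((p = Z.nw ∧ q = Y.ne) ∨ (p = Z.sw ∧ q = Y.se)) := by
  constructor
  · rintro ((h | ⟨h, h'⟩ | ⟨h, h'⟩) | ⟨c | c, h⟩)
    · exact Or.inl h
    · exact Or.inr (Or.inl ⟨Sum.inl_injective h, Sum.inr_injective h'⟩)
    · exact Or.inr (Or.inr ⟨Sum.inl_injective h, Sum.inr_injective h'⟩)
    · simp [closure, numerator, add] at h
    · simp [closure, numerator, add] at h
  · rintro (h | ⟨rfl, rfl⟩ | ⟨rfl, rfl⟩)
    · exact Or.inl (Or.inl h)
    · exact Or.inl (Or.inr (Or.inl ⟨rfl, rfl⟩))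
    · exact Or.inl (Or.inr (Or.inr ⟨rfl, rfl⟩))

theorem closure_joined_inr_inl {p : Y.Pt} {q : Z.Pt} :
    ¬ (closure Z Y).Joined σ (Sum.inr p) (Sum.inl q) := by
  rintro ((h | ⟨h, h'⟩ | ⟨h, h'⟩) | ⟨c | c, h⟩)
  · exact h
  · exact absurd h (by simp [add])
  · exact absurd h (by simp [add])
  · simp [closure, numerator, add] at h
  · simp [closure, numerator, add] at h

theorem closure_sameCircle_inr {p q : Y.Pt} (h : Y.SameCircle (fun c => σ (Sum.inr c)) p q) :
    (closure Z Y).SameCircle σ (Sum.inr p) (Sum.inr q) := by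
  induction h with
  | rel x y h => exact Joined.sameCircle (closure_joined_inr.2 h)
  | refl x => exact SameCircle.refl _ _
  | symm x y _ ih => exact ih.symm
  | trans x y z _ _ ih1 ih2 => exact ih1.trans ih2

/-- The four joints of `closure Z Y`. -/
theorem closure_joint (Z Y : TangleDiagram) (σ : (closure Z Y).Cr → Bool) :
    ((closure Z Y).SameCircle σ (Sum.inl Z.ne) (Sum.inr Y.nw) ∧
      (closure Z Y).SameCircle σ (Sum.inl Z.se) (Sum.inr Y.sw)) ∧
    ((closure Z Y).SameCircle σ (Sum.inl Z.nw) (Sum.inr Y.ne) ∧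
      (closure Z Y).SameCircle σ (Sum.inl Z.sw) (Sum.inr Y.se)) :=
  ⟨⟨Joined.sameCircle (closure_joined_inl_inr.2 (by simp)),
    Joined.sameCircle (closure_joined_inl_inr.2 (by simp))⟩,
    Joined.sameCircle (closure_joined_inl_inr.2 (by simp)),
    Joined.sameCircle (closure_joined_inl_inr.2 (by simp))⟩

/-- A reduction of tangle diagrams respecting the four ends. -/
structure Reduction (A B : TangleDiagram) extends
    PlanarDiagram.Reduction A.toPlanarDiagram B.toPlanarDiagram where
  nw_notMem : A.nw ∉ K
  ne_notMem : A.ne ∉ K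
  sw_notMem : A.sw ∉ K
  se_notMem : A.se ∉ K
  f_nw : ∀ σ, B.SameCircle σ (f A.nw) B.nw
  f_ne : ∀ σ, B.SameCircle σ (f A.ne) B.ne
  f_sw : ∀ σ, B.SameCircle σ (f A.sw) B.sw
  f_se : ∀ σ, B.SameCircle σ (f A.se) B.se

theorem Reduction.fits_inr (R : Y.Reduction Y') {σ : (closure Z Y).Cr → Bool}
    {τ : (closure Z Y).Cr → Bool} (hτ : ∀ c, τ (Sum.inr c) = R.τ c)
    (hσ : ∀ c, c ∉ Set.range (Sum.map id R.e : Z.Cr ⊕ Y'.Cr → Z.Cr ⊕ Y.Cr) → σ c = τ c) :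
    R.Fits (fun c => σ (Sum.inr c)) := by
  intro c hc
  refine (hσ (Sum.inr c) ?_).trans (hτ c)
  rintro ⟨d | d, hd⟩
  · cases hd
  · exact hc ⟨d, Sum.inr_injective hd⟩

/-- A reduction of `Y` induces a reduction of the closure of `Z + Y`. -/
def Reduction.close (R : Y.Reduction Y') (Z : TangleDiagram) :
    (closure Z Y).Reduction (closure Z Y') where
  e := Sum.map id R.e
  τ := Sum.elim (fun _ => false) R.τ
  K := {p | Sum.elim (fun _ => False) (fun q => q ∈ R.K) p}
  f := Sum.map id R.f
  g := Sum.map id R.g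
  inj := Injective.sumMap injective_id R.inj
  joined_mem := by
    intro σ hσ p q h
    have hfit := R.fits_inr (fun _ => rfl) hσ
    rcases p with p | p <;> rcases q with q | q
    · exact Iff.rfl
    · rcases closure_joined_inl_inr.1 h with (⟨-, rfl⟩ | ⟨-, rfl⟩) | (⟨-, rfl⟩ | ⟨-, rfl⟩)
      exacts [iff_of_false id R.nw_notMem, iff_of_false id R.sw_notMem,
        iff_of_false id R.ne_notMem, iff_of_false id R.se_notMem]
    · exact absurd h closure_joined_inr_inl
    · exact R.joined_mem _ hfit p q (closure_joined_inr.1 h)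
  map := by
    intro σ hσ p q hp h
    have hfit := R.fits_inr (fun _ => rfl) hσ
    rcases p with p | p <;> rcases q with q | q
    · have h' := closure_joined_inl.1 h
      exact Joined.sameCircle (closure_joined_inl.2 h')
    · have hj := closure_joint Z Y' (σ ∘ Sum.map id R.e)
      rcases closure_joined_inl_inr.1 h with (⟨rfl, rfl⟩ | ⟨rfl, rfl⟩) | (⟨rfl, rfl⟩ | ⟨rfl, rfl⟩)
      · exact hj.1.1.trans (closure_sameCircle_inr (R.f_nw _).symm)
      · exact hj.1.2.trans (closure_sameCircle_inr (R.f_sw _).symm)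
      · exact hj.2.1.trans (closure_sameCircle_inr (R.f_ne _).symm)
      · exact hj.2.2.trans (closure_sameCircle_inr (R.f_se _).symm)
    · exact absurd h closure_joined_inr_inl
    · exact closure_sameCircle_inr (R.map _ hfit p q hp (closure_joined_inr.1 h))
  comap := by
    intro σ hσ p q h
    have hfit := R.fits_inr (fun _ => rfl) hσ
    have aux : ∀ (x : Y.Pt) (y : Y'.Pt), x ∉ R.K → (∀ σ, Y'.SameCircle σ (R.f x) y) →
        (closure Z Y).SameCircle σ (Sum.inr x) (Sum.inr (R.g y)) := fun x y hx hxy =>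
      closure_sameCircle_inr ((R.gf _ hfit x hx).trans
        (Reduction.sameCircle_comap hfit (hxy _)))
    rcases p with p | p <;> rcases q with q | q
    · have h' := closure_joined_inl.1 h
      exact Joined.sameCircle (closure_joined_inl.2 h')
    · have hj := closure_joint Z Y σ
      rcases closure_joined_inl_inr.1 h with (⟨rfl, rfl⟩ | ⟨rfl, rfl⟩) | (⟨rfl, rfl⟩ | ⟨rfl, rfl⟩)
      · exact hj.1.1.trans (aux _ _ R.nw_notMem R.f_nw)
      · exact hj.1.2.trans (aux _ _ R.sw_notMem R.f_sw)
      · exact hj.2.1.trans (aux _ _ R.ne_notMem R.f_ne)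
      · exact hj.2.2.trans (aux _ _ R.se_notMem R.f_se)
    · exact absurd h closure_joined_inr_inl
    · exact closure_sameCircle_inr (R.comap _ hfit p q (closure_joined_inr.1 h))
  notMem := by
    rintro (p | p)
    · exact id
    · exact R.notMem p
  gf := by
    rintro σ hσ (p | p) hp
    · exact SameCircle.refl _ _
    · exact closure_sameCircle_inr (R.gf _ (R.fits_inr (fun _ => rfl) hσ) p hp)
  fg := by
    rintro σ (p | p)
    · exact SameCircle.refl _ _
    · exact closure_sameCircle_inr (R.fg _ p)
  cross_notMem := by
    rintro (c | c) i
    · exact id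
    · exact R.cross_notMem c i
  cross := by
    rintro (c | c) i σ
    · exact SameCircle.refl _ _
    · exact closure_sameCircle_inr (R.cross c i _)

end Closure

end TangleDiagram

/-! ### Relabelling, rotation and regrouping of closures; local moves inside a closure. -/

namespace PlanarDiagram

open Relation Function
open scoped Classical

/-- Diagrams which differ by a relabelling. -/
def Reduction.ofEquiv {D D' : PlanarDiagram} (e : D'.Cr ≃ D.Cr) (f : D.Pt ≃ D'.Pt)
    (hcross : ∀ c i, f (D.cross (e c) i) = D'.cross c i)
    (hwire : ∀ p q, D.wire p q ↔ D'.wire (f p) (f q)) : D.Reduction D' :=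
  have hj : ∀ σ p q, D.Joined σ p q ↔ D'.Joined (σ ∘ e) (f p) (f q) := by
    intro σ p q
    unfold Joined
    rw [hwire, ← e.exists_congr_right]
    simp only [← hcross, f.injective.eq_iff, comp_apply]
  { e := e
    τ := fun _ => false
    K := ∅
    f := f
    g := f.symm
    inj := e.injective
    joined_mem := fun _ _ _ _ _ => Iff.rfl
    map := fun σ _ p q _ h => Joined.sameCircle ((hj σ p q).1 h)
    comap := fun σ _ p q h => Joined.sameCircle ((hj σ _ _).2 (by simpa using h))
    notMem := fun _ => id
    gf := fun σ _ p _ => by rw [f.symm_apply_apply]; exact SameCircle.refl _ _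
    fg := fun σ p => by rw [f.apply_symm_apply]; exact SameCircle.refl _ _
    cross_notMem := fun _ _ => id
    cross := fun c i σ => by rw [hcross]; exact SameCircle.refl _ _ }

theorem khRank_congr {D D' : PlanarDiagram} (e : D'.Cr ≃ D.Cr) (f : D.Pt ≃ D'.Pt)
    (hcross : ∀ c i, f (D.cross (e c) i) = D'.cross c i)
    (hwire : ∀ p q, D.wire p q ↔ D'.wire (f p) (f q)) (base : D.Pt) :
    D.khRank base = D'.khRank (f base) :=
  (Reduction.ofEquiv e f hcross hwire).khRank_eq e.surjective rfl fun _ => SameCircle.refl _ _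

end PlanarDiagram

namespace TangleDiagram

open Relation Function PlanarDiagram
open scoped Classical

section

variable {Z Y : TangleDiagram}

theorem closure_wire_inl {p q : Z.Pt} :
    (closure Z Y).wire (Sum.inl p) (Sum.inl q) ↔ Z.wire p q := by
  constructor
  · rintro (h | ⟨-, h⟩ | ⟨-, h⟩)
    · exact h
    · exact absurd h (by simp [add])
    · exact absurd h (by simp [add])
  · exact Or.inl

theorem closure_wire_inr {p q : Y.Pt} :
    (closure Z Y).wire (Sum.inr p) (Sum.inr q) ↔ Y.wire p q := by
  constructor
  · rintro (h | ⟨h, -⟩ | ⟨h, -⟩)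
    · exact h
    · exact absurd h (by simp [add])
    · exact absurd h (by simp [add])
  · exact Or.inl

theorem closure_wire_inl_inr {p : Z.Pt} {q : Y.Pt} :
    (closure Z Y).wire (Sum.inl p) (Sum.inr q) ↔
      ((p = Z.ne ∧ q = Y.nw) ∨ (p = Z.se ∧ q = Y.sw)) ∨
      ((p = Z.nw ∧ q = Y.ne) ∨ (p = Z.sw ∧ q = Y.se)) := by
  constructor
  · rintro (h | ⟨h, h'⟩ | ⟨h, h'⟩)
    · exact Or.inl h
    · exact Or.inr (Or.inl ⟨Sum.inl_injective h, Sum.inr_injective h'⟩)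
    · exact Or.inr (Or.inr ⟨Sum.inl_injective h, Sum.inr_injective h'⟩)
  · rintro (h | ⟨rfl, rfl⟩ | ⟨rfl, rfl⟩)
    · exact Or.inl h
    · exact Or.inr (Or.inl ⟨rfl, rfl⟩)
    · exact Or.inr (Or.inr ⟨rfl, rfl⟩)

theorem closure_wire_inr_inl {p : Y.Pt} {q : Z.Pt} :
    ¬ (closure Z Y).wire (Sum.inr p) (Sum.inl q) := by
  rintro (h | ⟨h, -⟩ | ⟨h, -⟩)
  · exact h
  · exact absurd h (by simp [add])
  · exact absurd h (by simp [add])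

end

/-- Turning either tangle relative to the other produces the same four joints. This is how a column
of twists becomes a row. -/
theorem khRank_closure_rot (X Y : TangleDiagram) (b : X.Pt) :
    (closure X Y.rot).khRank (Sum.inl b) = (closure X.rot Y).khRank (Sum.inl b) := by
  refine khRank_congr (D := closure X Y.rot) (D' := closure X.rot Y) (Equiv.refl _) (Equiv.refl _)
    (fun _ _ => rfl) ?_ (Sum.inl b)
  rintro (p | p) (q | q)
  · exact closure_wire_inl.trans (closure_wire_inl (Z := X.rot) (Y := Y) (p := p) (q := q)).symm
  · refine closure_wire_inl_inr.trans (Iff.trans ?_ closure_wire_inl_inr.symm)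
    simp only [rot]
    tauto
  · exact iff_of_false closure_wire_inr_inl closure_wire_inr_inl
  · exact closure_wire_inr.trans (closure_wire_inr (Z := X.rot) (Y := Y) (p := p) (q := q)).symm

/-- Local moves are performed in the second tangle of a closure; regrouping brings the relevant
crossings there and keeps the base point in the first. -/
theorem khRank_closure_assoc (Z W V : TangleDiagram) (b : Z.Pt) :
    (closure (Z.add W) V).khRank (Sum.inl (Sum.inl b)) =
      (closure Z (W.add V)).khRank (Sum.inl b) := by
  refine khRank_congr (D := closure (Z.add W) V) (D' := closure Z (W.add V))
    (Equiv.sumAssoc _ _ _).symm (Equiv.sumAssoc _ _ _) ?_ ?_ (Sum.inl (Sum.inl b))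
  · rintro (c | c | c) i <;> rfl
  · rintro ((p | p) | p) ((q | q) | q)
    · exact closure_wire_inl.trans
        (closure_wire_inl (Z := Z) (Y := W.add V) (p := p) (q := q)).symm
    · refine closure_wire_inl.trans (Iff.trans ?_ closure_wire_inl_inr.symm)
      simp [add]
    · refine closure_wire_inl_inr.trans (Iff.trans ?_ closure_wire_inl_inr.symm)
      simp [add]
    · exact iff_of_false (fun h => closure_wire_inl.1 h) closure_wire_inr_inl
    · exact closure_wire_inl.trans
        (closure_wire_inr (Z := Z) (Y := W.add V) (p := Sum.inl p) (q := Sum.inl q)).symm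
    · refine closure_wire_inl_inr.trans (Iff.trans ?_ closure_wire_inr.symm)
      simp [add]
    · exact iff_of_false closure_wire_inr_inl closure_wire_inr_inl
    · exact iff_of_false closure_wire_inr_inl fun h => closure_wire_inr.1 h
    · exact closure_wire_inr.trans
        (closure_wire_inr (Z := Z) (Y := W.add V) (p := Sum.inr p) (q := Sum.inr q)).symm

/-- The exact triangle inside the second tangle: reductions that respect its four ends extend by the
identity on `Z`. -/
theorem khRank_closure_le_add {Y Y₀ Y₁ : TangleDiagram} (c : Y.Cr) (R₀ : Y.Reduction Y₀)
    (R₁ : Y.Reduction Y₁) (he₀ : ∀ d, d ∉ Set.range R₀.e ↔ d = c)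
    (he₁ : ∀ d, d ∉ Set.range R₁.e ↔ d = c) (hτ₀ : R₀.τ c = false) (hτ₁ : R₁.τ c = true)
    (hK₀ : R₀.K = ∅) (hK₁ : R₁.K = ∅) (Z : TangleDiagram) (b : Z.Pt) :
    (closure Z Y).khRank (Sum.inl b) ≤
      (closure Z Y₀).khRank (Sum.inl b) + (closure Z Y₁).khRank (Sum.inl b) := by
  have aux : ∀ {Y' : TangleDiagram} (R : Y.Reduction Y'), (∀ d, d ∉ Set.range R.e ↔ d = c) →
      ∀ d, d ∉ Set.range (R.close Z).e ↔ d = Sum.inr c := by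
    rintro Y' R h (d | d)
    · exact iff_of_false (fun h' => h' ⟨Sum.inl d, rfl⟩) (by rintro ⟨⟩)
    · constructor
      · intro h'
        rw [(h d).1 fun ⟨x, hx⟩ => h' ⟨Sum.inr x, congrArg Sum.inr hx⟩]
      · rintro h1 ⟨x | x, hx⟩
        · cases hx
        · exact (h d).2 (Sum.inr_injective h1) ⟨x, Sum.inr_injective hx⟩
  have auxK : ∀ {Y' : TangleDiagram} (R : Y.Reduction Y'), R.K = ∅ → (R.close Z).K = ∅ := by
    intro Y' R h
    ext (p | p)
    · exact Iff.rfl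
    · exact (congrArg (p ∈ ·) h).to_iff
  exact khRank_le_add (Sum.inr c) (R₀.close Z) (R₁.close Z) (aux R₀ he₀) (aux R₁ he₁) hτ₀ hτ₁
    (auxK R₀ hK₀) (auxK R₁ hK₁) (fun _ => SameCircle.refl _ _) (fun _ => SameCircle.refl _ _)

theorem khRank_closure_eq {Y Y' : TangleDiagram} (R : Y.Reduction Y') (hs : Surjective R.e)
    (hK : R.K = ∅) (Z : TangleDiagram) (b : Z.Pt) :
    (closure Z Y).khRank (Sum.inl b) = (closure Z Y').khRank (Sum.inl b) := by
  refine (R.close Z).khRank_eq (surjective_id.sumMap hs) ?_ fun _ => SameCircle.refl _ _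
  ext (p | p)
  · exact Iff.rfl
  · exact (congrArg (p ∈ ·) hK).to_iff

theorem khRank_closure_le_of_kink {Y Y' : TangleDiagram} (R : Y.Reduction Y') (c : Y.Cr)
    (u v : Y.Pt) (s : Bool) (he : ∀ d, d ∉ Set.range R.e ↔ d = c) (hτ : R.τ c = s)
    (huv : Y.IsUnder c u v) (hu : u ∈ R.K) (hv : v ∉ R.K)
    (hconn : ∀ σ, ∀ p ∈ R.K, Y.SameCircle σ p u)
    (hmerge : ∀ σ, σ c = !s → Y.SameCircle σ u v) (Z : TangleDiagram) (b : Z.Pt) :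
    (closure Z Y).khRank (Sum.inl b) ≤ (closure Z Y').khRank (Sum.inl b) := by
  refine khRank_le_of_kink (R.close Z) (Sum.inr c) (Sum.inr u) (Sum.inr v) s ?_ hτ ?_ hu hv ?_
    (fun σ h => closure_sameCircle_inr (hmerge _ h)) id (fun _ => SameCircle.refl _ _)
  · rintro (d | d)
    · exact iff_of_false (fun h' => h' ⟨Sum.inl d, rfl⟩) (by rintro ⟨⟩)
    · constructor
      · intro h'
        rw [(he d).1 fun ⟨x, hx⟩ => h' ⟨Sum.inr x, congrArg Sum.inr hx⟩]
      · rintro h1 ⟨x | x, hx⟩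
        · cases hx
        · exact (he d).2 (Sum.inr_injective h1) ⟨x, Sum.inr_injective hx⟩
  · exact huv.imp (fun h => ⟨congrArg Sum.inr h.1, congrArg Sum.inr h.2⟩)
      fun h => ⟨congrArg Sum.inr h.1, congrArg Sum.inr h.2⟩
  · rintro σ (p | p) hp
    · exact absurd hp id
    · exact closure_sameCircle_inr (hconn _ p hp)

/-- As `hends` keeps the four ends off `K`, the loop of the bigon is not affected by the gluing. -/
theorem khRank_closure_le_of_bigon {Y Y' : TangleDiagram} (R : Y.Reduction Y') (c d : Y.Cr)
    (u v u' v' : Y.Pt) (K : Set Y.Pt) (hcd : c ≠ d)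
    (he : ∀ x, x ∉ Set.range R.e ↔ x = c ∨ x = d) (hτc : R.τ c = true) (hτd : R.τ d = false)
    (hRK : R.K = ∅) (huv : Y.IsUnder c u v) (huv' : Y.IsUnder d u' v')
    (hu : u ∈ K) (hv : v ∉ K) (hu' : u' ∈ K) (hv' : v' ∉ K)
    (hjoin : ∀ σ, σ c = false → σ d = true → ∀ p q, Y.Joined σ p q → (p ∈ K ↔ q ∈ K))
    (hends : Y.nw ∉ K ∧ Y.ne ∉ K ∧ Y.sw ∉ K ∧ Y.se ∉ K)
    (hconn : ∀ σ, (σ c = false ∨ σ d = true) → ∀ p ∈ K, Y.SameCircle σ p u)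
    (hmerge : ∀ σ, σ c = true → σ d = true → Y.SameCircle σ u v)
    (hmerge' : ∀ σ, σ c = false → σ d = false → Y.SameCircle σ u' v')
    (hcross : ∀ x, x ≠ c → x ≠ d → Y.cross x 0 ∉ K ∧ Y.cross x 2 ∉ K)
    (Z : TangleDiagram) (b : Z.Pt) :
    (closure Z Y).khRank (Sum.inl b) ≤ (closure Z Y').khRank (Sum.inl b) := by
  refine khRank_le_of_bigon (R.close Z) (Sum.inr c) (Sum.inr d) (Sum.inr u) (Sum.inr v)
    (Sum.inr u') (Sum.inr v') {p | Sum.elim (fun _ => False) (fun q => q ∈ K) p}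
    (fun h => hcd (Sum.inr_injective h)) ?_ hτc hτd ?_ ?_ ?_ hu hv hu' hv' ?_ ?_
    (fun σ h h' => closure_sameCircle_inr (hmerge _ h h'))
    (fun σ h h' => closure_sameCircle_inr (hmerge' _ h h')) ?_ id (fun _ => SameCircle.refl _ _)
  · rintro (x | x)
    · exact iff_of_false (fun h' => h' ⟨Sum.inl x, rfl⟩) (by rintro (⟨⟨⟩⟩ | ⟨⟨⟩⟩))
    · constructor
      · intro h'
        exact ((he x).1 fun ⟨y, hy⟩ => h' ⟨Sum.inr y, congrArg Sum.inr hy⟩).imp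
          (congrArg Sum.inr) (congrArg Sum.inr)
      · rintro h1 ⟨y | y, hy⟩
        · cases hy
        · exact (he x).2 (h1.imp (fun h => Sum.inr_injective h) (fun h => Sum.inr_injective h))
            ⟨y, Sum.inr_injective hy⟩
  · ext (p | p)
    · exact Iff.rfl
    · exact (congrArg (p ∈ ·) hRK).to_iff
  · exact huv.imp (fun h => ⟨congrArg Sum.inr h.1, congrArg Sum.inr h.2⟩)
      fun h => ⟨congrArg Sum.inr h.1, congrArg Sum.inr h.2⟩
  · exact huv'.imp (fun h => ⟨congrArg Sum.inr h.1, congrArg Sum.inr h.2⟩)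
      fun h => ⟨congrArg Sum.inr h.1, congrArg Sum.inr h.2⟩
  · rintro σ h1 h2 (p | p) (q | q) h
    · exact Iff.rfl
    · rcases closure_joined_inl_inr.1 h with (⟨-, rfl⟩ | ⟨-, rfl⟩) | (⟨-, rfl⟩ | ⟨-, rfl⟩)
      exacts [iff_of_false id hends.1, iff_of_false id hends.2.2.1,
        iff_of_false id hends.2.1, iff_of_false id hends.2.2.2]
    · exact absurd h closure_joined_inr_inl
    · exact hjoin _ h1 h2 p q (closure_joined_inr.1 h)
  · rintro σ h (p | p) hp
    · exact absurd hp id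
    · exact closure_sameCircle_inr (hconn _ h p hp)
  · rintro (x | x) h1 h2
    · exact ⟨id, id⟩
    · exact hcross x (fun h => h1 (congrArg Sum.inr h)) (fun h => h2 (congrArg Sum.inr h))

end TangleDiagram

/-! ### The two smoothings of a crossing, and closing with the tangle `0`. -/

namespace TangleDiagram

open Relation Function PlanarDiagram
open scoped Classical

/-- For both signs the smoothing `!s` is horizontal and the smoothing `s` is vertical, which permits
a uniform treatment. The listed orientations of the segments allow for the different order of
corners in the two crossings. -/
theorem crossing_joined {s : Bool} {σ : (crossing s).Cr → Bool} {p q : Fin 4}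
    (h : (crossing s).Joined σ p q) :
    (σ () = !s ∧ ((p = 1 ∧ q = 0) ∨ (p = 2 ∧ q = 3) ∨ (p = 3 ∧ q = 2))) ∨
    (σ () = s ∧ ((p = 2 ∧ q = 0) ∨ (p = 0 ∧ q = 2) ∨ (p = 3 ∧ q = 1))) := by
  rcases h with h | ⟨c, h⟩
  · exact absurd h id
  · cases s <;> simp only [crossing] at h <;>
      rcases h with ⟨h1, ⟨rfl, rfl⟩ | ⟨rfl, rfl⟩⟩ | ⟨h1, ⟨rfl, rfl⟩ | ⟨rfl, rfl⟩⟩ <;>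
      simp [show σ () = _ from h1]

theorem crossing_horizontal {s : Bool} {σ : (crossing s).Cr → Bool} (h : σ () = !s) :
    (crossing s).SameCircle σ (0 : Fin 4) (1 : Fin 4) ∧
      (crossing s).SameCircle σ (2 : Fin 4) (3 : Fin 4) := by
  cases s
  · exact ⟨(Joined.sameCircle (Or.inr ⟨(), Or.inr ⟨h, Or.inr ⟨rfl, rfl⟩⟩⟩)).symm,
      (Joined.sameCircle (Or.inr ⟨(), Or.inr ⟨h, Or.inl ⟨rfl, rfl⟩⟩⟩)).symm⟩
  · exact ⟨(Joined.sameCircle (Or.inr ⟨(), Or.inl ⟨h, Or.inr ⟨rfl, rfl⟩⟩⟩)).symm,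
      (Joined.sameCircle (Or.inr ⟨(), Or.inl ⟨h, Or.inl ⟨rfl, rfl⟩⟩⟩))⟩

theorem crossing_vertical {s : Bool} {σ : (crossing s).Cr → Bool} (h : σ () = s) :
    (crossing s).SameCircle σ (0 : Fin 4) (2 : Fin 4) ∧
      (crossing s).SameCircle σ (1 : Fin 4) (3 : Fin 4) := by
  cases s
  · exact ⟨Joined.sameCircle (Or.inr ⟨(), Or.inl ⟨h, Or.inr ⟨rfl, rfl⟩⟩⟩),
      (Joined.sameCircle (Or.inr ⟨(), Or.inl ⟨h, Or.inl ⟨rfl, rfl⟩⟩⟩)).symm⟩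
  · exact ⟨(Joined.sameCircle (Or.inr ⟨(), Or.inr ⟨h, Or.inl ⟨rfl, rfl⟩⟩⟩)).symm,
      (Joined.sameCircle (Or.inr ⟨(), Or.inr ⟨h, Or.inr ⟨rfl, rfl⟩⟩⟩)).symm⟩

theorem zero_joined {σ : zero.Cr → Bool} {p q : Fin 4} :
    zero.Joined σ p q ↔ (p = 0 ∧ q = 1) ∨ (p = 2 ∧ q = 3) :=
  ⟨fun h => h.elim id fun ⟨c, _⟩ => c.elim, Or.inl⟩

theorem zero_sameCircle (σ : zero.Cr → Bool) :
    zero.SameCircle σ (0 : Fin 4) (1 : Fin 4) ∧ zero.SameCircle σ (2 : Fin 4) (3 : Fin 4) :=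
  ⟨Joined.sameCircle (zero_joined.2 (by simp)), Joined.sameCircle (zero_joined.2 (by simp))⟩

/-- The horizontal smoothing of a crossing. -/
def horizontalSmoothing (s : Bool) : (crossing s).Reduction zero where
  e := Empty.elim
  τ := fun _ => !s
  K := ∅
  f := id
  g := id
  inj := fun c => c.elim
  joined_mem := fun _ _ _ _ _ => Iff.rfl
  map := by
    intro σ hσ p q _ h
    have h0 : σ () = !s := hσ () (by rintro ⟨⟨⟩, _⟩)
    have hz := zero_sameCircle (σ ∘ Empty.elim)
    rcases crossing_joined h with ⟨-, ⟨rfl, rfl⟩ | ⟨rfl, rfl⟩ | ⟨rfl, rfl⟩⟩ | ⟨h1, -⟩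
    · exact hz.1.symm
    · exact hz.2
    · exact hz.2.symm
    · rw [h0] at h1
      cases s <;> cases h1
  comap := by
    intro σ hσ p q h
    have h0 : σ () = !s := hσ () (by rintro ⟨⟨⟩, _⟩)
    rcases zero_joined.1 h with ⟨rfl, rfl⟩ | ⟨rfl, rfl⟩
    · exact (crossing_horizontal h0).1
    · exact (crossing_horizontal h0).2
  notMem := fun _ => id
  gf := fun _ _ _ _ => SameCircle.refl _ _
  fg := fun _ _ => SameCircle.refl _ _
  cross_notMem := fun c => c.elim
  cross := fun c => c.elim
  nw_notMem := id
  ne_notMem := id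
  sw_notMem := id
  se_notMem := id
  f_nw := fun _ => SameCircle.refl _ _
  f_ne := fun _ => SameCircle.refl _ _
  f_sw := fun _ => SameCircle.refl _ _
  f_se := fun _ => SameCircle.refl _ _

/-- The vertical smoothing of a crossing. -/
def verticalSmoothing (s : Bool) : (crossing s).Reduction zero.rot where
  e := Empty.elim
  τ := fun _ => s
  K := ∅
  -- In `zero.rot` the corners north-west, north-east, south-west, south-east are the points 1, 3,
  -- 0, 2.
  f := (![1, 3, 0, 2] : Fin 4 → Fin 4)
  g := (![2, 0, 3, 1] : Fin 4 → Fin 4)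
  inj := fun c => c.elim
  joined_mem := fun _ _ _ _ _ => Iff.rfl
  map := by
    intro σ hσ p q _ h
    have h0 : σ () = s := hσ () (by rintro ⟨⟨⟩, _⟩)
    have hz := zero_sameCircle (σ ∘ Empty.elim)
    rcases crossing_joined h with ⟨h1, -⟩ | ⟨-, ⟨rfl, rfl⟩ | ⟨rfl, rfl⟩ | ⟨rfl, rfl⟩⟩
    · rw [h0] at h1
      cases s <;> cases h1
    · exact hz.1
    · exact hz.1.symm
    · exact hz.2
  comap := by
    intro σ hσ p q h
    have h0 : σ () = s := hσ () (by rintro ⟨⟨⟩, _⟩)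
    rcases zero_joined.1 h with ⟨rfl, rfl⟩ | ⟨rfl, rfl⟩
    · exact (crossing_vertical h0).1.symm
    · exact (crossing_vertical h0).2.symm
  notMem := fun _ => id
  gf := by
    rintro σ hσ (p : Fin 4) hp
    fin_cases p <;> exact SameCircle.refl _ _
  fg := by
    rintro σ (p : Fin 4)
    fin_cases p <;> exact SameCircle.refl _ _
  cross_notMem := fun c => c.elim
  cross := fun c => c.elim
  nw_notMem := id
  ne_notMem := id
  sw_notMem := id
  se_notMem := id
  f_nw := fun _ => SameCircle.refl _ _
  f_ne := fun _ => SameCircle.refl _ _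
  f_sw := fun _ => SameCircle.refl _ _
  f_se := fun _ => SameCircle.refl _ _

/-- The exact triangle at a single crossing. -/
theorem khRank_closure_crossing_le (s : Bool) (Z : TangleDiagram) (b : Z.Pt) :
    (closure Z (crossing s)).khRank (Sum.inl b) ≤
      (closure Z zero).khRank (Sum.inl b) + (closure Z zero.rot).khRank (Sum.inl b) := by
  have he : ∀ d : Unit, d ∉ Set.range (Empty.elim : Empty → Unit) ↔ d = () := fun d =>
    iff_of_true (by rintro ⟨⟨⟩, _⟩) rfl
  cases s
  -- For the crossing `-1` the 0-smoothing is the vertical one, so the two terms appear in the other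
  -- order.
  · rw [add_comm]
    exact khRank_closure_le_add (Y := crossing false) PUnit.unit (verticalSmoothing false) (horizontalSmoothing false)
      he he rfl rfl rfl rfl Z b
  · exact khRank_closure_le_add (Y := crossing true) PUnit.unit (horizontalSmoothing true) (verticalSmoothing true)
      he he rfl rfl rfl rfl Z b

/-- The tangle `0` turned by half a turn. -/
def halfTurnZero : zero.rot.rot.Reduction zero where
  e := id
  τ := fun _ => false
  K := ∅
  f := (![3, 2, 1, 0] : Fin 4 → Fin 4)
  g := (![3, 2, 1, 0] : Fin 4 → Fin 4)
  inj := injective_id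
  joined_mem := fun _ _ _ _ _ => Iff.rfl
  map := by
    intro σ _ p q _ h
    have hz := zero_sameCircle (σ ∘ id)
    rcases zero_joined.1 h with ⟨rfl, rfl⟩ | ⟨rfl, rfl⟩
    · exact hz.2.symm
    · exact hz.1.symm
  comap := by
    intro σ _ p q h
    have hz := zero_sameCircle σ
    rcases zero_joined.1 h with ⟨rfl, rfl⟩ | ⟨rfl, rfl⟩
    · exact hz.2.symm
    · exact hz.1.symm
  notMem := fun _ => id
  gf := by
    rintro σ hσ (p : Fin 4) hp
    fin_cases p <;> exact SameCircle.refl _ _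
  fg := by
    rintro σ (p : Fin 4)
    fin_cases p <;> exact SameCircle.refl _ _
  cross_notMem := fun c => c.elim
  cross := fun c => c.elim
  nw_notMem := id
  ne_notMem := id
  sw_notMem := id
  se_notMem := id
  f_nw := fun _ => SameCircle.refl _ _
  f_ne := fun _ => SameCircle.refl _ _
  f_sw := fun _ => SameCircle.refl _ _
  f_se := fun _ => SameCircle.refl _ _

/-- The closure of `W + 0` is the closure of `W`. -/
def closureZero (W : TangleDiagram) : (closure W zero).Reduction W.numerator where
  e := Sum.inl
  τ := fun _ => false
  K := ∅
  f := Sum.elim id ![W.ne, W.nw, W.se, W.sw]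
  g := Sum.inl
  inj := Sum.inl_injective
  joined_mem := fun _ _ _ _ _ => Iff.rfl
  map := by
    rintro σ - (p | p) (q | q) - h
    · rcases closure_joined_inl.1 h with h | h
      · exact Joined.sameCircle (Or.inl (Or.inl h))
      · exact Joined.sameCircle (Or.inr h)
    · rcases closure_joined_inl_inr.1 h with (⟨rfl, rfl⟩ | ⟨rfl, rfl⟩) | (⟨rfl, rfl⟩ | ⟨rfl, rfl⟩) <;>
        exact SameCircle.refl _ _
    · exact absurd h closure_joined_inr_inl
    · rcases zero_joined.1 (closure_joined_inr.1 h) with ⟨rfl, rfl⟩ | ⟨rfl, rfl⟩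
      · exact (Joined.sameCircle (Or.inl (Or.inr (Or.inl ⟨rfl, rfl⟩)))).symm
      · exact (Joined.sameCircle (Or.inl (Or.inr (Or.inr ⟨rfl, rfl⟩)))).symm
  comap := by
    rintro σ - p q ((h | ⟨rfl, rfl⟩ | ⟨rfl, rfl⟩) | h)
    · exact Joined.sameCircle (closure_joined_inl.2 (Or.inl h))
    · have hj := closure_joint W zero σ
      exact (hj.2.1.trans (closure_sameCircle_inr (zero_sameCircle _).1).symm).trans hj.1.1.symm
    · have hj := closure_joint W zero σ
      exact (hj.2.2.trans (closure_sameCircle_inr (zero_sameCircle _).2).symm).trans hj.1.2.symm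
    · exact Joined.sameCircle (closure_joined_inl.2 (Or.inr h))
  notMem := fun _ => id
  gf := by
    rintro σ - (p | (p : Fin 4)) -
    · exact SameCircle.refl _ _
    · have hj := closure_joint W zero σ
      fin_cases p
      exacts [hj.1.1.symm, hj.2.1.symm, hj.1.2.symm, hj.2.2.symm]
  fg := fun _ _ => SameCircle.refl _ _
  cross_notMem := fun _ _ => id
  cross := fun _ _ _ => SameCircle.refl _ _

theorem khRank_closure_zero (W : TangleDiagram) (b : W.Pt) :
    (closure W zero).khRank (Sum.inl b) = W.numerator.khRank b :=
  (closureZero W).khRank_eq (by rintro (c | c); exacts [⟨c, rfl⟩, c.elim]) rfl fun _ => SameCircle.refl _ _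

end TangleDiagram

/-! ### Circles in a sum of tangles. -/

namespace TangleDiagram

open Relation Function PlanarDiagram
open scoped Classical

section Add

variable {A B : TangleDiagram} {σ : (A.add B).Cr → Bool}

theorem add_joined_inl {p q : A.Pt} :
    (A.add B).Joined σ (Sum.inl p) (Sum.inl q) ↔ A.Joined (fun c => σ (Sum.inl c)) p q := by
  constructor
  · rintro (h | ⟨c | c, h⟩)
    · exact Or.inl h
    · exact Or.inr ⟨c, by simpa [add] using h⟩
    · simp [add] at h
  · rintro (h | ⟨c, h⟩)
    · exact Or.inl h
    · exact Or.inr ⟨Sum.inl c, by simpa [add] using h⟩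

theorem add_joined_inr {p q : B.Pt} :
    (A.add B).Joined σ (Sum.inr p) (Sum.inr q) ↔ B.Joined (fun c => σ (Sum.inr c)) p q := by
  constructor
  · rintro (h | ⟨c | c, h⟩)
    · exact Or.inl h
    · simp [add] at h
    · exact Or.inr ⟨c, by simpa [add] using h⟩
  · rintro (h | ⟨c, h⟩)
    · exact Or.inl h
    · exact Or.inr ⟨Sum.inr c, by simpa [add] using h⟩

theorem add_joined_inl_inr {p : A.Pt} {q : B.Pt} :
    (A.add B).Joined σ (Sum.inl p) (Sum.inr q) ↔
      (p = A.ne ∧ q = B.nw) ∨ (p = A.se ∧ q = B.sw) := by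
  constructor
  · rintro (h | ⟨c | c, h⟩)
    · exact h
    · simp [add] at h
    · simp [add] at h
  · exact Or.inl

theorem add_joined_inr_inl {p : B.Pt} {q : A.Pt} :
    ¬ (A.add B).Joined σ (Sum.inr p) (Sum.inl q) := by
  rintro (h | ⟨c | c, h⟩)
  · exact h
  · simp [add] at h
  · simp [add] at h

theorem add_sameCircle_inl {p q : A.Pt} (h : A.SameCircle (fun c => σ (Sum.inl c)) p q) :
    (A.add B).SameCircle σ (Sum.inl p) (Sum.inl q) := by
  induction h with
  | rel x y h => exact Joined.sameCircle (add_joined_inl.2 h)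
  | refl x => exact SameCircle.refl _ _
  | symm x y _ ih => exact ih.symm
  | trans x y z _ _ ih1 ih2 => exact ih1.trans ih2

theorem add_sameCircle_inr {p q : B.Pt} (h : B.SameCircle (fun c => σ (Sum.inr c)) p q) :
    (A.add B).SameCircle σ (Sum.inr p) (Sum.inr q) := by
  induction h with
  | rel x y h => exact Joined.sameCircle (add_joined_inr.2 h)
  | refl x => exact SameCircle.refl _ _
  | symm x y _ ih => exact ih.symm
  | trans x y z _ _ ih1 ih2 => exact ih1.trans ih2

theorem add_joint (A B : TangleDiagram) (σ : (A.add B).Cr → Bool) :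
    (A.add B).SameCircle σ (Sum.inl A.ne) (Sum.inr B.nw) ∧
      (A.add B).SameCircle σ (Sum.inl A.se) (Sum.inr B.sw) :=
  ⟨Joined.sameCircle (add_joined_inl_inr.2 (by simp)),
    Joined.sameCircle (add_joined_inl_inr.2 (by simp))⟩

end Add

/-- The tangle `0` is neutral for the sum. -/
def zeroAdd (Y : TangleDiagram) : (zero.add Y).Reduction Y where
  e := Sum.inr
  τ := fun _ => false
  K := ∅
  f := Sum.elim ![Y.nw, Y.nw, Y.sw, Y.sw] id
  g := Sum.inr
  inj := Sum.inr_injective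
  joined_mem := fun _ _ _ _ _ => Iff.rfl
  map := by
    rintro σ - (p | p) (q | q) - h
    · rcases zero_joined.1 (add_joined_inl.1 h) with ⟨rfl, rfl⟩ | ⟨rfl, rfl⟩ <;>
        exact SameCircle.refl _ _
    · rcases add_joined_inl_inr.1 h with ⟨rfl, rfl⟩ | ⟨rfl, rfl⟩ <;> exact SameCircle.refl _ _
    · exact absurd h add_joined_inr_inl
    · exact Joined.sameCircle (add_joined_inr.1 h)
  comap := fun σ _ p q h => Joined.sameCircle (add_joined_inr.2 h)
  notMem := fun _ => id
  gf := by
    rintro σ - ((p : Fin 4) | p) -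
    · have hj := add_joint zero Y σ
      have hz := zero_sameCircle fun c => σ (Sum.inl c)
      fin_cases p
      exacts [(add_sameCircle_inl hz.1).trans hj.1, hj.1, (add_sameCircle_inl hz.2).trans hj.2, hj.2]
    · exact SameCircle.refl _ _
  fg := fun _ _ => SameCircle.refl _ _
  cross_notMem := fun _ _ => id
  cross := fun _ _ _ => SameCircle.refl _ _
  nw_notMem := id
  ne_notMem := id
  sw_notMem := id
  se_notMem := id
  f_nw := fun _ => SameCircle.refl _ _
  f_ne := fun _ => SameCircle.refl _ _
  f_sw := fun _ => SameCircle.refl _ _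
  f_se := fun _ => SameCircle.refl _ _

theorem khRank_closure_zero_add (Y Z : TangleDiagram) (b : Z.Pt) :
    (closure Z (zero.add Y)).khRank (Sum.inl b) = (closure Z Y).khRank (Sum.inl b) :=
  khRank_closure_eq (zeroAdd Y) (by rintro (c | c); exacts [c.elim, ⟨c, rfl⟩]) rfl Z b

end TangleDiagram

/-! ### Rows of twists: removing kinks, the growth estimate, and cancelling a row against a column.
-/

namespace TangleDiagram

open Relation Function PlanarDiagram
open scoped Classical

/-- Removing the kink in the sum of a crossing and the tangle `∞`. -/
def kink (s : Bool) : ((crossing s).add zero.rot).Reduction zero.rot where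
  e := Empty.elim
  τ := fun _ => s
  -- The loop consists of the two eastern corners of the crossing and the western arc of `∞`, which
  -- joins the points 0 and 1.
  K := {p | Sum.elim (![False, True, False, True] : Fin 4 → Prop)
    (![True, True, False, False] : Fin 4 → Prop) p}
  f := Sum.elim (![1, 3, 0, 2] : Fin 4 → Fin 4) (id : Fin 4 → Fin 4)
  g := fun p => (![Sum.inl 2, Sum.inl 0, Sum.inr 2, Sum.inr 3] : Fin 4 → Fin 4 ⊕ Fin 4) p
  inj := fun c => c.elim
  joined_mem := by
    rintro σ hσ (p | p) (q | q) h
    · have h0 : σ (Sum.inl ()) = s := hσ (Sum.inl ()) (by rintro ⟨⟨⟩, _⟩)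
      rcases crossing_joined (add_joined_inl.1 h) with
        ⟨h1, -⟩ | ⟨-, ⟨rfl, rfl⟩ | ⟨rfl, rfl⟩ | ⟨rfl, rfl⟩⟩
      · rw [h0] at h1
        cases s <;> cases h1
      · exact iff_of_false id id
      · exact iff_of_false id id
      · exact iff_of_true trivial trivial
    · rcases add_joined_inl_inr.1 h with ⟨rfl, rfl⟩ | ⟨rfl, rfl⟩ <;> exact iff_of_true trivial trivial
    · exact absurd h add_joined_inr_inl
    · rcases zero_joined.1 (add_joined_inr.1 h) with ⟨rfl, rfl⟩ | ⟨rfl, rfl⟩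
      · exact iff_of_true trivial trivial
      · exact iff_of_false id id
  map := by
    rintro σ hσ (p | p) (q | q) hp h
    · have h0 : σ (Sum.inl ()) = s := hσ (Sum.inl ()) (by rintro ⟨⟨⟩, _⟩)
      have hz := zero_sameCircle (σ ∘ Empty.elim)
      rcases crossing_joined (add_joined_inl.1 h) with
        ⟨h1, -⟩ | ⟨-, ⟨rfl, rfl⟩ | ⟨rfl, rfl⟩ | ⟨rfl, rfl⟩⟩
      · rw [h0] at h1
        cases s <;> cases h1
      · exact hz.1
      · exact hz.1.symm
      · exact absurd trivial hp
    · rcases add_joined_inl_inr.1 h with ⟨rfl, rfl⟩ | ⟨rfl, rfl⟩ <;> exact absurd trivial hp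
    · exact absurd h add_joined_inr_inl
    · rcases zero_joined.1 (add_joined_inr.1 h) with ⟨rfl, rfl⟩ | ⟨rfl, rfl⟩
      · exact absurd trivial hp
      · exact (zero_sameCircle (σ ∘ Empty.elim)).2
  comap := by
    intro σ hσ p q h
    have h0 : σ (Sum.inl ()) = s := hσ (Sum.inl ()) (by rintro ⟨⟨⟩, _⟩)
    rcases zero_joined.1 h with ⟨rfl, rfl⟩ | ⟨rfl, rfl⟩
    · exact (add_sameCircle_inl (crossing_vertical h0).1).symm
    · exact add_sameCircle_inr (zero_sameCircle _).2
  notMem := by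
    rintro (p : Fin 4)
    fin_cases p <;> exact id
  gf := by
    rintro σ hσ ((p : Fin 4) | (p : Fin 4)) hp <;> fin_cases p
    all_goals first | exact SameCircle.refl _ _ | exact absurd trivial hp
  fg := by
    rintro σ (p : Fin 4)
    fin_cases p <;> exact SameCircle.refl _ _
  cross_notMem := fun c => c.elim
  cross := fun c => c.elim
  nw_notMem := id
  ne_notMem := id
  sw_notMem := id
  se_notMem := id
  f_nw := fun _ => SameCircle.refl _ _
  f_ne := fun _ => SameCircle.refl _ _
  f_sw := fun _ => SameCircle.refl _ _
  f_se := fun _ => SameCircle.refl _ _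

/-- The western arc of `∞` joins the eastern corners of the crossing, so the crossing is a kink,
whose loop is split off in the vertical smoothing `s`. -/
theorem khRank_closure_kink_le (s : Bool) (Z : TangleDiagram) (b : Z.Pt) :
    (closure Z ((crossing s).add zero.rot)).khRank (Sum.inl b) ≤
      (closure Z zero.rot).khRank (Sum.inl b) := by
  have hr : ∀ σ : ((crossing s).add zero.rot).Cr → Bool,
      ((crossing s).add zero.rot).SameCircle σ (Sum.inl (1 : Fin 4)) (Sum.inl (3 : Fin 4)) := by
    intro σ
    have hj := add_joint (crossing s) zero.rot σ
    exact (hj.1.trans (add_sameCircle_inr (zero_sameCircle _).1.symm)).trans hj.2.symm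
  have hconn : ∀ σ, ∀ p ∈ (kink s).K,
      ((crossing s).add zero.rot).SameCircle σ p (Sum.inl (1 : Fin 4)) := by
    rintro σ ((p : Fin 4) | (p : Fin 4)) hp
    · fin_cases p
      exacts [absurd hp id, SameCircle.refl _ _, absurd hp id, (hr σ).symm]
    · have hj := add_joint (crossing s) zero.rot σ
      fin_cases p
      exacts [hj.2.symm.trans (hr σ).symm, hj.1.symm, absurd hp id, absurd hp id]
  have he : ∀ d, d ∉ Set.range (kink s).e ↔ d = Sum.inl PUnit.unit := by
    rintro (d | d)
    · exact iff_of_true (by rintro ⟨⟨⟩, _⟩) rfl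
    · exact d.elim
  -- The sign decides which end of the under-strand lies on the loop: corner 0 of the crossing `-1`,
  -- corner 2 of the crossing `+1`.
  cases s
  · refine khRank_closure_le_of_kink (kink false) (Sum.inl PUnit.unit) (Sum.inl (3 : Fin 4))
      (Sum.inl (0 : Fin 4)) false he rfl (Or.inl ⟨rfl, rfl⟩) trivial id
      (fun σ p hp => (hconn σ p hp).trans (hr σ)) (fun σ h => ?_) Z b
    exact (hr σ).symm.trans (add_sameCircle_inl (crossing_horizontal h).1.symm)
  · refine khRank_closure_le_of_kink (kink true) (Sum.inl PUnit.unit) (Sum.inl (1 : Fin 4))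
      (Sum.inl (2 : Fin 4)) true he rfl (Or.inr ⟨rfl, rfl⟩) trivial id hconn (fun σ h => ?_) Z b
    exact (hr σ).trans (add_sameCircle_inl (crossing_horizontal h).2.symm)

/-- Associativity of the sum of tangles. -/
def addAssoc (W V U : TangleDiagram) : ((W.add V).add U).Reduction (W.add (V.add U)) where
  toReduction := Reduction.ofEquiv (D := ((W.add V).add U).toPlanarDiagram)
    (D' := (W.add (V.add U)).toPlanarDiagram) (Equiv.sumAssoc _ _ _).symm (Equiv.sumAssoc _ _ _)
    (by rintro (c | c | c) i <;> rfl)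
    (by
      rintro ((p | p) | p) ((q | q) | q)
      · exact Iff.rfl
      · change (p = W.ne ∧ q = V.nw) ∨ (p = W.se ∧ q = V.sw) ↔
          (p = W.ne ∧ (Sum.inl q : V.Pt ⊕ U.Pt) = Sum.inl V.nw) ∨
          (p = W.se ∧ (Sum.inl q : V.Pt ⊕ U.Pt) = Sum.inl V.sw)
        simp only [Sum.inl.injEq]
      · change ((Sum.inl p : W.Pt ⊕ V.Pt) = Sum.inr V.ne ∧ q = U.nw) ∨
          ((Sum.inl p : W.Pt ⊕ V.Pt) = Sum.inr V.se ∧ q = U.sw) ↔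
          (p = W.ne ∧ (Sum.inr q : V.Pt ⊕ U.Pt) = Sum.inl V.nw) ∨
          (p = W.se ∧ (Sum.inr q : V.Pt ⊕ U.Pt) = Sum.inl V.sw)
        simp
      · exact Iff.rfl
      · exact Iff.rfl
      · change ((Sum.inr p : W.Pt ⊕ V.Pt) = Sum.inr V.ne ∧ q = U.nw) ∨
          ((Sum.inr p : W.Pt ⊕ V.Pt) = Sum.inr V.se ∧ q = U.sw) ↔
          (p = V.ne ∧ q = U.nw) ∨ (p = V.se ∧ q = U.sw)
        simp only [Sum.inr.injEq]
      · exact Iff.rfl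
      · exact Iff.rfl
      · exact Iff.rfl)
  nw_notMem := id
  ne_notMem := id
  sw_notMem := id
  se_notMem := id
  f_nw := fun _ => SameCircle.refl _ _
  f_ne := fun _ => SameCircle.refl _ _
  f_sw := fun _ => SameCircle.refl _ _
  f_se := fun _ => SameCircle.refl _ _

theorem khRank_closure_addAssoc (W V U Z : TangleDiagram) (b : Z.Pt) :
    (closure Z ((W.add V).add U)).khRank (Sum.inl b) =
      (closure Z (W.add (V.add U))).khRank (Sum.inl b) :=
  khRank_closure_eq (addAssoc W V U) (Equiv.surjective _) rfl Z b

/-- Twists can be removed next to the tangle `∞`. -/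
theorem khRank_closure_twist_add_le (s : Bool) (n : ℕ) (Z : TangleDiagram) (b : Z.Pt) :
    (closure Z ((twist s n).add zero.rot)).khRank (Sum.inl b) ≤
      (closure Z zero.rot).khRank (Sum.inl b) := by
  induction n with
  | zero => exact (khRank_closure_zero_add zero.rot Z b).le
  | succ n ih =>
    calc (closure Z ((twist s (n + 1)).add zero.rot)).khRank (Sum.inl b)
        = (closure Z ((twist s n).add ((crossing s).add zero.rot))).khRank (Sum.inl b) :=
          khRank_closure_addAssoc _ _ _ _ _
      -- The first `n` twists are absorbed into the outer tangle, so that only the crossing next to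
      -- `∞` is involved.
      _ = (closure (Z.add (twist s n)) ((crossing s).add zero.rot)).khRank
          (Sum.inl (Sum.inl b)) := (khRank_closure_assoc Z _ _ b).symm
      _ ≤ (closure (Z.add (twist s n)) zero.rot).khRank (Sum.inl (Sum.inl b)) :=
        khRank_closure_kink_le s (Z.add (twist s n)) (Sum.inl b)
      _ = (closure Z ((twist s n).add zero.rot)).khRank (Sum.inl b) :=
        khRank_closure_assoc _ _ _ _
      _ ≤ _ := ih

/-- The exact triangle for a row of twists. -/
theorem khRank_closure_twist_succ_le (s : Bool) (n : ℕ) (Z : TangleDiagram) (b : Z.Pt) :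
    (closure Z (twist s (n + 1))).khRank (Sum.inl b) ≤
      (closure Z (twist s n)).khRank (Sum.inl b) + (closure Z zero.rot).khRank (Sum.inl b) := by
  calc (closure Z (twist s (n + 1))).khRank (Sum.inl b)
      = (closure (Z.add (twist s n)) (crossing s)).khRank (Sum.inl (Sum.inl b)) :=
        (khRank_closure_assoc Z _ _ b).symm
    _ ≤ (closure (Z.add (twist s n)) zero).khRank (Sum.inl (Sum.inl b)) +
        (closure (Z.add (twist s n)) zero.rot).khRank (Sum.inl (Sum.inl b)) :=
      khRank_closure_crossing_le s (Z.add (twist s n)) (Sum.inl b)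
    _ ≤ _ := add_le_add (khRank_closure_zero (Z.add (twist s n)) (Sum.inl b)).le
      ((khRank_closure_assoc Z _ _ b).trans_le (khRank_closure_twist_add_le s n Z b))

/-- The main growth estimate. The cost of a further twist does not depend on the length of the row,
because the remaining twists become kinks next to `∞`. -/
theorem khRank_closure_twist_le (s : Bool) (m n : ℕ) (Z : TangleDiagram) (b : Z.Pt) :
    (closure Z (twist s (m + n))).khRank (Sum.inl b) ≤
      (closure Z (twist s m)).khRank (Sum.inl b) +
        n * (closure Z zero.rot).khRank (Sum.inl b) := by
  induction n with
  | zero => simp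
  | succ n ih =>
    have := khRank_closure_twist_succ_le s (m + n) Z b
    push_cast
    rw [← add_assoc]
    linarith

/-- A column of a single twist, as it arises from `twist`. -/
abbrev column : TangleDiagram := (zero.add (crossing false)).rot

section

variable (σ : ((crossing false).add column).Cr → Bool)

/-- The segments of a row and a column which are present in every smoothing. -/
theorem row_column_sameCircle :
    (((crossing false).add column).SameCircle σ (Sum.inl (1 : Fin 4))
        (Sum.inr (Sum.inr (1 : Fin 4))) ∧
      ((crossing false).add column).SameCircle σ (Sum.inl (3 : Fin 4))
        (Sum.inr (Sum.inr (0 : Fin 4)))) ∧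
    (((crossing false).add column).SameCircle σ (Sum.inr (Sum.inl (2 : Fin 4)))
        (Sum.inr (Sum.inl (3 : Fin 4))) ∧
      ((crossing false).add column).SameCircle σ (Sum.inr (Sum.inl (3 : Fin 4)))
        (Sum.inr (Sum.inr (2 : Fin 4)))) ∧
    (((crossing false).add column).SameCircle σ (Sum.inl (3 : Fin 4))
        (Sum.inr (Sum.inl (0 : Fin 4))) ∧
      ((crossing false).add column).SameCircle σ (Sum.inl (3 : Fin 4))
        (Sum.inr (Sum.inl (1 : Fin 4)))) := by
  have hj := add_joint (crossing false) column σ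
  have hz := zero_sameCircle fun c => σ (Sum.inr (Sum.inl c))
  have hi := add_joint zero (crossing false) fun c => σ (Sum.inr c)
  have h01 := add_sameCircle_inr (A := crossing false) (B := column) (σ := σ)
    (add_sameCircle_inl (B := crossing false) hz.1)
  exact ⟨⟨hj.1, (hj.2.trans h01).trans (add_sameCircle_inr hi.1)⟩,
    ⟨add_sameCircle_inr (add_sameCircle_inl (B := crossing false) hz.2),
      add_sameCircle_inr hi.2⟩, hj.2, hj.2.trans h01⟩

variable {σ}

theorem row_horizontal (h : σ (Sum.inl ()) = true) :
    ((crossing false).add column).SameCircle σ (Sum.inl (0 : Fin 4)) (Sum.inl (1 : Fin 4)) ∧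
      ((crossing false).add column).SameCircle σ (Sum.inl (2 : Fin 4)) (Sum.inl (3 : Fin 4)) :=
  ⟨add_sameCircle_inl (crossing_horizontal h).1, add_sameCircle_inl (crossing_horizontal h).2⟩

theorem row_vertical (h : σ (Sum.inl ()) = false) :
    ((crossing false).add column).SameCircle σ (Sum.inl (0 : Fin 4)) (Sum.inl (2 : Fin 4)) ∧
      ((crossing false).add column).SameCircle σ (Sum.inl (1 : Fin 4)) (Sum.inl (3 : Fin 4)) :=
  ⟨add_sameCircle_inl (crossing_vertical h).1, add_sameCircle_inl (crossing_vertical h).2⟩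

theorem column_horizontal (h : σ (Sum.inr (Sum.inr ())) = true) :
    ((crossing false).add column).SameCircle σ (Sum.inr (Sum.inr (0 : Fin 4)))
        (Sum.inr (Sum.inr (1 : Fin 4))) ∧
      ((crossing false).add column).SameCircle σ (Sum.inr (Sum.inr (2 : Fin 4)))
        (Sum.inr (Sum.inr (3 : Fin 4))) :=
  ⟨add_sameCircle_inr (add_sameCircle_inr (A := zero) (crossing_horizontal h).1),
    add_sameCircle_inr (add_sameCircle_inr (A := zero) (crossing_horizontal h).2)⟩

theorem column_vertical (h : σ (Sum.inr (Sum.inr ())) = false) :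
    ((crossing false).add column).SameCircle σ (Sum.inr (Sum.inr (0 : Fin 4)))
        (Sum.inr (Sum.inr (2 : Fin 4))) ∧
      ((crossing false).add column).SameCircle σ (Sum.inr (Sum.inr (1 : Fin 4)))
        (Sum.inr (Sum.inr (3 : Fin 4))) :=
  ⟨add_sameCircle_inr (add_sameCircle_inr (A := zero) (crossing_vertical h).1),
    add_sameCircle_inr (add_sameCircle_inr (A := zero) (crossing_vertical h).2)⟩

end

/-- The second Reidemeister move between a row and a column. -/
def bigon : ((crossing false).add column).Reduction zero where
  e := Empty.elim
  -- The crossing of the row is smoothed horizontally. The crossing of the column is smoothed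
  -- vertically in its own frame, hence horizontally after the quarter turn, and the two together
  -- give the tangle `0`.
  τ := Sum.elim (fun _ => true) (fun _ => false)
  K := ∅
  f := Sum.elim (![0, 0, 2, 2] : Fin 4 → Fin 4)
    (Sum.elim (![2, 2, 3, 3] : Fin 4 → Fin 4) (![2, 0, 2, 1] : Fin 4 → Fin 4))
  g := fun p => (![Sum.inl 0, Sum.inr (Sum.inr 3), Sum.inl 2, Sum.inr (Sum.inl 2)] :
    Fin 4 → Fin 4 ⊕ Fin 4 ⊕ Fin 4) p
  inj := fun c => c.elim
  joined_mem := fun _ _ _ _ _ => Iff.rfl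
  map := by
    intro σ hσ
    have h1 : σ (Sum.inl ()) = true := hσ (Sum.inl ()) (by rintro ⟨⟨⟩, _⟩)
    have h2 : σ (Sum.inr (Sum.inr ())) = false := hσ (Sum.inr (Sum.inr ())) (by rintro ⟨⟨⟩, _⟩)
    have hz := zero_sameCircle (σ ∘ Empty.elim)
    rintro (p | p) (q | q) - h
    · rcases crossing_joined (add_joined_inl.1 h) with
        ⟨-, ⟨rfl, rfl⟩ | ⟨rfl, rfl⟩ | ⟨rfl, rfl⟩⟩ | ⟨h3, -⟩
      · exact SameCircle.refl _ _
      · exact SameCircle.refl _ _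
      · exact SameCircle.refl _ _
      · exact absurd (h1.symm.trans h3) (by simp)
    · rcases add_joined_inl_inr.1 h with ⟨rfl, rfl⟩ | ⟨rfl, rfl⟩ <;> exact SameCircle.refl _ _
    · exact absurd h add_joined_inr_inl
    · replace h := add_joined_inr.1 h
      rcases p with p | p <;> rcases q with q | q
      · rcases zero_joined.1 (add_joined_inl.1 h) with ⟨rfl, rfl⟩ | ⟨rfl, rfl⟩ <;>
          exact SameCircle.refl _ _
      · rcases add_joined_inl_inr.1 h with ⟨rfl, rfl⟩ | ⟨rfl, rfl⟩
        exacts [SameCircle.refl _ _, hz.2.symm]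
      · exact absurd h add_joined_inr_inl
      · rcases crossing_joined (add_joined_inr.1 h) with
          ⟨h3, -⟩ | ⟨-, ⟨rfl, rfl⟩ | ⟨rfl, rfl⟩ | ⟨rfl, rfl⟩⟩
        · exact absurd (h2.symm.trans h3) (by simp)
        · exact SameCircle.refl _ _
        · exact SameCircle.refl _ _
        · exact hz.1.symm
  comap := by
    intro σ hσ p q h
    have h1 : σ (Sum.inl ()) = true := hσ (Sum.inl ()) (by rintro ⟨⟨⟩, _⟩)
    have h2 : σ (Sum.inr (Sum.inr ())) = false := hσ (Sum.inr (Sum.inr ())) (by rintro ⟨⟨⟩, _⟩)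
    have a := row_column_sameCircle σ
    have r := row_horizontal h1
    have v := column_vertical h2
    rcases zero_joined.1 h with ⟨rfl, rfl⟩ | ⟨rfl, rfl⟩
    · exact (r.1.trans a.1.1).trans v.2
    · exact (r.2.trans a.1.2).trans (v.1.trans (a.2.1.1.trans a.2.1.2).symm)
  notMem := fun _ => id
  gf := by
    intro σ hσ
    have h1 : σ (Sum.inl ()) = true := hσ (Sum.inl ()) (by rintro ⟨⟨⟩, _⟩)
    have h2 : σ (Sum.inr (Sum.inr ())) = false := hσ (Sum.inr (Sum.inr ())) (by rintro ⟨⟨⟩, _⟩)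
    have a := row_column_sameCircle σ
    have r := row_horizontal h1
    have v := column_vertical h2
    rintro ((p : Fin 4) | (p : Fin 4) | (p : Fin 4)) -
    · fin_cases p
      exacts [SameCircle.refl _ _, r.1.symm, SameCircle.refl _ _, r.2.symm]
    · fin_cases p
      exacts [(r.2.trans a.2.2.1).symm, (r.2.trans a.2.2.2).symm, SameCircle.refl _ _, a.2.1.1.symm]
    · fin_cases p
      exacts [(r.2.trans a.1.2).symm, (r.1.trans a.1.1).symm,
        ((r.2.trans a.1.2).trans v.1).symm, SameCircle.refl _ _]
  fg := by
    rintro σ (p : Fin 4)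
    fin_cases p <;> exact SameCircle.refl _ _
  cross_notMem := fun c => c.elim
  cross := fun c => c.elim
  nw_notMem := id
  ne_notMem := id
  sw_notMem := id
  se_notMem := id
  f_nw := fun _ => SameCircle.refl _ _
  f_ne := fun _ => SameCircle.refl _ _
  f_sw := fun _ => SameCircle.refl _ _
  f_se := fun _ => SameCircle.refl _ _

/-- A quarter turn changes the sign of a half twist, so the row and the column, built from the same
crossing, form a bigon that the second Reidemeister move removes. -/
theorem khRank_closure_bigon_le (Z : TangleDiagram) (b : Z.Pt) :
    (closure Z ((crossing false).add column)).khRank (Sum.inl b) ≤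
      (closure Z zero).khRank (Sum.inl b) := by
  refine khRank_closure_le_of_bigon bigon (Sum.inl PUnit.unit) (Sum.inr (Sum.inr PUnit.unit))
    (Sum.inl (3 : Fin 4)) (Sum.inl (0 : Fin 4)) (Sum.inr (Sum.inr (0 : Fin 4)))
    (Sum.inr (Sum.inr (3 : Fin 4)))
    -- The loop runs through the eastern corners of the row, the two western corners of the turned
    -- crossing, and one arc of the auxiliary tangle `0` inside `column`.
    {p | Sum.elim (![False, True, False, True] : Fin 4 → Prop)
      (Sum.elim (![True, True, False, False] : Fin 4 → Prop)
        (![True, True, False, False] : Fin 4 → Prop)) p}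
    (by rintro ⟨⟩) ?_ rfl rfl rfl (Or.inl ⟨rfl, rfl⟩) (Or.inr ⟨rfl, rfl⟩) trivial id trivial id
    ?_ ⟨id, id, id, id⟩ ?_ ?_ ?_ ?_ Z b
  · rintro (x | x | x)
    · exact iff_of_true (by rintro ⟨⟨⟩, _⟩) (Or.inl rfl)
    · exact x.elim
    · exact iff_of_true (by rintro ⟨⟨⟩, _⟩) (Or.inr rfl)
  · rintro σ h1 h2 (p | p) (q | q) h
    · rcases crossing_joined (add_joined_inl.1 h) with
        ⟨h3, -⟩ | ⟨-, ⟨rfl, rfl⟩ | ⟨rfl, rfl⟩ | ⟨rfl, rfl⟩⟩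
      · exact absurd (h1.symm.trans h3) (by simp)
      exacts [iff_of_false id id, iff_of_false id id, iff_of_true trivial trivial]
    · rcases add_joined_inl_inr.1 h with ⟨rfl, rfl⟩ | ⟨rfl, rfl⟩ <;> exact iff_of_true trivial trivial
    · exact absurd h add_joined_inr_inl
    · replace h := add_joined_inr.1 h
      rcases p with p | p <;> rcases q with q | q
      · rcases zero_joined.1 (add_joined_inl.1 h) with ⟨rfl, rfl⟩ | ⟨rfl, rfl⟩
        exacts [iff_of_true trivial trivial, iff_of_false id id]
      · rcases add_joined_inl_inr.1 h with ⟨rfl, rfl⟩ | ⟨rfl, rfl⟩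
        exacts [iff_of_true trivial trivial, iff_of_false id id]
      · exact absurd h add_joined_inr_inl
      · rcases crossing_joined (add_joined_inr.1 h) with
          ⟨-, ⟨rfl, rfl⟩ | ⟨rfl, rfl⟩ | ⟨rfl, rfl⟩⟩ | ⟨h3, -⟩
        · exact iff_of_true trivial trivial
        · exact iff_of_false id id
        · exact iff_of_false id id
        · exact absurd (h2.symm.trans h3) (by simp)
  · intro σ h
    have a := row_column_sameCircle σ
    have key : ((crossing false).add column).SameCircle σ (Sum.inl (1 : Fin 4))
        (Sum.inl (3 : Fin 4)) := by
      rcases h with h | h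
      · exact (row_vertical h).2
      · exact (a.1.1.trans (column_horizontal h).1.symm).trans a.1.2.symm
    rintro ((p : Fin 4) | (p : Fin 4) | (p : Fin 4)) hp <;> fin_cases p
    exacts [absurd hp id, key, absurd hp id, SameCircle.refl _ _, a.2.2.1.symm, a.2.2.2.symm,
      absurd hp id, absurd hp id, a.1.2.symm, a.1.1.symm.trans key, absurd hp id, absurd hp id]
  · intro σ h1 h2
    have a := row_column_sameCircle σ
    exact (a.1.2.trans ((column_horizontal h2).1.trans a.1.1.symm)).trans (row_horizontal h1).1.symm
  · intro σ h1 h2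
    have a := row_column_sameCircle σ
    exact a.1.2.symm.trans ((row_vertical h1).2.symm.trans (a.1.1.trans (column_vertical h2).2))
  · rintro (x | x | x) h1 h2
    · exact absurd rfl h1
    · exact x.elim
    · exact absurd rfl h2

end TangleDiagram

/-! ### Assembly of the bounds from the two computed values. -/

namespace TangleDiagram

open Relation Function PlanarDiagram
open scoped Classical

/-- The unframed Montesinos tangle `-1/2 + 2/5`, turned by a quarter turn. -/
def montesinos : TangleDiagram := (minusHalf.add twoFifths).rot

/-- The growth estimate with cost 1 per twist, started at three half twists. It is applied to rows
of nine and ten twists, with bounds 15 and 16. -/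
theorem khRank_montesinos_twist_le
    (h3 : (closure montesinos (twist false 3)).khRank (Sum.inl montesinos.nw) ≤ 9)
    (hU : (closure montesinos zero.rot).khRank (Sum.inl montesinos.nw) ≤ 1)
    (n : ℕ) :
    (closure montesinos (twist false (3 + n))).khRank (Sum.inl montesinos.nw) ≤ 9 + n := by
  have := khRank_closure_twist_le false 3 n montesinos montesinos.nw
  nlinarith

/-- The closure of the cinqfoil tangle along the tangle `0`. -/
theorem khRank_cinqfoil_rot_zero_rot_eq :
    (closure cinqfoil.rot zero.rot).khRank (Sum.inl (Sum.inl montesinos.nw)) =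
      (closure montesinos (twist false 10)).khRank (Sum.inl montesinos.nw) :=
  calc (closure cinqfoil.rot zero.rot).khRank (Sum.inl (Sum.inl montesinos.nw))
      = (closure cinqfoil zero.rot.rot).khRank (Sum.inl (Sum.inl montesinos.nw)) :=
        (khRank_closure_rot cinqfoil zero.rot (Sum.inl montesinos.nw)).symm
    _ = (closure cinqfoil zero).khRank (Sum.inl (Sum.inl montesinos.nw)) :=
      khRank_closure_eq halfTurnZero surjective_id rfl cinqfoil (Sum.inl montesinos.nw)
    _ = cinqfoil.numerator.khRank (Sum.inl montesinos.nw) :=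
      khRank_closure_zero cinqfoil (Sum.inl montesinos.nw)

/-- The empty column closes the cinqfoil tangle by `∞`, next to which the ten framing twists are
kinks. This is the trivial surgery. -/
theorem khRank_cinqfoil_rot_zero_le :
    (closure cinqfoil.rot zero).khRank (Sum.inl (Sum.inl montesinos.nw)) ≤
      (closure montesinos zero.rot).khRank (Sum.inl montesinos.nw) :=
  calc (closure cinqfoil.rot zero).khRank (Sum.inl (Sum.inl montesinos.nw))
      = (closure cinqfoil zero.rot).khRank (Sum.inl (Sum.inl montesinos.nw)) :=
        (khRank_closure_rot cinqfoil zero (Sum.inl montesinos.nw)).symm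
    _ = (closure montesinos ((twist false 10).add zero.rot)).khRank (Sum.inl montesinos.nw) :=
      khRank_closure_assoc montesinos _ _ _
    _ ≤ _ := khRank_closure_twist_add_le false 10 montesinos montesinos.nw

/-- The single half twist of the column cancels the last of the ten framing twists. This saves two
compared with starting at the empty column: 15 at `n = 1` instead of 17. -/
theorem khRank_cinqfoil_rot_twist_one_le :
    (closure cinqfoil.rot (twist false 1)).khRank (Sum.inl (Sum.inl montesinos.nw)) ≤
      (closure montesinos (twist false 9)).khRank (Sum.inl montesinos.nw) :=
  calc (closure cinqfoil.rot (twist false 1)).khRank (Sum.inl (Sum.inl montesinos.nw))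
      = (closure cinqfoil column).khRank (Sum.inl (Sum.inl montesinos.nw)) :=
        (khRank_closure_rot cinqfoil (twist false 1) (Sum.inl montesinos.nw)).symm
    _ = (closure montesinos ((twist false 10).add column)).khRank (Sum.inl montesinos.nw) :=
      khRank_closure_assoc montesinos _ _ _
    _ = (closure montesinos ((twist false 9).add ((crossing false).add column))).khRank
        (Sum.inl montesinos.nw) := khRank_closure_addAssoc _ _ _ _ _
    _ = (closure (montesinos.add (twist false 9)) ((crossing false).add column)).khRank
        (Sum.inl (Sum.inl montesinos.nw)) := (khRank_closure_assoc montesinos _ _ _).symm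
    _ ≤ (closure (montesinos.add (twist false 9)) zero).khRank (Sum.inl (Sum.inl montesinos.nw)) :=
      khRank_closure_bigon_le (montesinos.add (twist false 9)) (Sum.inl montesinos.nw)
    _ = _ := khRank_closure_zero (montesinos.add (twist false 9)) (Sum.inl montesinos.nw)

/-- The passage from homology to `khRank` by evenness, followed by turning the column `1/n` or
`-1/n` into a row; the sign flips because `reciprocal` is a rotated row of opposite sign. -/
theorem rkKh_branchSet (s : Bool) (n : ℕ) :
    ((branchSet s n).rkKh (branchSetBase s n) : ℤ) =
      (closure cinqfoil.rot (twist (!s) n)).khRank (Sum.inl (Sum.inl montesinos.nw)) :=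
  ((isEven_branchSet s n).rkKh_eq _).trans
    (khRank_closure_rot cinqfoil (twist (!s) n) (Sum.inl montesinos.nw))

/-- The induction starts at one half twist with 15, and each of the other `n - 1` costs at most 16.
-/
theorem rkKh_branchSet_true_le
    (h3 : (closure montesinos (twist false 3)).khRank (Sum.inl montesinos.nw) ≤ 9)
    (hU : (closure montesinos zero.rot).khRank (Sum.inl montesinos.nw) ≤ 1)
    (n : ℕ) (hn : 0 < n) :
    ((branchSet true n).rkKh (branchSetBase true n) : ℤ) ≤ 16 * n - 1 := by
  obtain ⟨m, rfl⟩ : ∃ m, n = 1 + m := ⟨n - 1, by omega⟩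
  rw [rkKh_branchSet]
  have h9 := khRank_montesinos_twist_le h3 hU 6
  have h10 := khRank_montesinos_twist_le h3 hU 7
  have := khRank_closure_twist_le false 1 m cinqfoil.rot (Sum.inl montesinos.nw)
  rw [khRank_cinqfoil_rot_zero_rot_eq] at this
  have h1 := khRank_cinqfoil_rot_twist_one_le
  have hm : (0 : ℤ) ≤ m := Int.natCast_nonneg m
  push_cast
  calc _ ≤ _ := this
    _ ≤ 15 + m * 16 := add_le_add (h1.trans (h9.trans (by norm_num)))
      (mul_le_mul_of_nonneg_left (h10.trans (by norm_num)) hm)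
    _ ≤ _ := by linarith

theorem rkKh_branchSet_false_le
    (h3 : (closure montesinos (twist false 3)).khRank (Sum.inl montesinos.nw) ≤ 9)
    (hU : (closure montesinos zero.rot).khRank (Sum.inl montesinos.nw) ≤ 1)
    (n : ℕ) :
    ((branchSet false n).rkKh (branchSetBase false n) : ℤ) ≤ 16 * n + 1 := by
  rw [rkKh_branchSet]
  have h10 := khRank_montesinos_twist_le h3 hU 7
  have := khRank_closure_twist_le true 0 n cinqfoil.rot (Sum.inl montesinos.nw)
  rw [khRank_cinqfoil_rot_zero_rot_eq, zero_add] at this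
  have h1 := khRank_cinqfoil_rot_zero_le
  have hm : (0 : ℤ) ≤ n := Int.natCast_nonneg n
  calc _ ≤ _ := this
    _ ≤ 1 + n * 16 := add_le_add (h1.trans hU)
      (mul_le_mul_of_nonneg_left (h10.trans (by norm_num)) hm)
    _ ≤ _ := by linarith

end TangleDiagram

/-! ### A program for the rank of the differential

Tangles are coded by numbering their marked points. A set of marked points is coded by the number
whose binary digits are its indicator function. The functions in continuation passing style are
evaluated to normal form by the kernel before they are passed on. -/

/-- The numbers of the four points adjacent to a crossing. -/
abbrev CrossingCode := ℕ × ℕ × ℕ × ℕ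

/-- Tangles with numbered marked points. -/
structure TangleCode where
  size : ℕ
  crossings : List CrossingCode
  wires : List (ℕ × ℕ)
  nw : ℕ
  ne : ℕ
  sw : ℕ
  se : ℕ

namespace TangleCode

def zero : TangleCode := ⟨4, [], [(0, 1), (2, 3)], 0, 1, 2, 3⟩

def crossing (s : Bool) : TangleCode :=
  ⟨4, [bif s then (2, 3, 1, 0) else (3, 1, 0, 2)], [], 0, 1, 2, 3⟩

def add (A B : TangleCode) : TangleCode where
  size := A.size + B.size
  crossings := A.crossings ++ B.crossings.map fun c =>
    (A.size + c.1, A.size + c.2.1, A.size + c.2.2.1, A.size + c.2.2.2)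
  wires := (A.ne, A.size + B.nw) :: (A.se, A.size + B.sw) ::
    (A.wires ++ B.wires.map fun w => (A.size + w.1, A.size + w.2))
  nw := A.nw
  ne := A.size + B.ne
  sw := A.sw
  se := A.size + B.se

def rot (A : TangleCode) : TangleCode :=
  { A with nw := A.ne, ne := A.se, sw := A.nw, se := A.sw }

def twist (s : Bool) : ℕ → TangleCode
  | 0 => zero
  | n + 1 => (twist s n).add (crossing s)

def numerator (A : TangleCode) : TangleCode :=
  { A with wires := (A.nw, A.ne) :: (A.sw, A.se) :: A.wires }

def montesinos : TangleCode :=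
  ((twist true 2).rot.add ((twist false 2).add (twist true 2).rot).rot).rot

end TangleCode

namespace KhovanovProgram

/-- The recursion on `n` makes no step before `n` is evaluated, so the continuation receives a value
and not an unevaluated expression. -/
def force {α : Type} (n : ℕ) (k : ℕ → α) : α := Nat.rec (k 0) (fun m _ => k (Nat.succ m)) n

def forceList {α : Type} : List ℕ → (List ℕ → α) → α
  | [], k => k []
  | m :: L, k => force m fun m => forceList L fun L => k (m :: L)

/-- The binary digits of a number. -/
def bit (x i : ℕ) : Bool := Nat.beq (Nat.land (Nat.shiftRight x i) 1) 1

/-- The first class of `L` containing `i`. -/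
def classOf : List ℕ → ℕ → ℕ
  | [], _ => 0
  | m :: L, i => bif bit m i then m else classOf L i

def removeClass : List ℕ → ℕ → List ℕ
  | [], _ => []
  | m :: L, i => bif bit m i then removeClass L i else m :: removeClass L i

/-- Join the classes of `i` and `j`. -/
def addEdge (L : List ℕ) (i j : ℕ) : List ℕ :=
  Nat.lor (classOf L i) (classOf L j) :: removeClass (removeClass L i) j

def addEdges {α : Type} : List ℕ → List (ℕ × ℕ) → (List ℕ → α) → α
  | L, [], k => k L
  | L, w :: ws, k => forceList (addEdge L w.1 w.2) fun L => addEdges L ws k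

/-- The circles of all complete smoothings, each coded as a set of marked points. -/
inductive CubeTree
  | leaf (L : List ℕ)
  | node (l r : CubeTree)

def cubeTree {α : Type} : List CrossingCode → List ℕ → (CubeTree → α) → α
  | [], L, k => k (.leaf L)
  | c :: cs, L, k =>
    addEdges L [(c.1, c.2.1), (c.2.2.1, c.2.2.2)] fun L₀ =>
    addEdges L [(c.1, c.2.2.2), (c.2.1, c.2.2.1)] fun L₁ =>
    cubeTree cs L₀ fun t₀ => cubeTree cs L₁ fun t₁ => k (.node t₀ t₁)

def CubeTree.get : CubeTree → List Bool → List ℕ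
  | .leaf L, _ => L
  | .node _ _, [] => []
  | .node l r, b :: s => bif b then r.get s else l.get s

def vertexNumber : List Bool → ℕ
  | [] => 0
  | b :: s => bif b then Nat.add (Nat.mul 2 (vertexNumber s)) 1 else Nat.mul 2 (vertexNumber s)

def vertices : ℕ → List (List Bool)
  | 0 => [[]]
  | n + 1 => (vertices n).map (List.cons false) ++ (vertices n).map (List.cons true)

/-- The unions of `b` with some of the sets in `L`. -/
def labelings (b : ℕ) : List ℕ → List ℕ
  | [] => [b]
  | m :: L => labelings b L ++ (labelings b L).map (Nat.lor m)

/-- The reduced states at a vertex of the cube, each coded as the set of points labelled `X`. -/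
def statesAt (L : List ℕ) (base : ℕ) : List ℕ :=
  labelings (classOf L base) (removeClass L base)

/-- The effect of an edge of the cube on labels: two circles through `a` and `b` merge to the
circle `A`, or a circle through `a` splits into `A` and `B`. -/
inductive EdgeKind
  | none
  | merge (a b A : ℕ)
  | split (a A B : ℕ)

/-- As `x` is the set of points labelled `X`, a merged circle labelled `X` must be filled up to all
of `A`, while a split circle labelled `X` needs no change because its halves cover the same points.
-/
def EdgeKind.targets (x : ℕ) : EdgeKind → List ℕ
  | none => []
  | merge a b A => bif bit x a then (bif bit x b then [] else [Nat.lor x A])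
    else bif bit x b then [Nat.lor x A] else [x]
  | split a A B => bif bit x a then [x] else [Nat.lor x A, Nat.lor x B]

def EdgeKind.force {α : Type} : EdgeKind → (EdgeKind → α) → α
  | none, k => k none
  | merge a b A, k => KhovanovProgram.force A fun A => k (merge a b A)
  | split a A B, k => KhovanovProgram.force A fun A => KhovanovProgram.force B fun B =>
    k (split a A B)

/-- The value `none` covers the changes that neither merge nor split circles; they contribute
nothing to the differential. -/
def edgeKind (c : CrossingCode) (L L' : List ℕ) : EdgeKind :=
  bif bit (classOf L c.1) c.2.2.1 then
    bif bit (classOf L' c.1) c.2.2.1 then .none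
    else .split c.1 (classOf L' c.1) (classOf L' c.2.2.1)
  else bif bit (classOf L' c.1) c.2.2.1 then .merge c.1 c.2.2.1 (classOf L' c.1)
  else .none

/-- The edges of the cube which start at the vertex `s`, with the numbers of their ends. -/
def edgesAt {α : Type} (T : CubeTree) (L : List ℕ) :
    List Bool → List CrossingCode → List Bool → (List (ℕ × EdgeKind) → α) → α
  | pre, c :: cs, b :: s, k => bif b then edgesAt T L (pre ++ [true]) cs s k else
    force (vertexNumber (pre ++ true :: s)) fun n =>
    (edgeKind c L (T.get (pre ++ true :: s))).force fun e =>
    edgesAt T L (pre ++ [false]) cs s fun es => k ((n, e) :: es)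
  | _, _, _, k => k []

/-- The basis vector which represents the state `x` at the vertex with the number `n`. -/
def position (p q n x : ℕ) : ℕ := Nat.add (Nat.mul n 64) (Nat.mod (Nat.mod x p) q)

/-- Add a basis vector to a vector, over the field of two elements. Vectors are coded by the
decreasing list of the basis vectors which occur in them. -/
def toggle (k : ℕ) : List ℕ → List ℕ
  | [] => [k]
  | a :: l => bif Nat.ble a k then (bif Nat.beq a k then l else k :: a :: l) else a :: toggle k l

def toggleAll : List ℕ → List ℕ → List ℕ
  | [], l => l
  | k :: ks, l => toggle k (toggleAll ks l)

/-- The differential of the state `x`. -/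
def column (p q x : ℕ) : List (ℕ × EdgeKind) → List ℕ
  | [] => []
  | e :: es => toggleAll ((e.2.targets x).map (position p q e.1)) (column p q x es)

/-- A search tree for vectors. -/
inductive Trie
  | leaf
  | node (v : List ℕ) (l r : Trie)

def Trie.get : Trie → List Bool → List ℕ
  | .leaf, _ => []
  | .node v _ _, [] => v
  | .node _ l r, b :: s => bif b then r.get s else l.get s

def Trie.set {α : Type} (v : List ℕ) : List Bool → Trie → (Trie → α) → α
  | [], .leaf, K => K (.node v .leaf .leaf)
  | [], .node _ l r, K => K (.node v l r)
  | b :: s, .leaf, K => bif b then Trie.set v s .leaf fun t => K (.node [] .leaf t) else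
      Trie.set v s .leaf fun t => K (.node [] t .leaf)
  | b :: s, .node w l r, K => bif b then Trie.set v s r fun t => K (.node w l t) else
      Trie.set v s l fun t => K (.node w t r)

def key : ℕ → ℕ → List Bool
  | 0, _ => []
  | n + 1, k => bit k 0 :: key n (Nat.div k 2)

/-- Reduce a vector by the vectors found so far; if it does not vanish then store and count it. -/
def eliminate {α : Type} (t : Trie) (c : ℕ) (K : Trie → ℕ → α) : ℕ → List ℕ → α
  | 0, _ => K t c
  | n + 1, x => match x with
    | [] => K t c
    | l :: x => match t.get (key 16 l) with
      | [] => t.set (l :: x) (key 16 l) fun t => K t (Nat.succ c)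
      | a :: y => forceList (toggleAll (a :: y) (l :: x)) fun x => eliminate t c K n x

/-- A state whose position is already the leading one of a stored boundary is skipped. When
positions are distinct, that boundary is a cycle and expresses the column of the state by other
columns, so no pivot is lost. Soundness of the lower bound does not rely on this. -/
def eliminateStates {α : Type} (p q n : ℕ) (es : List (ℕ × EdgeKind)) :
    List ℕ → Trie → ℕ → (Trie → ℕ → α) → α
  | [], t, c, K => K t c
  | x :: xs, t, c, K => force x fun x => match t.get (key 16 (position p q n x)) with
    | [] => forceList (column p q x es) fun v =>
      eliminate t c (fun t c => eliminateStates p q n es xs t c K) 100 v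
    | _ :: _ => eliminateStates p q n es xs t c K

def eliminateVertices (p q : ℕ) (T : CubeTree) (cs : List CrossingCode) (base : ℕ) :
    List (List Bool) → Trie → ℕ → ℕ
  | [], _, c => c
  | s :: ss, t, c =>
    edgesAt T (T.get s) [] cs s fun es =>
    force (vertexNumber s) fun n =>
    forceList (statesAt (T.get s) base) fun xs =>
    eliminateStates p q n es xs t c fun t c => eliminateVertices p q T cs base ss t c

def countStates (T : CubeTree) (base : ℕ) : List (List Bool) → ℕ
  | [] => 0
  | s :: ss => Nat.add (statesAt (T.get s) base).length (countStates T base ss)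

def singletons (n : ℕ) : List ℕ := (List.range n).map (Nat.shiftLeft 1)

/-- The number of generators of the reduced complex of the numerator closure, with the base point
at the north-west. -/
def numStates (C : TangleCode) : ℕ :=
  addEdges (singletons C.size) C.numerator.wires fun L => cubeTree C.crossings L fun T =>
    countStates T C.nw (vertices C.crossings.length)

/-- The number of independent columns of the differential found by Gaussian elimination. -/
def numPivots (p q : ℕ) (C : TangleCode) : ℕ :=
  addEdges (singletons C.size) C.numerator.wires fun L => cubeTree C.crossings L fun T =>
    eliminateVertices p q T C.crossings C.nw (vertices C.crossings.length) .leaf 0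

end KhovanovProgram

/-! ### Correctness of the enumeration of circles, vertices and labels. -/

namespace KhovanovProgram

open Relation

theorem force_eq {α : Type} (n : ℕ) (k : ℕ → α) : force n k = k n := by cases n <;> rfl

theorem forceList_eq {α : Type} (L : List ℕ) (k : List ℕ → α) : forceList L k = k L := by
  induction L generalizing k with
  | nil => rfl
  | cons m L ih => simp only [forceList, force_eq, ih]

theorem bit_eq_testBit (x i : ℕ) : bit x i = x.testBit i := by
  rw [bit, Nat.testBit, Bool.eq_iff_iff, Nat.beq_eq]
  change Nat.land (x >>> i) 1 = 1 ↔ _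
  rw [show Nat.land (x >>> i) 1 = x >>> i &&& 1 from rfl, Nat.and_comm 1, Nat.and_one_is_mod]
  simp

/-- Add edges to the graph whose components are listed in `L`. -/
def join (L : List ℕ) (E : List (ℕ × ℕ)) : List ℕ := E.foldl (fun L w => addEdge L w.1 w.2) L

theorem addEdges_eq {α : Type} (L : List ℕ) (E : List (ℕ × ℕ)) (k : List ℕ → α) :
    addEdges L E k = k (join L E) := by
  induction E generalizing L with
  | nil => rfl
  | cons w E ih => simp only [addEdges, forceList_eq, ih, join, List.foldl_cons]

theorem join_append (L : List ℕ) (E F : List (ℕ × ℕ)) : join L (E ++ F) = join (join L E) F :=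
  List.foldl_append

/-- Connectedness in a graph given by a list of edges. -/
abbrev Connected (E : List (ℕ × ℕ)) : ℕ → ℕ → Prop := EqvGen fun i j => (i, j) ∈ E

/-- A new edge unites the components of its two ends and leaves the others alone; this is what
`addEdge` does to the list of components. -/
theorem connected_concat {E : List (ℕ × ℕ)} {i j x y : ℕ} :
    Connected (E ++ [(i, j)]) x y ↔ Connected E x y ∨
      (Connected E i x ∨ Connected E j x) ∧ (Connected E i y ∨ Connected E j y) := by
  have mono : ∀ {x y}, Connected E x y → Connected (E ++ [(i, j)]) x y := fun h =>
    EqvGen.mono (p := fun a b => (a, b) ∈ E ++ [(i, j)])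
      (fun _ _ h => List.mem_append_left _ h) _ _ h
  have hij : Connected (E ++ [(i, j)]) i j := EqvGen.rel _ _ (by simp)
  constructor
  · intro h
    induction h with
    | rel x y h =>
      simp only [List.mem_append, List.mem_singleton, Prod.mk.injEq] at h
      rcases h with h | ⟨rfl, rfl⟩
      · exact Or.inl (EqvGen.rel _ _ h)
      · exact Or.inr ⟨Or.inl (EqvGen.refl _), Or.inr (EqvGen.refl _)⟩
    | refl x => exact Or.inl (EqvGen.refl _)
    | symm x y _ ih => exact ih.imp (EqvGen.symm _ _) And.symm
    | trans x y z _ _ ih₁ ih₂ =>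
      rcases ih₁ with h₁ | ⟨h₁, h₁'⟩ <;> rcases ih₂ with h₂ | ⟨h₂, h₂'⟩
      · exact Or.inl (EqvGen.trans _ _ _ h₁ h₂)
      · have h₁ := EqvGen.symm _ _ h₁
        exact Or.inr ⟨h₂.imp (EqvGen.trans _ _ _ · h₁) (EqvGen.trans _ _ _ · h₁), h₂'⟩
      · exact Or.inr ⟨h₁, h₁'.imp (EqvGen.trans _ _ _ · h₂) (EqvGen.trans _ _ _ · h₂)⟩
      · exact Or.inr ⟨h₁, h₂'⟩
  · rintro (h | ⟨hx, hy⟩)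
    · exact mono h
    · have aux : ∀ {z}, Connected E i z ∨ Connected E j z → Connected (E ++ [(i, j)]) i z := by
        rintro z (h | h)
        · exact mono h
        · exact EqvGen.trans _ _ _ hij (mono h)
      exact EqvGen.trans _ _ _ (EqvGen.symm _ _ (aux hx)) (aux hy)

/-- The list `L` consists of the components of the graph with vertices below `n` and edges `E`. -/
structure IsPartition (n : ℕ) (E : List (ℕ × ℕ)) (L : List ℕ) : Prop where
  testBit_iff : ∀ m ∈ L, ∀ i j, m.testBit i = true → (m.testBit j = true ↔ Connected E i j)
  cover : ∀ i < n, ∃ m ∈ L, m.testBit i = true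
  lt : ∀ m ∈ L, ∀ i, m.testBit i = true → i < n

theorem classOf_spec {L : List ℕ} {i : ℕ} (h : ∃ m ∈ L, m.testBit i = true) :
    classOf L i ∈ L ∧ (classOf L i).testBit i = true := by
  induction L with
  | nil => simp at h
  | cons m L ih =>
    rw [classOf, bit_eq_testBit]
    cases hm : m.testBit i with
    | true => exact ⟨List.mem_cons_self, hm⟩
    | false =>
      have := ih (by simpa [hm] using h)
      exact ⟨List.mem_cons_of_mem _ this.1, this.2⟩

theorem mem_removeClass {L : List ℕ} {i m : ℕ} :
    m ∈ removeClass L i ↔ m ∈ L ∧ m.testBit i = false := by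
  induction L with
  | nil => simp [removeClass]
  | cons a L ih =>
    rw [removeClass, bit_eq_testBit]
    cases ha : a.testBit i with
    | true =>
      rw [cond_true, ih, List.mem_cons]
      constructor
      · exact fun h => ⟨Or.inr h.1, h.2⟩
      · rintro ⟨rfl | h, h'⟩
        · simp [ha] at h'
        · exact ⟨h, h'⟩
    | false =>
      rw [cond_false, List.mem_cons, List.mem_cons, ih]
      constructor
      · rintro (rfl | h)
        · exact ⟨Or.inl rfl, ha⟩
        · exact ⟨Or.inr h.1, h.2⟩
      · rintro ⟨rfl | h, h'⟩
        · exact Or.inl rfl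
        · exact Or.inr ⟨h, h'⟩

namespace IsPartition

variable {n : ℕ} {E : List (ℕ × ℕ)} {L : List ℕ}

theorem testBit_classOf (h : IsPartition n E L) {i j : ℕ} (hi : i < n) :
    (classOf L i).testBit j = true ↔ Connected E i j :=
  let h' := classOf_spec (h.cover i hi)
  h.testBit_iff _ h'.1 _ _ h'.2

theorem addEdge (h : IsPartition n E L) {i j : ℕ} (hi : i < n) (hj : j < n) :
    IsPartition n (E ++ [(i, j)]) (addEdge L i j) := by
  have key : ∀ x, (Nat.lor (classOf L i) (classOf L j)).testBit x = true ↔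
      Connected E i x ∨ Connected E j x := fun x => by
    change (classOf L i ||| classOf L j).testBit x = true ↔ _
    rw [Nat.testBit_or, Bool.or_eq_true, h.testBit_classOf hi, h.testBit_classOf hj]
  constructor
  · intro m hm x y hx
    rw [connected_concat]
    rcases List.mem_cons.1 hm with rfl | hm
    · rw [key] at hx ⊢
      constructor
      · exact fun hy => Or.inr ⟨hx, hy⟩
      · rintro (hy | hy)
        · exact hx.imp (EqvGen.trans _ _ _ · hy) (EqvGen.trans _ _ _ · hy)
        · exact hy.2
    · rw [mem_removeClass, mem_removeClass] at hm
      rw [h.testBit_iff m hm.1.1 x y hx]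
      refine ⟨Or.inl, fun h' => h'.resolve_right ?_⟩
      rintro ⟨hc | hc, -⟩
      · have := (h.testBit_iff m hm.1.1 x i hx).2 (EqvGen.symm _ _ hc)
        rw [hm.1.2] at this
        cases this
      · have := (h.testBit_iff m hm.1.1 x j hx).2 (EqvGen.symm _ _ hc)
        rw [hm.2] at this
        cases this
  · intro x hx
    obtain ⟨m, hm, hmx⟩ := h.cover x hx
    by_cases h' : Connected E i x ∨ Connected E j x
    · exact ⟨_, List.mem_cons_self, (key x).2 h'⟩
    · refine ⟨m, List.mem_cons_of_mem _ (mem_removeClass.2 ⟨mem_removeClass.2 ⟨hm, ?_⟩, ?_⟩), hmx⟩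
      · by_contra hmi
        rw [Bool.not_eq_false] at hmi
        exact h' (Or.inl ((h.testBit_iff m hm i x hmi).1 hmx))
      · by_contra hmj
        rw [Bool.not_eq_false] at hmj
        exact h' (Or.inr ((h.testBit_iff m hm j x hmj).1 hmx))
  · intro m hm x hx
    rcases List.mem_cons.1 hm with rfl | hm
    · change (classOf L i ||| classOf L j).testBit x = true at hx
      rw [Nat.testBit_or, Bool.or_eq_true] at hx
      rcases hx with hx | hx
      · exact h.lt _ (classOf_spec (h.cover i hi)).1 x hx
      · exact h.lt _ (classOf_spec (h.cover j hj)).1 x hx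
    · rw [mem_removeClass, mem_removeClass] at hm
      exact h.lt m hm.1.1 x hx

theorem join (h : IsPartition n E L) {F : List (ℕ × ℕ)} (hF : ∀ w ∈ F, w.1 < n ∧ w.2 < n) :
    IsPartition n (E ++ F) (join L F) := by
  induction F generalizing E L with
  | nil => rwa [List.append_nil]
  | cons w F ih =>
    have hw := hF w List.mem_cons_self
    have := ih (h.addEdge hw.1 hw.2) fun v hv => hF v (List.mem_cons_of_mem _ hv)
    rwa [List.append_assoc, List.singleton_append] at this

theorem singletons (n : ℕ) : IsPartition n [] (singletons n) := by
  have key : ∀ a x, (Nat.shiftLeft 1 a).testBit x = true ↔ a = x := fun a x => by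
    change (1 <<< a).testBit x = true ↔ _
    rw [Nat.one_shiftLeft, Nat.testBit_two_pow, decide_eq_true_iff]
  constructor
  · intro m hm i j hi
    obtain ⟨a, -, rfl⟩ := List.mem_map.1 hm
    rw [key] at hi ⊢
    subst hi
    constructor
    · rintro rfl
      exact EqvGen.refl _
    · intro h
      clear hm
      induction h with
      | rel x y h => simp at h
      | refl => rfl
      | symm x y _ ih => exact ih.symm
      | trans x y z _ _ h₁ h₂ => exact h₁.trans h₂
  · exact fun i hi => ⟨_, List.mem_map.2 ⟨i, List.mem_range.2 hi, rfl⟩, (key _ _).2 rfl⟩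
  · intro m hm i hi
    obtain ⟨a, ha, rfl⟩ := List.mem_map.1 hm
    exact (key _ _).1 hi ▸ List.mem_range.1 ha

end IsPartition

/-- The segments of a complete smoothing which lie near crossings. -/
def smoothingEdges : List CrossingCode → List Bool → List (ℕ × ℕ)
  | c :: cs, b :: s => (bif b then [(c.1, c.2.2.2), (c.2.1, c.2.2.1)]
      else [(c.1, c.2.1), (c.2.2.1, c.2.2.2)]) ++ smoothingEdges cs s
  | _, _ => []

/-- Continuation passing hides the computed tree. The lemma extracts it as one value that serves all
continuations. -/
theorem exists_cubeTree (cs : List CrossingCode) (L : List ℕ) :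
    ∃ T, (∀ (α : Type) (k : CubeTree → α), cubeTree cs L k = k T) ∧
      ∀ s, s.length = cs.length → T.get s = join L (smoothingEdges cs s) := by
  induction cs generalizing L with
  | nil =>
    refine ⟨.leaf L, fun α k => rfl, fun s hs => ?_⟩
    rw [List.length_eq_zero_iff.1 hs]
    rfl
  | cons c cs ih =>
    obtain ⟨T₀, h₀, h₀'⟩ := ih (join L [(c.1, c.2.1), (c.2.2.1, c.2.2.2)])
    obtain ⟨T₁, h₁, h₁'⟩ := ih (join L [(c.1, c.2.2.2), (c.2.1, c.2.2.1)])
    refine ⟨.node T₀ T₁, fun α k => by simp only [cubeTree, addEdges_eq, h₀, h₁], fun s hs => ?_⟩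
    cases s with
    | nil => simp at hs
    | cons b s =>
      rw [smoothingEdges, join_append]
      cases b
      · exact h₀' s (Nat.succ_injective hs)
      · exact h₁' s (Nat.succ_injective hs)

theorem EdgeKind.force_eq {α : Type} (e : EdgeKind) (k : EdgeKind → α) : e.force k = k e := by
  cases e <;> simp only [EdgeKind.force, KhovanovProgram.force_eq]

open Function in
open scoped Classical in
theorem edgesAt_eq {α : Type} {ι : Type*} (T : CubeTree) (L : List ℕ) (code : ι → CrossingCode)
    (σ : ι → Bool) (l : List ι) (hl : l.Nodup) (pre : List Bool)
    (k : List (ℕ × EdgeKind) → α) :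
    edgesAt T L pre (l.map code) (l.map σ) k = k ((l.filter fun c => !σ c).map fun c =>
      (vertexNumber (pre ++ l.map (update σ c true)),
        edgeKind (code c) L (T.get (pre ++ l.map (update σ c true))))) := by
  induction l generalizing pre k with
  | nil => rfl
  | cons d l ih =>
    have hl := List.nodup_cons.1 hl
    have ih := @ih hl.2
    have hd : l.map (update σ d true) = l.map σ := List.map_congr_left fun c hc =>
      update_of_ne (ne_of_mem_of_not_mem hc hl.1) _ _
    have hc : ∀ c ∈ l.filter fun c => !σ c, update σ c true d = σ d := fun c hc =>
      update_of_ne (ne_of_mem_of_not_mem (List.mem_filter.1 hc).1 hl.1).symm _ _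
    rw [List.map_cons, List.map_cons, edgesAt]
    cases h : σ d with
    | true =>
      rw [cond_true, ih, List.filter_cons_of_neg (by simp [h])]
      congr 1
      refine List.map_congr_left fun c hc' => ?_
      rw [List.map_cons, hc c hc', h, List.append_assoc, List.singleton_append]
    | false =>
      rw [cond_false, force_eq, EdgeKind.force_eq, ih, List.filter_cons_of_pos (by simp [h]),
        List.map_cons, List.map_cons, hd, update_self]
      congr 2
      refine List.map_congr_left fun c hc' => ?_
      rw [List.map_cons, hc c hc', h, List.append_assoc, List.singleton_append]

theorem mem_vertices {n : ℕ} {s : List Bool} : s ∈ vertices n ↔ s.length = n := by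
  induction n generalizing s with
  | zero => simp [vertices]
  | succ n ih =>
    cases s with
    | nil => simp [vertices]
    | cons b s => cases b <;> simp [vertices, ih]

theorem mem_labelings {b : ℕ} {L : List ℕ} {x : ℕ} :
    x ∈ labelings b L ↔ ∃ M : List ℕ, M.Sublist L ∧ x = M.foldr Nat.lor b := by
  induction L generalizing x with
  | nil => simp [labelings]
  | cons m L ih =>
    simp only [labelings, List.mem_append, List.mem_map, ih]
    constructor
    · rintro (⟨M, hM, rfl⟩ | ⟨_, ⟨M, hM, rfl⟩, rfl⟩)
      · exact ⟨M, hM.cons _, rfl⟩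
      · exact ⟨m :: M, hM.cons_cons _, rfl⟩
    · rintro ⟨M, hM, rfl⟩
      cases hM with
      | cons _ hM => exact Or.inl ⟨M, hM, rfl⟩
      | cons_cons _ hM => exact Or.inr ⟨_, ⟨_, hM, rfl⟩, rfl⟩

theorem testBit_foldr_lor {b : ℕ} {M : List ℕ} {i : ℕ} :
    (M.foldr Nat.lor b).testBit i = true ↔ b.testBit i = true ∨ ∃ m ∈ M, m.testBit i = true := by
  induction M with
  | nil => simp
  | cons m M ih =>
    rw [List.foldr_cons]
    change (m ||| M.foldr Nat.lor b).testBit i = true ↔ _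
    rw [Nat.testBit_or, Bool.or_eq_true, ih]
    simp only [List.mem_cons, exists_eq_or_imp]
    tauto

end KhovanovProgram

/-! ### Correctness of Gaussian elimination over the field of two elements. -/

namespace KhovanovProgram

/-- The vector coded by a list of basis vectors. -/
def vec (l : List ℕ) : ℕ → ZMod 2 := fun i => (l.count i : ZMod 2)

theorem vec_nil : vec [] = 0 := rfl

theorem vec_cons (k : ℕ) (l : List ℕ) : vec (k :: l) = Pi.single k 1 + vec l := by
  ext i
  simp only [vec, List.count_cons, Pi.add_apply, Pi.single_apply, beq_iff_eq, eq_comm (a := i)]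
  push_cast
  split_ifs <;> ring

/-- Removing an occurrence and inserting one have the same effect on the count modulo 2, so no
sortedness is required. The order matters only for leading coordinates. -/
theorem vec_toggle (k : ℕ) (l : List ℕ) : vec (toggle k l) = Pi.single k 1 + vec l := by
  induction l with
  | nil => exact vec_cons k []
  | cons a l ih =>
    rw [toggle]
    cases h : Nat.ble a k with
    | true =>
      rw [cond_true]
      cases h' : Nat.beq a k with
      | true =>
        rw [Nat.beq_eq] at h'
        rw [cond_true, vec_cons, h', ← add_assoc, CharTwo.add_self_eq_zero, zero_add]
      | false => rw [cond_false, vec_cons]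
    | false =>
      rw [cond_false, vec_cons, vec_cons, ih]
      abel

theorem vec_toggleAll (ks l : List ℕ) : vec (toggleAll ks l) = vec ks + vec l := by
  induction ks with
  | nil => rw [vec_nil, zero_add, toggleAll]
  | cons k ks ih => rw [toggleAll, vec_toggle, ih, vec_cons, add_assoc]

theorem mem_toggle {k i : ℕ} {l : List ℕ} (h : i ∈ toggle k l) : i = k ∨ i ∈ l := by
  induction l with
  | nil => simpa [toggle] using h
  | cons a l ih =>
    rw [toggle] at h
    cases h₁ : Nat.ble a k <;> cases h₂ : Nat.beq a k <;>
      simp only [h₁, h₂, cond_true, cond_false, List.mem_cons] at h ⊢ <;> tauto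

theorem pairwise_toggle {l : List ℕ} (k : ℕ) (h : l.Pairwise (· > ·)) :
    (toggle k l).Pairwise (· > ·) := by
  induction l with
  | nil => simp [toggle]
  | cons a l ih =>
    have h' := List.pairwise_cons.1 h
    rw [toggle]
    cases h₁ : Nat.ble a k with
    | true =>
      rw [Nat.ble_eq] at h₁
      rw [cond_true]
      cases h₂ : Nat.beq a k with
      | true => exact h'.2
      | false =>
        have h₂ := Nat.ne_of_beq_eq_false h₂
        refine List.pairwise_cons.2 ⟨fun i hi => ?_, h⟩
        rcases List.mem_cons.1 hi with rfl | hi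
        · omega
        · have := h'.1 i hi
          omega
    | false =>
      have h₁ : k < a := by
        by_contra h₃
        rw [Nat.ble_eq_true_of_le (not_lt.1 h₃)] at h₁
        cases h₁
      refine List.pairwise_cons.2 ⟨fun i hi => ?_, ih h'.2⟩
      rcases mem_toggle hi with rfl | hi
      · exact h₁
      · exact h'.1 i hi

theorem pairwise_toggleAll {l : List ℕ} (ks : List ℕ) (h : l.Pairwise (· > ·)) :
    (toggleAll ks l).Pairwise (· > ·) := by
  induction ks with
  | nil => exact h
  | cons k ks ih => exact pairwise_toggle k ih

theorem pairwise_column (p q x : ℕ) (es : List (ℕ × EdgeKind)) :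
    (column p q x es).Pairwise (· > ·) := by
  cases es with
  | nil => exact List.Pairwise.nil
  | cons e es => exact pairwise_toggleAll _ (pairwise_column p q x es)

theorem vec_column (p q x : ℕ) (es : List (ℕ × EdgeKind)) :
    vec (column p q x es) =
      vec (es.flatMap fun e => (e.2.targets x).map (position p q e.1)) := by
  have vec_append : ∀ l l' : List ℕ, vec (l ++ l') = vec l + vec l' := fun l l' => by
    ext i
    simp [vec, List.count_append]
  induction es with
  | nil => rfl
  | cons e es ih => rw [column, vec_toggleAll, ih, List.flatMap_cons, vec_append]

theorem exists_set (v : List ℕ) (s : List Bool) (t : Trie) :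
    ∃ t' : Trie, (∀ (α : Type) (K : Trie → α), t.set v s K = K t') ∧
      ∀ s', s'.length = s.length → t'.get s' = if s' = s then v else t.get s' := by
  induction s generalizing t with
  | nil =>
    cases t with
    | leaf => exact ⟨_, fun α K => rfl, fun s' hs' => by simp [List.length_eq_zero_iff.1 hs', Trie.get]⟩
    | node w l r => exact ⟨_, fun α K => rfl, fun s' hs' => by simp [List.length_eq_zero_iff.1 hs', Trie.get]⟩
  | cons b s ih =>
    cases t with
    | leaf =>
      obtain ⟨t', h₁, h₂⟩ := ih .leaf
      refine ⟨bif b then .node [] .leaf t' else .node [] t' .leaf, fun α K => ?_, fun s' hs' => ?_⟩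
      · cases b <;> simp only [Trie.set, h₁, cond_true, cond_false]
      · cases s' with
        | nil => simp at hs'
        | cons b' s' =>
          have := h₂ s' (Nat.succ_injective hs')
          cases b <;> cases b' <;> simp [Trie.get, this]
    | node w l r =>
      obtain ⟨tl, h₁, h₂⟩ := ih l
      obtain ⟨tr, h₃, h₄⟩ := ih r
      refine ⟨bif b then .node w l tr else .node w tl r, fun α K => ?_, fun s' hs' => ?_⟩
      · cases b <;> simp only [Trie.set, h₁, h₃, cond_true, cond_false]
      · cases s' with
        | nil => simp at hs'
        | cons b' s' =>
          have e₁ := h₂ s' (Nat.succ_injective hs')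
          have e₂ := h₄ s' (Nat.succ_injective hs')
          cases b <;> cases b' <;> simp [Trie.get, e₁, e₂]

theorem length_key (n k : ℕ) : (key n k).length = n := by
  induction n generalizing k with
  | zero => rfl
  | succ n ih => rw [key, List.length_cons, ih]

/-- The coordinate `l` is the leading one of some vector in `W`. -/
def IsLead (W : Submodule (ZMod 2) (ℕ → ZMod 2)) (l : ℕ) : Prop :=
  ∃ w ∈ W, w l = 1 ∧ ∀ j > l, w j = 0

theorem isLead_of_mem {W : Submodule (ZMod 2) (ℕ → ZMod 2)} {l : ℕ} {x : List ℕ}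
    (h : vec (l :: x) ∈ W) (h' : (l :: x).Pairwise (· > ·)) : IsLead W l := by
  have h' := List.pairwise_cons.1 h'
  refine ⟨_, h, ?_, fun j hj => ?_⟩
  · have : x.count l = 0 := List.count_eq_zero.2 fun hl => lt_irrefl _ (h'.1 l hl)
    simp [vec, this]
  · have : (l :: x).count j = 0 := List.count_eq_zero.2 fun hl => by
      rcases List.mem_cons.1 hl with rfl | hl
      · exact lt_irrefl _ hj
      · exact lt_asymm hj (h'.1 j hl)
    simp [vec, this]

/-- Vectors with distinct leading coordinates are independent: in a linear relation, look at the
largest leading coordinate whose vector has a nonzero coefficient. -/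
theorem card_le_finrank {W : Submodule (ZMod 2) (ℕ → ZMod 2)} [Module.Finite (ZMod 2) W]
    (P : Finset ℕ) (hP : ∀ l ∈ P, IsLead W l) : P.card ≤ Module.finrank (ZMod 2) W := by
  choose! w hw h₁ h₀ using hP
  let f : P → W := fun l => ⟨w l, hw l l.2⟩
  have hf : LinearIndependent (ZMod 2) f := by
    rw [linearIndependent_iff']
    intro s g hg
    by_contra! hne
    obtain ⟨i, hi, hgi⟩ := hne
    have hne : (s.filter fun i => g i ≠ 0).Nonempty := ⟨i, Finset.mem_filter.2 ⟨hi, hgi⟩⟩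
    obtain ⟨m, hm, hmax⟩ := Finset.exists_max_image _ (fun i : P => (i : ℕ)) hne
    have hm := Finset.mem_filter.1 hm
    have := congrFun (congrArg Subtype.val hg) (m : ℕ)
    simp only [Submodule.coe_sum, Submodule.coe_smul, Finset.sum_apply, Pi.smul_apply, f,
      ZeroMemClass.coe_zero, Pi.zero_apply, smul_eq_mul] at this
    rw [Finset.sum_eq_single_of_mem m hm.1, h₁ _ m.2, mul_one] at this
    · exact hm.2 this
    · intro j hj hjm
      by_cases hgj : g j = 0
      · rw [hgj, zero_mul]
      · have := hmax j (Finset.mem_filter.2 ⟨hj, hgj⟩)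
        rw [h₀ j j.2 m (lt_of_le_of_ne this fun h => hjm (Subtype.ext h)), mul_zero]
  simpa using hf.fintype_card_le_finrank

/-- The vectors in `t` lie in `W`, and `c` leading coordinates were found. -/
structure Trie.IsValid (W : Submodule (ZMod 2) (ℕ → ZMod 2)) (t : Trie) (c : ℕ) : Prop where
  mem : ∀ l, vec (t.get (key 16 l)) ∈ W
  pairwise : ∀ l, (t.get (key 16 l)).Pairwise (· > ·)
  leads : ∃ P : Finset ℕ, P.card = c ∧ ∀ l ∈ P, t.get (key 16 l) ≠ [] ∧ IsLead W l

section

variable {W : Submodule (ZMod 2) (ℕ → ZMod 2)} {N : ℕ}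

theorem isValid_leaf : Trie.leaf.IsValid W 0 where
  mem l := by rw [Trie.get, vec_nil]; exact W.zero_mem
  pairwise l := List.Pairwise.nil
  leads := ⟨∅, rfl, by simp⟩

/-- Adding stored vectors keeps the vector in `W`, and a new pivot is counted only where nothing was
stored. If the bound on the number of reduction steps is reached the vector is dropped, which can
only lower the count. -/
theorem eliminate_le {K : Trie → ℕ → ℕ} (hK : ∀ t c, t.IsValid W c → K t c ≤ N) (n : ℕ)
    {t : Trie} {c : ℕ} (ht : t.IsValid W c) {x : List ℕ} (hx : vec x ∈ W)
    (hx' : x.Pairwise (· > ·)) : eliminate t c K n x ≤ N := by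
  induction n generalizing x with
  | zero => exact hK t c ht
  | succ n ih =>
    cases x with
    | nil => exact hK t c ht
    | cons l x =>
      simp only [eliminate]
      cases hl : t.get (key 16 l) with
      | nil =>
        obtain ⟨t', h₁, h₂⟩ := exists_set (l :: x) (key 16 l) t
        have h₂ : ∀ l', _ := fun l' => h₂ (key 16 l') (by simp only [length_key])
        rw [h₁]
        refine hK t' _ ⟨fun l' => ?_, fun l' => ?_, ?_⟩
        · rw [h₂]
          split_ifs
          exacts [hx, ht.mem l']
        · rw [h₂]
          split_ifs
          exacts [hx', ht.pairwise l']
        · obtain ⟨P, hP, hP'⟩ := ht.leads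
          refine ⟨insert l P, ?_, fun l' hl' => ?_⟩
          · rw [Finset.card_insert_of_notMem fun h => (hP' l h).1 hl, hP]
          · rw [h₂]
            split_ifs with h
            · refine ⟨by simp, ?_⟩
              rcases Finset.mem_insert.1 hl' with rfl | hl'
              exacts [isLead_of_mem hx hx', (hP' l' hl').2]
            · rcases Finset.mem_insert.1 hl' with rfl | hl'
              exacts [absurd rfl h, hP' l' hl']
      | cons a y =>
        simp only [forceList_eq]
        refine ih ?_ (pairwise_toggleAll _ hx')
        rw [vec_toggleAll]
        exact W.add_mem (hl ▸ ht.mem l) hx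

theorem eliminateStates_le {p q n : ℕ} {es : List (ℕ × EdgeKind)} {K : Trie → ℕ → ℕ}
    (hK : ∀ t c, t.IsValid W c → K t c ≤ N) {xs : List ℕ}
    (hxs : ∀ x ∈ xs, vec (column p q x es) ∈ W) {t : Trie} {c : ℕ} (ht : t.IsValid W c) :
    eliminateStates p q n es xs t c K ≤ N := by
  induction xs generalizing t c with
  | nil => exact hK t c ht
  | cons x xs ih =>
    have ih : ∀ t c, t.IsValid W c → eliminateStates p q n es xs t c K ≤ N := fun t c =>
      ih fun y hy => hxs y (List.mem_cons_of_mem _ hy)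
    simp only [eliminateStates, force_eq]
    cases t.get (key 16 (position p q n x)) with
    | nil =>
      simp only [forceList_eq]
      exact eliminate_le ih _ ht (hxs x List.mem_cons_self) (pairwise_column _ _ _ _)
    | cons a y => exact ih t c ht

theorem eliminateVertices_le [Module.Finite (ZMod 2) W] {p q : ℕ} {T : CubeTree}
    {cs : List CrossingCode} {base : ℕ} {ss : List (List Bool)}
    (hss : ∀ s ∈ ss, ∃ es, (∀ k : List (ℕ × EdgeKind) → ℕ, edgesAt T (T.get s) [] cs s k = k es) ∧
      ∀ x ∈ statesAt (T.get s) base, vec (column p q x es) ∈ W)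
    {t : Trie} {c : ℕ} (ht : t.IsValid W c) :
    eliminateVertices p q T cs base ss t c ≤ Module.finrank (ZMod 2) W := by
  induction ss generalizing t c with
  | nil =>
    obtain ⟨P, rfl, hP⟩ := ht.leads
    exact card_le_finrank P fun l hl => (hP l hl).2
  | cons s ss ih =>
    obtain ⟨es, h₁, h₂⟩ := hss s List.mem_cons_self
    simp only [eliminateVertices, h₁, force_eq, forceList_eq]
    exact eliminateStates_le
      (fun t c => ih fun s' hs' => hss s' (List.mem_cons_of_mem _ hs')) h₂ ht

end

end KhovanovProgram

/-! ### The differential in terms of the set of points labelled `X`. -/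

namespace PlanarDiagram

open Relation Function KhovanovProgram
open scoped Classical

section

variable {D : PlanarDiagram} {S T : D.EnhancedState} {c : D.Cr}

/-- The multiplication as an operation on sets of points, in the shape of `EdgeKind.targets`: zero
if both labels are `X`, otherwise the merged circle is added if one label is `X`. -/
theorem EnhancedState.incident_iff_merge (hc : S.smoothing c = false)
    (hT : T.smoothing = update S.smoothing c true)
    (h : ¬ D.SameCircle S.smoothing (D.cross c 0) (D.cross c 2))
    (h' : D.SameCircle T.smoothing (D.cross c 0) (D.cross c 2)) :
    S.Incident T ↔ ¬ (S.isX (D.cross c 0) = true ∧ S.isX (D.cross c 2) = true) ∧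
      ∀ p, T.isX p = true ↔ S.isX p = true ∨
        (S.isX (D.cross c 0) = true ∨ S.isX (D.cross c 2) = true) ∧
          D.SameCircle T.smoothing (D.cross c 0) p := by
  have agree : ∀ d, d ≠ c → S.smoothing d = T.smoothing d := fun d hd => by
    rw [hT, update_of_ne hd]
  rw [incident_iff (Or.inl ⟨rfl, rfl⟩) hc hT]
  constructor
  · rintro ⟨h₁, ⟨-, -, h₂⟩ | ⟨h₃, -⟩⟩
    swap
    · exact absurd h₃ h
    refine ⟨fun h₄ => ?_, fun p => ?_⟩
    · rw [h₄.1, h₄.2] at h₂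
      revert h₂
      cases T.isX (D.cross c 0) <;> simp
    · have h₅ : T.isX (D.cross c 0) = true ↔
          S.isX (D.cross c 0) = true ∨ S.isX (D.cross c 2) = true := by
        revert h₂
        cases T.isX (D.cross c 0) <;> cases S.isX (D.cross c 0) <;>
          cases S.isX (D.cross c 2) <;> simp
      by_cases hp : D.SameCircle T.smoothing (D.cross c 0) p
      · rw [← T.isX_eq hp, h₅]
        simp only [hp, and_true]
        refine ⟨Or.inr, fun h₆ => h₆.elim (fun h₆ => ?_) id⟩
        rcases hp.flip fun d hd => (agree d hd).symm with h₇ | ⟨-, h₇ | h₇⟩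
        · exact Or.inl ((S.isX_eq h₇).trans h₆)
        · exact Or.inl ((S.isX_eq h₇).symm.trans h₆)
        · exact Or.inr ((S.isX_eq h₇).symm.trans h₆)
      · rw [h₁ p (fun h₆ => hp ?_) fun h₆ => hp ?_]
        · simp [hp]
        · rcases h₆.flip agree with h₇ | ⟨h₇ | h₇, -⟩
          exacts [h₇.symm, h₇.symm, h'.trans h₇.symm]
        · rcases h₆.flip agree with h₇ | ⟨h₇ | h₇, -⟩
          exacts [h'.trans h₇.symm, h₇.symm, h'.trans h₇.symm]
  · rintro ⟨h₁, h₂⟩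
    refine ⟨fun p hp hp' => ?_, Or.inl ⟨h, h', ?_⟩⟩
    · rw [Bool.eq_iff_iff, h₂, or_iff_left]
      rintro ⟨-, h₃⟩
      rcases h₃.flip fun d hd => (agree d hd).symm with h₇ | ⟨-, h₇ | h₇⟩
      exacts [hp h₇.symm, hp h₇, hp' h₇]
    · have h₃ := h₂ (D.cross c 0)
      simp only [SameCircle.refl, and_true] at h₃
      revert h₁ h₃
      cases T.isX (D.cross c 0) <;> cases S.isX (D.cross c 0) <;>
        cases S.isX (D.cross c 2) <;> simp

/-- The comultiplication as an operation on sets of points: a circle labelled `X` keeps all its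
points, and from a circle labelled `1` exactly one of the two halves is added. -/
theorem EnhancedState.incident_iff_split (hc : S.smoothing c = false)
    (hT : T.smoothing = update S.smoothing c true)
    (h : D.SameCircle S.smoothing (D.cross c 0) (D.cross c 2))
    (h' : ¬ D.SameCircle T.smoothing (D.cross c 0) (D.cross c 2)) :
    S.Incident T ↔
      if S.isX (D.cross c 0) = true then ∀ p, T.isX p = true ↔ S.isX p = true
      else (∀ p, T.isX p = true ↔ S.isX p = true ∨ D.SameCircle T.smoothing (D.cross c 0) p) ∨
        ∀ p, T.isX p = true ↔ S.isX p = true ∨ D.SameCircle T.smoothing (D.cross c 2) p := by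
  have agree : ∀ d, d ≠ c → S.smoothing d = T.smoothing d := fun d hd => by
    rw [hT, update_of_ne hd]
  have e := S.isX_eq h
  have key : ∀ p, D.SameCircle S.smoothing p (D.cross c 0) →
      D.SameCircle T.smoothing p (D.cross c 0) ∨ D.SameCircle T.smoothing p (D.cross c 2) := by
    intro p hp
    rcases hp.flip agree with h₇ | ⟨h₇, -⟩
    exacts [Or.inl h₇, h₇]
  have key' : ∀ p, D.SameCircle T.smoothing (D.cross c 0) p ∨
      D.SameCircle T.smoothing (D.cross c 2) p → D.SameCircle S.smoothing p (D.cross c 0) := by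
    rintro p (hp | hp) <;> rcases hp.flip fun d hd => (agree d hd).symm with h₇ | ⟨-, h₇ | h₇⟩
    exacts [h₇.symm, h₇, h₇.trans h.symm, h₇.symm.trans h.symm, h₇, h₇.trans h.symm]
  rw [incident_iff (Or.inl ⟨rfl, rfl⟩) hc hT]
  constructor
  · rintro ⟨h₁, ⟨h₃, -⟩ | ⟨-, -, h₂⟩⟩
    · exact absurd h h₃
    have h₁ : ∀ p, ¬ D.SameCircle S.smoothing p (D.cross c 0) → T.isX p = S.isX p :=
      fun p hp => h₁ p hp fun h₃ => hp (h₃.trans h.symm)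
    have h₄ : ∀ p, ¬ D.SameCircle T.smoothing (D.cross c 0) p →
        ¬ D.SameCircle T.smoothing (D.cross c 2) p → T.isX p = S.isX p := fun p hp hp' =>
      h₁ p fun h₃ => (key p h₃).elim (fun h => hp h.symm) fun h => hp' h.symm
    cases ha : S.isX (D.cross c 0) with
    | true =>
      rw [if_pos rfl]
      intro p
      by_cases hp : D.SameCircle S.smoothing p (D.cross c 0)
      · rw [S.isX_eq hp, ha]
        rw [ha] at h₂
        rcases key p hp with hp | hp <;> rw [T.isX_eq hp] <;> revert h₂ <;>
          cases T.isX (D.cross c 0) <;> cases T.isX (D.cross c 2) <;> simp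
      · rw [h₁ p hp]
    | false =>
      rw [if_neg (by simp)]
      rw [ha] at h₂
      have h₅ : ∀ p, D.SameCircle T.smoothing (D.cross c 0) p ∨
          D.SameCircle T.smoothing (D.cross c 2) p → S.isX p = false := fun p hp =>
        (S.isX_eq (key' p hp)).trans ha
      cases ha' : T.isX (D.cross c 0) with
      | true =>
        left
        have hb' : T.isX (D.cross c 2) = false := by
          revert h₂
          rw [ha']
          cases T.isX (D.cross c 2) <;> simp
        intro p
        by_cases hp : D.SameCircle T.smoothing (D.cross c 0) p
        · simp [← T.isX_eq hp, ha', hp]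
        · by_cases hp' : D.SameCircle T.smoothing (D.cross c 2) p
          · simp [← T.isX_eq hp', hb', hp, h₅ p (Or.inr hp')]
          · simp [h₄ p hp hp', hp]
      | false =>
        right
        have hb' : T.isX (D.cross c 2) = true := by
          revert h₂
          rw [ha']
          cases T.isX (D.cross c 2) <;> simp
        intro p
        by_cases hp' : D.SameCircle T.smoothing (D.cross c 2) p
        · simp [← T.isX_eq hp', hb', hp']
        · by_cases hp : D.SameCircle T.smoothing (D.cross c 0) p
          · simp [← T.isX_eq hp, ha', hp', h₅ p (Or.inl hp)]
          · simp [h₄ p hp hp', hp']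
  · intro h₁
    cases ha : S.isX (D.cross c 0) with
    | true =>
      rw [ha, if_pos rfl] at h₁
      have h₁ : ∀ p, T.isX p = S.isX p := fun p => Bool.eq_iff_iff.2 (h₁ p)
      refine ⟨fun p _ _ => h₁ p, Or.inr ⟨h, h', ?_⟩⟩
      rw [h₁, h₁, ← e, ha]
      rfl
    | false =>
      have hb := e.symm.trans ha
      rw [ha, if_neg (by simp)] at h₁
      rcases h₁ with h₁ | h₁
      · refine ⟨fun p hp hp' => ?_, Or.inr ⟨h, h', ?_⟩⟩
        · rw [Bool.eq_iff_iff, h₁, or_iff_left]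
          exact fun h₂ => hp (key' p (Or.inl h₂))
        · rw [(h₁ _).2 (Or.inr (SameCircle.refl _ _)),
            Bool.eq_false_iff.2 fun h₂ => ((h₁ _).1 h₂).elim (by simp [hb]) h']
          rfl
      · refine ⟨fun p hp hp' => ?_, Or.inr ⟨h, h', ?_⟩⟩
        · rw [Bool.eq_iff_iff, h₁, or_iff_left]
          exact fun h₂ => hp (key' p (Or.inr h₂))
        · rw [(h₁ _).2 (Or.inr (SameCircle.refl _ _)),
            Bool.eq_false_iff.2 fun h₂ => ((h₁ _).1 h₂).elim (by simp [ha]) fun h₃ => h' h₃.symm]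
          rfl

/-- The new labelling is constant on the new circles for one of two reasons: the old labels at `c`
agree, or every corner of `c` satisfies `P`, so that a disagreement of old labels is invisible. -/
theorem EnhancedState.exists_update (S : D.EnhancedState) (c : D.Cr) (P : D.Pt → Prop)
    (hP : ∀ p q, D.SameCircle (update S.smoothing c true) p q → P p → P q)
    (h : S.isX (D.cross c 0) = S.isX (D.cross c 2) ∨ P (D.cross c 0) ∧ P (D.cross c 2)) :
    ∃ T : D.EnhancedState, T.smoothing = update S.smoothing c true ∧
      ∀ p, T.isX p = true ↔ S.isX p = true ∨ P p := by
  refine ⟨⟨update S.smoothing c true, fun p => decide (S.isX p = true ∨ P p), fun p q hpq => ?_⟩,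
    rfl, fun p => decide_eq_true_iff⟩
  have h₁ : P p ↔ P q := ⟨hP p q hpq.sameCircle, hP q p hpq.sameCircle.symm⟩
  rw [decide_eq_decide]
  rcases h with h | h
  · rcases hpq.sameCircle.flip (σ' := S.smoothing) (c := c) fun d hd => update_of_ne hd _ _ with
      h₂ | ⟨h₂, h₃⟩
    · rw [S.isX_eq h₂, h₁]
    · have h₂ : S.isX p = S.isX (D.cross c 0) :=
        h₂.elim S.isX_eq fun h₂ => (S.isX_eq h₂).trans h.symm
      have h₃ : S.isX q = S.isX (D.cross c 0) :=
        h₃.elim S.isX_eq fun h₂ => (S.isX_eq h₂).trans h.symm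
      rw [h₂, h₃, h₁]
  · have h₂ : ∀ i, P (D.cross c i) := fun i =>
      (sameCircle_cross (update S.smoothing c true) c i).elim
        (fun h₃ => hP _ _ h₃.symm h.1) fun h₃ => hP _ _ h₃.symm h.2
    rcases hpq with hpq | ⟨d, hd⟩
    · rw [S.compat p q (Or.inl hpq), h₁]
    · by_cases hdc : d = c
      · subst hdc
        rcases hd with ⟨-, ⟨rfl, rfl⟩ | ⟨rfl, rfl⟩⟩ | ⟨-, ⟨rfl, rfl⟩ | ⟨rfl, rfl⟩⟩ <;> simp [h₂]
      · rw [update_of_ne hdc] at hd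
        rw [S.compat p q (Or.inr ⟨d, hd⟩), h₁]

end

end PlanarDiagram

/-! ### States of a diagram and their numerical codes. -/

namespace PlanarDiagram

open Relation Function KhovanovProgram
open scoped Classical

/-- A numbering of the marked points of a diagram, with lists of its crossings and wires. -/
structure Numbering (D : PlanarDiagram) (n : ℕ) (cs : List CrossingCode)
    (ws : List (ℕ × ℕ)) where
  num : D.Pt → ℕ
  crs : List D.Cr
  injective : Injective num
  lt : ∀ p, num p < n
  surjective : ∀ i < n, ∃ p, num p = i
  nodup : crs.Nodup
  mem : ∀ c, c ∈ crs
  crossings : cs = crs.map fun c =>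
    (num (D.cross c 0), num (D.cross c 1), num (D.cross c 2), num (D.cross c 3))
  wires : ∀ w, w ∈ ws ↔ ∃ p q, D.wire p q ∧ w = (num p, num q)

namespace Numbering

variable {D : PlanarDiagram} {n : ℕ} {cs : List CrossingCode} {ws : List (ℕ × ℕ)}
  (N : D.Numbering n cs ws) {base : D.Pt} {σ : D.Cr → Bool}

/-- The four points at a crossing. -/
def code (c : D.Cr) : CrossingCode :=
  (N.num (D.cross c 0), N.num (D.cross c 1), N.num (D.cross c 2), N.num (D.cross c 3))

theorem length_eq : cs.length = N.crs.length :=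
  (congrArg List.length N.crossings).trans (List.length_map _)

theorem mem_smoothingEdges {l : List D.Cr} {w : ℕ × ℕ} :
    w ∈ smoothingEdges (l.map N.code) (l.map σ) ↔ ∃ c ∈ l,
      (σ c = false ∧ (w = (N.num (D.cross c 0), N.num (D.cross c 1)) ∨
        w = (N.num (D.cross c 2), N.num (D.cross c 3)))) ∨
      (σ c = true ∧ (w = (N.num (D.cross c 0), N.num (D.cross c 3)) ∨
        w = (N.num (D.cross c 1), N.num (D.cross c 2)))) := by
  induction l with
  | nil => simp [smoothingEdges]
  | cons c l ih =>
    rw [List.map_cons, List.map_cons, smoothingEdges, List.mem_append, ih]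
    simp only [List.mem_cons, exists_eq_or_imp]
    refine or_congr ?_ Iff.rfl
    cases σ c <;> simp [code]

theorem mem_edges {w : ℕ × ℕ} : w ∈ ws ++ smoothingEdges cs (N.crs.map σ) ↔
    ∃ p q, D.Joined σ p q ∧ w = (N.num p, N.num q) := by
  have e : smoothingEdges cs (N.crs.map σ) = smoothingEdges (N.crs.map N.code) (N.crs.map σ) :=
    congrArg (smoothingEdges · _) N.crossings
  rw [List.mem_append, N.wires, e, N.mem_smoothingEdges]
  constructor
  · rintro (⟨p, q, h, rfl⟩ | ⟨c, -, ⟨h, rfl | rfl⟩ | ⟨h, rfl | rfl⟩⟩)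
    · exact ⟨p, q, Or.inl h, rfl⟩
    · exact ⟨_, _, Or.inr ⟨c, Or.inl ⟨h, Or.inl ⟨rfl, rfl⟩⟩⟩, rfl⟩
    · exact ⟨_, _, Or.inr ⟨c, Or.inl ⟨h, Or.inr ⟨rfl, rfl⟩⟩⟩, rfl⟩
    · exact ⟨_, _, Or.inr ⟨c, Or.inr ⟨h, Or.inl ⟨rfl, rfl⟩⟩⟩, rfl⟩
    · exact ⟨_, _, Or.inr ⟨c, Or.inr ⟨h, Or.inr ⟨rfl, rfl⟩⟩⟩, rfl⟩
  · rintro ⟨p, q, h | ⟨c, ⟨h, ⟨rfl, rfl⟩ | ⟨rfl, rfl⟩⟩ | ⟨h, ⟨rfl, rfl⟩ | ⟨rfl, rfl⟩⟩⟩, rfl⟩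
    · exact Or.inl ⟨p, q, h, rfl⟩
    · exact Or.inr ⟨c, N.mem c, Or.inl ⟨h, Or.inl rfl⟩⟩
    · exact Or.inr ⟨c, N.mem c, Or.inl ⟨h, Or.inr rfl⟩⟩
    · exact Or.inr ⟨c, N.mem c, Or.inr ⟨h, Or.inl rfl⟩⟩
    · exact Or.inr ⟨c, N.mem c, Or.inr ⟨h, Or.inr rfl⟩⟩

theorem connected_iff {p : D.Pt} {i : ℕ} :
    Connected (ws ++ smoothingEdges cs (N.crs.map σ)) (N.num p) i ↔
      ∃ q, D.SameCircle σ p q ∧ N.num q = i := by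
  constructor
  · intro h
    -- The generated relation is reflexive also at numbers that are not attached to a point, hence
    -- the first alternative.
    have key : ∀ {i j}, Connected (ws ++ smoothingEdges cs (N.crs.map σ)) i j →
        i = j ∨ ∃ p q, N.num p = i ∧ N.num q = j ∧ D.SameCircle σ p q := by
      intro i j h
      induction h with
      | rel i j h =>
        obtain ⟨p, q, h', e⟩ := N.mem_edges.1 h
        rw [Prod.mk.injEq] at e
        exact Or.inr ⟨p, q, e.1.symm, e.2.symm, h'.sameCircle⟩
      | refl i => exact Or.inl rfl
      | symm i j _ ih =>
        rcases ih with rfl | ⟨p, q, rfl, rfl, h⟩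
        exacts [Or.inl rfl, Or.inr ⟨q, p, rfl, rfl, h.symm⟩]
      | trans i j k _ _ ih₁ ih₂ =>
        rcases ih₁ with rfl | ⟨p, q, rfl, rfl, h⟩
        · exact ih₂
        · rcases ih₂ with rfl | ⟨q', r, h', rfl, h''⟩
          · exact Or.inr ⟨p, q, rfl, rfl, h⟩
          · exact Or.inr ⟨p, r, rfl, rfl, h.trans (N.injective h' ▸ h'')⟩
    rcases key h with rfl | ⟨p', q, h₁, rfl, h₂⟩
    · exact ⟨p, SameCircle.refl _ _, rfl⟩
    · exact ⟨q, N.injective h₁ ▸ h₂, rfl⟩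
  · rintro ⟨q, h, rfl⟩
    induction h with
    | rel p q h => exact EqvGen.rel _ _ (N.mem_edges.2 ⟨p, q, h, rfl⟩)
    | refl p => exact EqvGen.refl _
    | symm p q _ ih => exact EqvGen.symm _ _ ih
    | trans p q r _ _ ih₁ ih₂ => exact EqvGen.trans _ _ _ ih₁ ih₂

/-- The circles of the complete smoothing at `σ`. -/
def circles (σ : D.Cr → Bool) : List ℕ :=
  join (join (singletons n) ws) (smoothingEdges cs (N.crs.map σ))

theorem isPartition (σ : D.Cr → Bool) :
    IsPartition n (ws ++ smoothingEdges cs (N.crs.map σ)) (N.circles σ) := by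
  have h : ∀ w ∈ ws ++ smoothingEdges cs (N.crs.map σ), w.1 < n ∧ w.2 < n := fun w hw => by
    obtain ⟨p, q, -, rfl⟩ := N.mem_edges.1 hw
    exact ⟨N.lt p, N.lt q⟩
  exact ((IsPartition.singletons n).join fun w hw => h w (List.mem_append_left _ hw)).join
    fun w hw => h w (List.mem_append_right _ hw)

/-- The number `x` codes the set of the points which satisfy `P`. -/
def Codes (x : ℕ) (P : D.Pt → Prop) : Prop := ∀ i, x.testBit i = true ↔ ∃ q, P q ∧ N.num q = i

variable {N}

theorem Codes.testBit_num {x : ℕ} {P : D.Pt → Prop} (h : N.Codes x P) (p : D.Pt) :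
    x.testBit (N.num p) = true ↔ P p := by
  rw [h]
  exact ⟨fun ⟨q, hq, e⟩ => N.injective e ▸ hq, fun hp => ⟨p, hp, rfl⟩⟩

theorem Codes.eq {x y : ℕ} {P Q : D.Pt → Prop} (h : N.Codes x P) (h' : N.Codes y Q)
    (e : ∀ p, P p ↔ Q p) : x = y := by
  obtain rfl : P = Q := funext fun p => propext (e p)
  exact Nat.eq_of_testBit_eq fun i => Bool.eq_iff_iff.2 ((h i).trans (h' i).symm)

theorem Codes.lor {x y : ℕ} {P Q : D.Pt → Prop} (h : N.Codes x P) (h' : N.Codes y Q) :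
    N.Codes (Nat.lor x y) fun p => P p ∨ Q p := fun i => by
  change (x ||| y).testBit i = true ↔ _
  rw [Nat.testBit_or, Bool.or_eq_true, h, h', ← exists_or]
  simp only [or_and_right]

variable (N)

theorem exists_codes_of_mem {m : ℕ} (hm : m ∈ N.circles σ) {i : ℕ} (hi : m.testBit i = true) :
    ∃ p, N.num p = i ∧ N.Codes m fun q => D.SameCircle σ p q := by
  obtain ⟨p, rfl⟩ := N.surjective i ((N.isPartition σ).lt m hm i hi)
  exact ⟨p, rfl, fun j => by rw [(N.isPartition σ).testBit_iff m hm _ j hi, N.connected_iff]⟩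

theorem codes_classOf (σ : D.Cr → Bool) (p : D.Pt) :
    N.Codes (classOf (N.circles σ) (N.num p)) fun q => D.SameCircle σ p q := fun i => by
  rw [(N.isPartition σ).testBit_classOf (N.lt p), N.connected_iff]

/-- The set of points labelled `X` is the union of the base circle and those other circles that
contain a point labelled `X`. -/
theorem exists_mem_statesAt (S : D.ReducedState base) :
    ∃ x ∈ statesAt (N.circles S.1.smoothing) (N.num base), N.Codes x fun p => S.1.isX p = true := by
  refine ⟨_, mem_labelings.2 ⟨(removeClass (N.circles S.1.smoothing) (N.num base)).filter
    (fun m => ∃ p, m.testBit (N.num p) = true ∧ S.1.isX p = true), List.filter_sublist, rfl⟩, ?_⟩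
  intro i
  rw [testBit_foldr_lor, N.codes_classOf]
  simp only [List.mem_filter, mem_removeClass, decide_eq_true_eq]
  constructor
  · rintro (⟨q, h, rfl⟩ | ⟨m, ⟨⟨hm, -⟩, p, hp, hpX⟩, hi⟩)
    · exact ⟨q, (S.1.isX_eq h).symm.trans S.2, rfl⟩
    · obtain ⟨p', e, h⟩ := N.exists_codes_of_mem hm hp
      obtain rfl := N.injective e
      obtain ⟨q, hq, rfl⟩ := (h i).1 hi
      exact ⟨q, (S.1.isX_eq hq).symm.trans hpX, rfl⟩
  · rintro ⟨q, hq, rfl⟩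
    by_cases h : D.SameCircle S.1.smoothing base q
    · exact Or.inl ⟨q, h, rfl⟩
    · obtain ⟨m, hm, hmq⟩ := (N.isPartition S.1.smoothing).cover _ (N.lt q)
      refine Or.inr ⟨m, ⟨⟨hm, ?_⟩, q, hmq, hq⟩, hmq⟩
      by_contra hb
      rw [Bool.not_eq_false] at hb
      obtain ⟨p, e, h'⟩ := N.exists_codes_of_mem hm hb
      obtain rfl := N.injective e
      exact h ((h'.testBit_num q).1 hmq)

theorem exists_state {x : ℕ} (hx : x ∈ statesAt (N.circles σ) (N.num base)) :
    ∃ S : D.ReducedState base, S.1.smoothing = σ ∧ N.Codes x fun p => S.1.isX p = true := by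
  obtain ⟨M, hM, rfl⟩ := mem_labelings.1 hx
  have hM : ∀ m ∈ M, m ∈ N.circles σ := fun m hm => (mem_removeClass.1 (hM.subset hm)).1
  refine ⟨⟨⟨σ, fun p => (M.foldr Nat.lor (classOf (N.circles σ) (N.num base))).testBit (N.num p),
    fun p q h => ?_⟩, ?_⟩, rfl, fun i => ?_⟩
  · rw [Bool.eq_iff_iff, testBit_foldr_lor, testBit_foldr_lor]
    have key : ∀ {p q}, D.SameCircle σ p q →
        (classOf (N.circles σ) (N.num base)).testBit (N.num p) = true ∨
          (∃ m ∈ M, m.testBit (N.num p) = true) →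
        (classOf (N.circles σ) (N.num base)).testBit (N.num q) = true ∨
          ∃ m ∈ M, m.testBit (N.num q) = true := by
      rintro p q h (h' | ⟨m, hm, h'⟩)
      · rw [(N.codes_classOf σ base).testBit_num] at h' ⊢
        exact Or.inl (h'.trans h)
      · obtain ⟨p', e, h''⟩ := N.exists_codes_of_mem (hM m hm) h'
        obtain rfl := N.injective e
        exact Or.inr ⟨m, hm, (h''.testBit_num q).2 h⟩
    exact ⟨key h.sameCircle, key h.sameCircle.symm⟩
  · exact testBit_foldr_lor.2
      (Or.inl (((N.codes_classOf σ base).testBit_num base).2 (SameCircle.refl _ _)))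
  · constructor
    · intro hi
      obtain ⟨q, rfl⟩ : ∃ q, N.num q = i := by
        rcases testBit_foldr_lor.1 hi with h | ⟨m, hm, h⟩
        · obtain ⟨q, -, rfl⟩ := (N.codes_classOf σ base i).1 h
          exact ⟨q, rfl⟩
        · exact N.surjective i ((N.isPartition σ).lt m (hM m hm) i h)
      exact ⟨q, hi, rfl⟩
    · rintro ⟨q, hq, rfl⟩
      exact hq

/-- The number which codes the points labelled `X`. -/
noncomputable def mask (S : D.ReducedState base) : ℕ := (N.exists_mem_statesAt S).choose

theorem mask_mem (S : D.ReducedState base) :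
    N.mask S ∈ statesAt (N.circles S.1.smoothing) (N.num base) :=
  (N.exists_mem_statesAt S).choose_spec.1

theorem codes_mask (S : D.ReducedState base) : N.Codes (N.mask S) fun p => S.1.isX p = true :=
  (N.exists_mem_statesAt S).choose_spec.2

theorem exists_mask_eq {x : ℕ} (hx : x ∈ statesAt (N.circles σ) (N.num base)) :
    ∃ S : D.ReducedState base, S.1.smoothing = σ ∧ N.mask S = x :=
  let ⟨S, h, h'⟩ := N.exists_state hx
  ⟨S, h, (N.codes_mask S).eq h' fun _ => Iff.rfl⟩

theorem mask_eq_iff {S T : D.ReducedState base} :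
    N.mask S = N.mask T ↔ S.1.isX = T.1.isX := by
  constructor
  · intro h
    funext p
    rw [Bool.eq_iff_iff, ← (N.codes_mask S).testBit_num, h, (N.codes_mask T).testBit_num]
  · intro h
    exact (N.codes_mask S).eq (N.codes_mask T) fun p => by rw [h]

theorem smoothing_eq {σ σ' : D.Cr → Bool} (h : N.crs.map σ = N.crs.map σ') : σ = σ' :=
  funext fun c => List.map_inj_left.1 h c (N.mem c)

theorem exists_smoothing {s : List Bool} (hs : s.length = cs.length) :
    ∃ σ : D.Cr → Bool, N.crs.map σ = s := by
  refine ⟨fun c => s.getD (N.crs.idxOf c) false, List.ext_getElem ?_ fun i h₁ h₂ => ?_⟩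
  · rw [List.length_map, hs, N.length_eq]
  · rw [List.getElem_map, N.nodup.idxOf_getElem, List.getD_eq_getElem _ _ h₂]

theorem exists_cubeTree : ∃ T, (∀ (α : Type) (k : CubeTree → α),
    cubeTree cs (join (singletons n) ws) k = k T) ∧
      ∀ σ : D.Cr → Bool, T.get (N.crs.map σ) = N.circles σ := by
  obtain ⟨T, h, h'⟩ := KhovanovProgram.exists_cubeTree cs (join (singletons n) ws)
  exact ⟨T, h, fun σ => h' _ (by rw [List.length_map, N.length_eq])⟩

/-- A state is determined by its vertex and its mask, and these pairs occur in the enumerated list.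
An upper bound is enough, so it does not matter whether the list has repetitions. -/
theorem card_le {T : CubeTree} (hT : ∀ σ : D.Cr → Bool, T.get (N.crs.map σ) = N.circles σ) :
    Fintype.card (D.ReducedState base) ≤ countStates T (N.num base) (vertices cs.length) := by
  let l : List (List Bool × ℕ) := (vertices cs.length).flatMap fun s =>
    (statesAt (T.get s) (N.num base)).map fun x => (s, x)
  have hlen : l.length = countStates T (N.num base) (vertices cs.length) := by
    simp only [l]
    induction vertices cs.length with
    | nil => rfl
    | cons s ss ih =>
      rw [List.flatMap_cons, List.length_append, List.length_map, ih]
      rfl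
  rw [← hlen, ← Fintype.card_fin l.length]
  have hmem : ∀ S : D.ReducedState base, (N.crs.map S.1.smoothing, N.mask S) ∈ l := fun S =>
    List.mem_flatMap.2 ⟨_, mem_vertices.2 (by rw [List.length_map, N.length_eq]),
      List.mem_map.2 ⟨_, hT _ ▸ N.mask_mem S, rfl⟩⟩
  choose f hf using fun S => List.mem_iff_get.1 (hmem S)
  refine Fintype.card_le_of_injective f fun S T h => ?_
  have := (hf S).symm.trans ((congrArg l.get h).trans (hf T))
  rw [Prod.mk.injEq] at this
  exact Subtype.ext (EnhancedState.ext (N.smoothing_eq this.1) (N.mask_eq_iff.1 this.2))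

/-- The program is correct along one edge of the cube. The four cases ask whether the ends of the
under-strand share a circle before and after the change; if the answers agree there are no targets.
The list of targets has no repetitions, so its sum modulo 2 counts each of them. -/
theorem exists_targets (S : D.ReducedState base) {c : D.Cr} (hc : S.1.smoothing c = false) :
    ∃ l : List (D.ReducedState base), l.Nodup ∧
      (∀ T, T ∈ l ↔ T.1.smoothing = update S.1.smoothing c true ∧ S.1.Incident T.1) ∧
      (edgeKind (N.code c) (N.circles S.1.smoothing)
        (N.circles (update S.1.smoothing c true))).targets (N.mask S) = l.map N.mask := by
  have hbit : ∀ σ p q, bit (classOf (N.circles σ) (N.num p)) (N.num q) = true ↔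
      D.SameCircle σ p q := fun σ p q => by
    rw [bit_eq_testBit, (N.codes_classOf σ p).testBit_num]
  have hS : ∀ p, bit (N.mask S) (N.num p) = S.1.isX p := fun p => by
    rw [bit_eq_testBit, Bool.eq_iff_iff, (N.codes_mask S).testBit_num]
  have hex : ∀ P : D.Pt → Prop,
      (∀ p q, D.SameCircle (update S.1.smoothing c true) p q → P p → P q) →
      (S.1.isX (D.cross c 0) = S.1.isX (D.cross c 2) ∨ P (D.cross c 0) ∧ P (D.cross c 2)) →
      ∃ T : D.ReducedState base, T.1.smoothing = update S.1.smoothing c true ∧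
        ∀ p, T.1.isX p = true ↔ S.1.isX p = true ∨ P p := fun P hP h => by
    obtain ⟨T, h₁, h₂⟩ := S.1.exists_update c P hP h
    exact ⟨⟨T, (h₂ _).2 (Or.inl S.2)⟩, h₁, h₂⟩
  have heq : ∀ {T T' : D.ReducedState base} {P : D.Pt → Prop},
      T'.1.smoothing = update S.1.smoothing c true → (∀ p, T'.1.isX p = true ↔ P p) →
      (T = T' ↔ T.1.smoothing = update S.1.smoothing c true ∧ ∀ p, T.1.isX p = true ↔ P p) := by
    intro T T' P h₁ h₂
    constructor
    · rintro rfl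
      exact ⟨h₁, h₂⟩
    · exact fun ⟨h₃, h₄⟩ => Subtype.ext (EnhancedState.ext (h₃.trans h₁.symm)
        (funext fun p => Bool.eq_iff_iff.2 ((h₄ p).trans (h₂ p).symm)))
  have hmask : ∀ {T : D.ReducedState base} {a : D.Pt},
      (∀ p, T.1.isX p = true ↔ S.1.isX p = true ∨ D.SameCircle (update S.1.smoothing c true) a p) →
      Nat.lor (N.mask S) (classOf (N.circles (update S.1.smoothing c true)) (N.num a)) =
        N.mask T := fun h =>
    ((N.codes_mask S).lor (N.codes_classOf _ _)).eq (N.codes_mask _) fun p => (h p).symm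
  have hmask' : ∀ {T : D.ReducedState base},
      (∀ p, T.1.isX p = true ↔ S.1.isX p = true ∨ False) → N.mask S = N.mask T := fun h =>
    (N.codes_mask S).eq (N.codes_mask _) fun p => ((h p).trans (or_iff_left id)).symm
  have hclosed : ∀ a p q, D.SameCircle (update S.1.smoothing c true) p q →
      D.SameCircle (update S.1.smoothing c true) a p →
      D.SameCircle (update S.1.smoothing c true) a q := fun a p q h h' => h'.trans h
  have hempty : (D.SameCircle S.1.smoothing (D.cross c 0) (D.cross c 2) ↔
      D.SameCircle (update S.1.smoothing c true) (D.cross c 0) (D.cross c 2)) →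
      ∀ T : D.ReducedState base, T ∈ ([] : List (D.ReducedState base)) ↔
        T.1.smoothing = update S.1.smoothing c true ∧ S.1.Incident T.1 := by
    intro h T
    simp only [List.not_mem_nil, false_iff]
    rintro ⟨h₁, h₂⟩
    rcases ((EnhancedState.incident_iff (Or.inl ⟨rfl, rfl⟩) hc h₁).1 h₂).2 with
      ⟨h₃, h₄, -⟩ | ⟨h₃, h₄, -⟩ <;> rw [h₁] at h₄
    exacts [h₃ (h.2 h₄), h₄ (h.1 h₃)]
  by_cases h : D.SameCircle S.1.smoothing (D.cross c 0) (D.cross c 2) <;>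
    by_cases h' : D.SameCircle (update S.1.smoothing c true) (D.cross c 0) (D.cross c 2)
  · refine ⟨[], List.nodup_nil, hempty (iff_of_true h h'), ?_⟩
    simp only [edgeKind, code, (hbit _ _ _).2 h, (hbit _ _ _).2 h']
    rfl
  · have e : edgeKind (N.code c) (N.circles S.1.smoothing)
        (N.circles (update S.1.smoothing c true)) = .split (N.num (D.cross c 0))
          (classOf (N.circles (update S.1.smoothing c true)) (N.num (D.cross c 0)))
          (classOf (N.circles (update S.1.smoothing c true)) (N.num (D.cross c 2))) := by
      simp only [edgeKind, code, (hbit _ _ _).2 h, Bool.eq_false_iff.2 (mt (hbit _ _ _).1 h'),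
        cond_true, cond_false]
    rw [e]
    have hab := S.1.isX_eq h
    cases ha : S.1.isX (D.cross c 0) with
    | true =>
      obtain ⟨T, h₁, h₂⟩ := hex (fun _ => False) (fun _ _ _ => id) (Or.inl hab)
      refine ⟨[T], List.nodup_singleton T, fun T' => ?_, ?_⟩
      · rw [List.mem_singleton, heq h₁ fun p => (h₂ p).trans (or_iff_left id)]
        refine and_congr_right fun h₃ => ?_
        rw [EnhancedState.incident_iff_split hc h₃ h (h₃ ▸ h'), if_pos ha]
      · rw [EdgeKind.targets, hS, ha, cond_true, hmask' h₂]
        rfl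
    | false =>
      obtain ⟨T₁, h₁, h₂⟩ := hex _ (hclosed (D.cross c 0)) (Or.inl hab)
      obtain ⟨T₂, h₃, h₄⟩ := hex _ (hclosed (D.cross c 2)) (Or.inl hab)
      refine ⟨[T₁, T₂], ?_, fun T' => ?_, ?_⟩
      · refine List.nodup_cons.2 ⟨fun h₅ => ?_, List.nodup_singleton _⟩
        have h₅ := List.mem_singleton.1 h₅
        have := (h₂ (D.cross c 0)).2 (Or.inr (SameCircle.refl _ _))
        rw [h₅, h₄, ha] at this
        exact this.elim (by simp) fun h₆ => h' h₆.symm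
      · rw [List.mem_cons, List.mem_singleton, heq h₁ h₂, heq h₃ h₄, ← and_or_left]
        refine and_congr_right fun h₅ => ?_
        rw [EnhancedState.incident_iff_split hc h₅ h (h₅ ▸ h'), if_neg (by simp [ha]), h₅]
      · rw [EdgeKind.targets, hS, ha, cond_false, hmask h₂, hmask h₄]
        rfl
  · have e : edgeKind (N.code c) (N.circles S.1.smoothing)
        (N.circles (update S.1.smoothing c true)) =
          .merge (N.num (D.cross c 0)) (N.num (D.cross c 2))
            (classOf (N.circles (update S.1.smoothing c true)) (N.num (D.cross c 0))) := by
      simp only [edgeKind, code, Bool.eq_false_iff.2 (mt (hbit _ _ _).1 h), (hbit _ _ _).2 h',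
        cond_true, cond_false]
    rw [e, EdgeKind.targets, hS, hS]
    cases ha : S.1.isX (D.cross c 0) with
    | true =>
      cases hb : S.1.isX (D.cross c 2) with
      | true =>
        refine ⟨[], List.nodup_nil, fun T => ?_, rfl⟩
        simp only [List.not_mem_nil, false_iff]
        rintro ⟨h₁, h₂⟩
        exact ((EnhancedState.incident_iff_merge hc h₁ h (h₁ ▸ h')).1 h₂).1 ⟨ha, hb⟩
      | false =>
        obtain ⟨T, h₁, h₂⟩ := hex _ (hclosed (D.cross c 0)) (Or.inr ⟨SameCircle.refl _ _, h'⟩)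
        refine ⟨[T], List.nodup_singleton T, fun T' => ?_, ?_⟩
        · rw [List.mem_singleton, heq h₁ h₂]
          refine and_congr_right fun h₃ => ?_
          rw [EnhancedState.incident_iff_merge hc h₃ h (h₃ ▸ h'), h₃]
          simp [ha, hb]
        · rw [cond_true, cond_false, hmask h₂]
          rfl
    | false =>
      cases hb : S.1.isX (D.cross c 2) with
      | true =>
        obtain ⟨T, h₁, h₂⟩ := hex _ (hclosed (D.cross c 0)) (Or.inr ⟨SameCircle.refl _ _, h'⟩)
        refine ⟨[T], List.nodup_singleton T, fun T' => ?_, ?_⟩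
        · rw [List.mem_singleton, heq h₁ h₂]
          refine and_congr_right fun h₃ => ?_
          rw [EnhancedState.incident_iff_merge hc h₃ h (h₃ ▸ h'), h₃]
          simp [ha, hb]
        · rw [cond_true, cond_false, hmask h₂]
          rfl
      | false =>
        obtain ⟨T, h₁, h₂⟩ := hex (fun _ => False) (fun _ _ _ => id) (Or.inl (ha.trans hb.symm))
        refine ⟨[T], List.nodup_singleton T, fun T' => ?_, ?_⟩
        · rw [List.mem_singleton, heq h₁ h₂]
          refine and_congr_right fun h₃ => ?_
          rw [EnhancedState.incident_iff_merge hc h₃ h (h₃ ▸ h')]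
          simp [ha, hb]
        · rw [cond_false, cond_false, hmask' h₂]
          rfl
  · refine ⟨[], List.nodup_nil, hempty (iff_of_false h h'), ?_⟩
    simp only [edgeKind, code, Bool.eq_false_iff.2 (mt (hbit _ _ _).1 h),
      Bool.eq_false_iff.2 (mt (hbit _ _ _).1 h')]
    rfl

end Numbering

end PlanarDiagram

/-! ### The number of pivots bounds the rank of the differential. -/

namespace PlanarDiagram.Numbering

open Function KhovanovProgram
open scoped Classical

variable {D : PlanarDiagram} {n : ℕ} {cs : List CrossingCode} {ws : List (ℕ × ℕ)}
  (N : D.Numbering n cs ws) {base : D.Pt}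

/-- The number of the basis vector which represents a state. -/
noncomputable def pos (p q : ℕ) (S : D.ReducedState base) : ℕ :=
  position p q (vertexNumber (N.crs.map S.1.smoothing)) (N.mask S)

/-- The linear extension of `pos`. -/
noncomputable def posMap (base : D.Pt) (p q : ℕ) :
    (D.ReducedState base → ZMod 2) →ₗ[ZMod 2] (ℕ → ZMod 2) :=
  Fintype.linearCombination (ZMod 2) fun S => Pi.single (N.pos p q S) 1

/-- The edges of the cube which start at `σ`. -/
noncomputable def edges (σ : D.Cr → Bool) : List (ℕ × EdgeKind) :=
  (N.crs.filter fun c => !σ c).map fun c => (vertexNumber (N.crs.map (update σ c true)),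
    edgeKind (N.code c) (N.circles σ) (N.circles (update σ c true)))

/-- A target of `S` determines the crossing that changes, so the lists of targets at different
crossings are disjoint and no terms cancel before `posMap` is applied. -/
theorem vec_column_eq (p q : ℕ) (S : D.ReducedState base) :
    vec (column p q (N.mask S) (N.edges S.1.smoothing)) =
      N.posMap base p q ((D.incidence base).mulVecLin (Pi.single S 1)) := by
  have vec_map : ∀ l : List (D.ReducedState base),
      vec (l.map (N.pos p q)) = (l.map fun T => Pi.single (N.pos p q T) 1).sum := fun l => by
    induction l with
    | nil => rfl
    | cons T l ih => rw [List.map_cons, vec_cons, ih, List.map_cons, List.sum_cons]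
  choose! l h₁ h₂ h₃ using fun c => N.exists_targets S (c := c)
  have hf : ∀ c ∈ N.crs.filter fun c => !S.1.smoothing c, S.1.smoothing c = false := by
    intro c hc
    simpa using (List.mem_filter.1 hc).2
  have hcol : ((N.edges S.1.smoothing).flatMap fun e =>
      (e.2.targets (N.mask S)).map (position p q e.1)) =
        ((N.crs.filter fun c => !S.1.smoothing c).flatMap l).map (N.pos p q) := by
    rw [edges, List.flatMap_map, List.map_flatMap]
    refine List.flatMap_congr fun c hc => ?_
    rw [h₃ c (hf c hc), List.map_map]
    refine List.map_congr_left fun T hT => ?_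
    rw [comp_apply, pos, ((h₂ c (hf c hc) T).1 hT).1]
  have hmem : ∀ T, T ∈ (N.crs.filter fun c => !S.1.smoothing c).flatMap l ↔
      S.1.Incident T.1 := by
    intro T
    rw [List.mem_flatMap]
    constructor
    · rintro ⟨c, hc, hT⟩
      exact ((h₂ c (hf c hc) T).1 hT).2
    · intro h
      obtain ⟨c, hc, hT⟩ := h.exists_update
      exact ⟨c, List.mem_filter.2 ⟨N.mem c, by simp [hc]⟩, (h₂ c hc T).2 ⟨hT, h⟩⟩
  have hnodup : ((N.crs.filter fun c => !S.1.smoothing c).flatMap l).Nodup := by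
    refine List.nodup_flatMap.2 ⟨fun c hc => h₁ c (hf c hc), ?_⟩
    refine List.Pairwise.imp_of_mem ?_ (N.nodup.filter _)
    intro c d hc hd hcd T hT hT'
    have e := ((h₂ c (hf c hc) T).1 hT).1.symm.trans ((h₂ d (hf d hd) T).1 hT').1
    have := congrFun e c
    rw [update_self, update_of_ne hcd, hf c hc] at this
    cases this
  rw [vec_column, hcol, vec_map, ← List.sum_toFinset _ hnodup, posMap,
    Fintype.linearCombination_apply, Matrix.mulVecLin_apply, Matrix.mulVec_single_one]
  simp only [Matrix.col_apply, incidence, Matrix.of_apply, ite_smul, one_smul, zero_smul]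
  rw [← Finset.sum_filter]
  refine Finset.sum_congr ?_ fun _ _ => rfl
  ext T
  rw [List.mem_toFinset, hmem, Finset.mem_filter]
  simp

/-- The hashing of states to positions need not be injective. The program works in the image of the
column space under the linear map `posMap`, whose dimension is at most the rank; collisions could
only lose pivots. -/
theorem eliminateVertices_le_rank {T : CubeTree}
    (hT : ∀ σ : D.Cr → Bool, T.get (N.crs.map σ) = N.circles σ) (p q : ℕ) :
    eliminateVertices p q T cs (N.num base) (vertices cs.length) .leaf 0 ≤
      (D.incidence base).rank := by
  refine le_trans (eliminateVertices_le
    (W := (LinearMap.range (D.incidence base).mulVecLin).map (N.posMap base p q))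
    (fun s hs => ?_) isValid_leaf) (Submodule.finrank_map_le _ _)
  obtain ⟨σ, rfl⟩ := N.exists_smoothing (mem_vertices.1 hs)
  refine ⟨N.edges σ, fun k => ?_, fun x hx => ?_⟩
  · have e : edgesAt T (T.get (N.crs.map σ)) [] cs (N.crs.map σ) k = edgesAt T
        (T.get (N.crs.map σ)) [] (N.crs.map N.code) (N.crs.map σ) k :=
      congrArg (fun cs => edgesAt T _ [] cs _ k) N.crossings
    rw [e, edgesAt_eq _ _ _ _ _ N.nodup]
    simp only [List.nil_append, hT, edges]
  · rw [hT] at hx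
    obtain ⟨S, rfl, rfl⟩ := N.exists_mask_eq hx
    rw [vec_column_eq]
    exact Submodule.mem_map_of_mem (LinearMap.mem_range_self _ _)

end PlanarDiagram.Numbering

/-! ### Numberings compatible with the operations on tangles. -/

namespace TangleDiagram

open Function KhovanovProgram
open scoped Classical

/-- A numbering of the marked points of a tangle. -/
structure Numbering (A : TangleDiagram) (C : TangleCode) extends
    PlanarDiagram.Numbering A.toPlanarDiagram C.size C.crossings C.wires where
  nw_eq : C.nw = num A.nw
  ne_eq : C.ne = num A.ne
  sw_eq : C.sw = num A.sw
  se_eq : C.se = num A.se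

namespace Numbering

variable {A B : TangleDiagram} {C C' : TangleCode}

def zero : TangleDiagram.zero.Numbering TangleCode.zero where
  num := Fin.val
  crs := []
  injective := Fin.val_injective
  lt p := p.2
  surjective i hi := ⟨⟨i, hi⟩, rfl⟩
  nodup := List.nodup_nil
  mem c := c.elim
  crossings := rfl
  wires w := by
    constructor
    · intro h
      rcases List.mem_cons.1 h with rfl | h
      · exact ⟨(0 : Fin 4), (1 : Fin 4), Or.inl ⟨rfl, rfl⟩, rfl⟩
      · obtain rfl := List.mem_singleton.1 h
        exact ⟨(2 : Fin 4), (3 : Fin 4), Or.inr ⟨rfl, rfl⟩, rfl⟩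
    · rintro ⟨p, q, ⟨rfl, rfl⟩ | ⟨rfl, rfl⟩, rfl⟩
      · exact List.mem_cons_self
      · exact List.mem_cons_of_mem _ List.mem_cons_self
  nw_eq := rfl
  ne_eq := rfl
  sw_eq := rfl
  se_eq := rfl

def crossing (s : Bool) : (TangleDiagram.crossing s).Numbering (TangleCode.crossing s) where
  num := Fin.val
  crs := [()]
  injective := Fin.val_injective
  lt p := p.2
  surjective i hi := ⟨⟨i, hi⟩, rfl⟩
  nodup := List.nodup_singleton _
  mem _ := List.mem_singleton.2 rfl
  crossings := by cases s <;> rfl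
  wires w := ⟨fun h => absurd h List.not_mem_nil, fun ⟨_, _, h, _⟩ => h.elim⟩
  nw_eq := rfl
  ne_eq := rfl
  sw_eq := rfl
  se_eq := rfl

def rot (N : A.Numbering C) : A.rot.Numbering C.rot where
  toNumbering := N.toNumbering
  nw_eq := N.ne_eq
  ne_eq := N.se_eq
  sw_eq := N.nw_eq
  se_eq := N.sw_eq

def add (N : A.Numbering C) (N' : B.Numbering C') : (A.add B).Numbering (C.add C') where
  num := Sum.elim N.num fun p => C.size + N'.num p
  crs := N.crs.map Sum.inl ++ N'.crs.map Sum.inr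
  injective := by
    rintro (p | p) (q | q) h
    · exact congrArg _ (N.injective h)
    · have h : N.num p = C.size + N'.num q := h
      have := N.lt p
      omega
    · have h : C.size + N'.num p = N.num q := h
      have := N.lt q
      omega
    · exact congrArg _ (N'.injective (Nat.add_left_cancel h))
  lt := by
    rintro (p | p)
    · exact Nat.lt_add_right _ (N.lt p)
    · exact Nat.add_lt_add_left (N'.lt p) _
  surjective i hi := by
    by_cases h : i < C.size
    · obtain ⟨p, rfl⟩ := N.surjective i h
      exact ⟨Sum.inl p, rfl⟩
    · have hi : i < C.size + C'.size := hi
      obtain ⟨p, hp⟩ := N'.surjective (i - C.size) (by omega)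
      refine ⟨Sum.inr p, ?_⟩
      change C.size + N'.num p = i
      omega
  nodup := by
    refine List.Nodup.append (N.nodup.map Sum.inl_injective) (N'.nodup.map Sum.inr_injective) ?_
    intro c hc hc'
    obtain ⟨d, -, rfl⟩ := List.mem_map.1 hc
    obtain ⟨d', -, h⟩ := List.mem_map.1 hc'
    cases h
  mem := by
    rintro (c | c)
    · exact List.mem_append_left _ (List.mem_map_of_mem (N.mem c))
    · exact List.mem_append_right _ (List.mem_map_of_mem (N'.mem c))
  crossings := by
    let f : CrossingCode → CrossingCode := fun c =>
      (C.size + c.1, C.size + c.2.1, C.size + c.2.2.1, C.size + c.2.2.2)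
    change C.crossings ++ C'.crossings.map f =
      List.map (α := A.Cr ⊕ B.Cr) _ (N.crs.map Sum.inl ++ N'.crs.map Sum.inr)
    refine Eq.trans ?_ List.map_append.symm
    refine congrArg₂ _ (Eq.trans ?_ List.map_map.symm) (Eq.trans ?_ List.map_map.symm)
    · exact N.crossings
    · exact (congrArg (List.map f) N'.crossings).trans List.map_map
  wires w := by
    change w ∈ (C.ne, C.size + C'.nw) :: (C.se, C.size + C'.sw) ::
      (C.wires ++ C'.wires.map fun w => (C.size + w.1, C.size + w.2)) ↔ _
    rw [List.mem_cons, List.mem_cons, List.mem_append, List.mem_map, N.wires, N.ne_eq, N.se_eq,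
      N'.nw_eq, N'.sw_eq]
    constructor
    · rintro (rfl | rfl | ⟨p, q, h, rfl⟩ | ⟨w, hw, rfl⟩)
      · exact ⟨Sum.inl A.ne, Sum.inr B.nw, Or.inl ⟨rfl, rfl⟩, rfl⟩
      · exact ⟨Sum.inl A.se, Sum.inr B.sw, Or.inr ⟨rfl, rfl⟩, rfl⟩
      · exact ⟨Sum.inl p, Sum.inl q, h, rfl⟩
      · obtain ⟨p, q, h, rfl⟩ := (N'.wires w).1 hw
        exact ⟨Sum.inr p, Sum.inr q, h, rfl⟩
    · rintro ⟨p | p, q | q, h, rfl⟩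
      · exact Or.inr (Or.inr (Or.inl ⟨p, q, h, rfl⟩))
      · rcases h with ⟨rfl, rfl⟩ | ⟨rfl, rfl⟩
        · exact Or.inl rfl
        · exact Or.inr (Or.inl rfl)
      · exact h.elim
      · exact Or.inr (Or.inr (Or.inr ⟨_, (N'.wires _).2 ⟨p, q, h, rfl⟩, rfl⟩))
  nw_eq := N.nw_eq
  ne_eq := congrArg (C.size + ·) N'.ne_eq
  sw_eq := N.sw_eq
  se_eq := congrArg (C.size + ·) N'.se_eq

def twist (s : Bool) : ∀ n, (TangleDiagram.twist s n).Numbering (TangleCode.twist s n)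
  | 0 => zero
  | n + 1 => (twist s n).add (crossing s)

def montesinos : TangleDiagram.montesinos.Numbering TangleCode.montesinos :=
  ((twist true 2).rot.add ((twist false 2).add (twist true 2).rot).rot).rot

/-- The numbering of the numerator closure. -/
def numerator (N : A.Numbering C) :
    A.numerator.Numbering C.size C.crossings C.numerator.wires where
  num := N.num
  crs := N.crs
  injective := N.injective
  lt := N.lt
  surjective := N.surjective
  nodup := N.nodup
  mem := N.mem
  crossings := N.crossings
  wires w := by
    change w ∈ (C.nw, C.ne) :: (C.sw, C.se) :: C.wires ↔ _
    rw [List.mem_cons, List.mem_cons, N.wires, N.nw_eq, N.ne_eq, N.sw_eq, N.se_eq]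
    constructor
    · rintro (rfl | rfl | ⟨p, q, h, rfl⟩)
      · exact ⟨_, _, Or.inr (Or.inl ⟨rfl, rfl⟩), rfl⟩
      · exact ⟨_, _, Or.inr (Or.inr ⟨rfl, rfl⟩), rfl⟩
      · exact ⟨p, q, Or.inl h, rfl⟩
    · rintro ⟨p, q, h | ⟨rfl, rfl⟩ | ⟨rfl, rfl⟩, rfl⟩
      · exact Or.inr (Or.inr ⟨p, q, h, rfl⟩)
      · exact Or.inl rfl
      · exact Or.inr (Or.inl rfl)

/-- In the dimension minus twice the rank, overcounting generators and undercounting pivots both err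
upwards, so the computed number is an upper bound for every choice of `p` and `q`. -/
theorem khRank_le (N : A.Numbering C) (p q : ℕ) :
    A.numerator.khRank A.nw ≤ (numStates C : ℤ) - 2 * (numPivots p q C : ℤ) := by
  obtain ⟨T, h₁, h₂⟩ := N.numerator.exists_cubeTree
  have h₃ := N.numerator.card_le (base := A.nw) h₂
  have h₄ := N.numerator.eliminateVertices_le_rank (base := A.nw) h₂ p q
  have e : N.numerator.num A.nw = C.nw := N.nw_eq.symm
  rw [e] at h₃ h₄
  rw [numStates, numPivots, addEdges_eq, addEdges_eq, h₁, h₁]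
  unfold PlanarDiagram.khRank Matrix.homRank
  omega

end Numbering

end TangleDiagram

/-! ### The two computed values and the conclusion. -/

open KhovanovProgram in
set_option maxRecDepth 100000 in
theorem TangleDiagram.khRank_closure_montesinos_twist :
    (closure montesinos (twist false 3)).khRank (Sum.inl montesinos.nw) ≤ 9 := by
  have h₁ : Nat.beq (numStates (TangleCode.montesinos.add (TangleCode.twist false 3))) 3435 =
      true := by decide +kernel
  -- The bound is `3435 - 2 * 1713 = 9`. The numbers 22026 and 64 are hash parameters that yield
  -- enough pivots; residues below 64 keep the positions at different vertices apart.
  have h₂ : Nat.beq (numPivots 22026 64 (TangleCode.montesinos.add (TangleCode.twist false 3)))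
      1713 = true := by decide +kernel
  have h := (Numbering.montesinos.add (Numbering.twist false 3)).khRank_le 22026 64
  rw [Nat.eq_of_beq_eq_true h₁, Nat.eq_of_beq_eq_true h₂] at h
  exact h

open KhovanovProgram in
set_option maxRecDepth 100000 in
theorem TangleDiagram.khRank_closure_montesinos_rot_zero :
    (closure montesinos zero.rot).khRank (Sum.inl montesinos.nw) ≤ 1 := by
  have h₁ : Nat.beq (numStates (TangleCode.montesinos.add TangleCode.zero.rot)) 249 = true := by
    decide +kernel
  -- The bound is `249 - 2 * 124 = 1`.
  have h₂ : Nat.beq (numPivots 46 46 (TangleCode.montesinos.add TangleCode.zero.rot)) 124 =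
      true := by decide +kernel
  have h := (Numbering.montesinos.add Numbering.zero.rot).khRank_le 46 46
  rw [Nat.eq_of_beq_eq_true h₁, Nat.eq_of_beq_eq_true h₂] at h
  exact h

theorem mainTheorem2 :
    (∀ n : ℕ, 0 < n →
      (((TangleDiagram.branchSet true n).rkKh (TangleDiagram.branchSetBase true n) : ℕ) : ℤ) ≤
        16 * (n : ℤ) - 1) ∧
    (∀ n : ℕ, 0 < n →
      (((TangleDiagram.branchSet false n).rkKh (TangleDiagram.branchSetBase false n) : ℕ) : ℤ) ≤
        16 * (n : ℤ) + 1) := by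
  exact ⟨fun n hn => TangleDiagram.rkKh_branchSet_true_le
      TangleDiagram.khRank_closure_montesinos_twist
      TangleDiagram.khRank_closure_montesinos_rot_zero n hn,
    fun n _ => TangleDiagram.rkKh_branchSet_false_le
      TangleDiagram.khRank_closure_montesinos_twist
      TangleDiagram.khRank_closure_montesinos_rot_zero n⟩
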